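/- Let $\Omega\subset\mathbb R^2$ be an open neighbourhood of $0$ and $\phi:\Omega\to\mathbb R$ smooth with $\phi(0)=0$, $\nabla\phi(0)=0$, of finite type at $0$ (some $\partial^\alpha\phi(0)\neq0$). For a smooth function $g$ of finite type near $0\in\mathbb R^2$ let $\mathcal N(g)$ be its Newton polyhedron, i.e. the convex hull of $\bigcup\{t\in\mathbb R^2: t_1\ge\alpha_1,\,t_2\ge\alpha_2\}$ over all $\alpha\in\mathbb N_0^2$ with $\partial^\alpha g(0)\ne0$, and let $d(g)$ be its Newton distance: $(d(g),d(g))$ is the first point of the bisectrix $t_1=t_2$ in $\mathcal N(g)$. The principal face of $\mathcal N(g)$ is its face of minimal dimension containing this point. Let $h(\phi)$ (resp. $h_{\rm lin}(\phi)$) be the supremum of $d(\phi\circ\varphi)$ over all smooth local (resp. linear) coordinate changes $\varphi$ fixing $0$; $\phi$ is called adapted if $d(\phi)=h(\phi)$. Assume that $\phi$ is linearly adapted, $d(\phi)=h_{\rm lin}(\phi)$ (this includes the adapted case). For $w\in[0,\infty)^2$ put $L_w=\{t: w_1t_1+w_2t_2=1\}$. Let $\kappa$ be the weight such that $L_\kappa$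 contains the principal face of $\mathcal N(\phi)$ if this is an edge, and contains the edge of $\mathcal N(\phi)$ with the principal face as its left endpoint if this is a vertex. Assume $\kappa_2\ge\kappa_1$, and put $m=\kappa_2/\kappa_1$. Let $S$ be the graph of $\phi$ with surface measure $d\sigma$, let $0\le\rho\in C_c^\infty(S)$ with $\rho\ne0$ at the origin, and let $p_1,p_3\in[1,\infty]$ with dual exponents $p_1',p_3'$. Suppose that for some constant $C$ $$\Big(\int_S|\widehat f|^2\rho\,d\sigma\Big)^{1/2}\le C\,\|f\|_{L^{p_3}_{x_3}(L^{p_1}_{(x_1,x_2)})}\qquad\text{for all Schwartz functions } f \text{ on }\mathbb R^3 .$$ Then, whether $\phi$ is adapted or not, $$\text{(A)}\qquad \frac1{d(\phi)p_1'}+\frac1{p_3'}\le\frac1{2d(\phi)},\qquad \frac1{p_3'}\le\frac1{2h(\phi)} .$$ Assume moreover that $\phi$ is not adapted. Let $\psi$ be a smooth real function near $0$, $\psi(0)=0$, such that $\phi$ is adapted in the coordinates $y_1=x_1$, $y_2=x_2-\psi(x_1)$; that is, $\phi^a(y)=\phi(y_1,y_2+\psi(y_1))$ has $d(\phi^a)=h(\phi)$.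 Let $P$ be the lowest point of $L_\kappa\cap\mathcal N(\phi^a)$, and let $\mathcal N^{\rm res}(\phi^a)$ be the convex hull of $\mathcal N(\phi^a)\cup\{t\in L_\kappa: t_2\ge P_2\}$. Then $$\text{(B)}\qquad \frac{(1+m)\tilde\kappa_1}{p_1'}+\frac1{p_3'}\le\frac{\tilde\kappa_1+\tilde\kappa_2}2$$ for every $\tilde\kappa\in[0,\infty)^2$ such that $L_{\tilde\kappa}$ is a supporting line to $\mathcal N^{\rm res}(\phi^a)$. Moreover, with $\phi$ not adapted and $\psi$ as above, let $(A_l,B_l)$, $0\le l\le n$, be the vertices of $\mathcal N(\phi^a)$ from left to right, $\gamma_l=[(A_{l-1},B_{l-1}),(A_l,B_l)]$ for $1\le l\le n$ its compact edges, $\gamma_0$ and $\gamma_{n+1}$ its vertical and horizontal unbounded edges, $-1/a_l$ the slope of $\gamma_l$ ($a_0=0$, $a_{n+1}=\infty$), and $\kappa^l$ the weight with $\gamma_l\subset L_{\kappa^l}$. Let $l_0\in\{1,\dots,n+1\}$ be the index with $a_{l_0-1}\le m<a_{l_0}$, and $l^a$ the index of the principal face of $\mathcal N(\phi^a)$, or,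 if this is a vertex, of the edge to its left. Then the following holds for all $p_1',p_3'\in[1,\infty]$ (independently of the estimate). 1. The system (B) is equivalent to the finite system $$\text{(C)}\qquad \frac{(1+m)\kappa_1^l}{p_1'}+\frac1{p_3'}\le\frac{\kappa_1^l+\kappa_2^l}2\quad(l_0\le l\le n+1),\qquad \frac{(1+m)\kappa_1}{p_1'}+\frac1{p_3'}\le\frac{\kappa_1+\kappa_2}2 ,$$ where the condition for $l=n+1$ is void if $B_n=0$ (then $\kappa_2^{n+1}=\infty$). 2. The first condition in (A) is identical with the last condition in (C): $(1+m)\kappa_1=1/d(\phi)=\kappa_1+\kappa_2$. 3. The conditions in (C) with $l>l^a$ are redundant: they follow from those with $l_0\le l\le l^a$ together with the last one. 4. If $p_3'=\infty$, then (A) and (C) together are equivalent to $p_1'\ge2$; if $p_1'=\infty$, they are equivalent to $p_3'\ge2h(\phi)$. (The same equivalences hold for (A) alone, for adapted as well as non-adapted $\phi$.) -/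

import Mathlib

open MeasureTheory
open scoped ENNReal NNReal ContDiff FourierTransform SchwartzMap Topology

noncomputable section

namespace MixedRestriction

/-! ### Newton polyhedra -/

/-- The partial derivative `∂₁^a ∂₂^b φ` at the origin. -/
def partialAtZero (φ : ℝ × ℝ → ℝ) (a b : ℕ) : ℝ :=
  iteratedDeriv a (fun s => iteratedDeriv b (fun t => φ (s, t)) 0) 0

/-- The Taylor support of `φ` at the origin. -/
def taylorSupport (φ : ℝ × ℝ → ℝ) : Set (ℕ × ℕ) :=
  {α | partialAtZero φ α.1 α.2 ≠ 0}

/-- `φ` is of finite type at the origin. -/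
def FiniteType (φ : ℝ × ℝ → ℝ) : Prop :=
  (taylorSupport φ).Nonempty

/-- The Newton polyhedron of `φ`. -/
def newtonPolyhedron (φ : ℝ × ℝ → ℝ) : Set (ℝ × ℝ) :=
  convexHull ℝ (⋃ α ∈ taylorSupport φ, {t : ℝ × ℝ | (α.1 : ℝ) ≤ t.1 ∧ (α.2 : ℝ) ≤ t.2})

/-- The parameter `d` of the first point `(d, d)` of the bisectrix that lies in `N`. -/
def bisectrixParam (N : Set (ℝ × ℝ)) : ℝ :=
  sInf {t : ℝ | (t, t) ∈ N}

/-- The Newton distance `d(φ)`. -/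
def newtonDistance (φ : ℝ × ℝ → ℝ) : ℝ :=
  bisectrixParam (newtonPolyhedron φ)

/-- `e` is a smooth local coordinate change at the origin: a diffeomorphism between open
neighbourhoods of the origin that fixes the origin. -/
def IsCoordChange (e : OpenPartialHomeomorph (ℝ × ℝ) (ℝ × ℝ)) : Prop :=
  (0 : ℝ × ℝ) ∈ e.source ∧ e 0 = 0 ∧
    ContDiffOn ℝ ∞ e e.source ∧ ContDiffOn ℝ ∞ e.symm e.target

/-- The Newton height `h(φ)`. -/
def newtonHeight (φ : ℝ × ℝ → ℝ) : ℝ :=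
  sSup {d : ℝ | ∃ e : OpenPartialHomeomorph (ℝ × ℝ) (ℝ × ℝ),
    IsCoordChange e ∧ d = newtonDistance (φ ∘ e)}

/-- The linear height `h_lin(φ)`. -/
def linearHeight (φ : ℝ × ℝ → ℝ) : ℝ :=
  sSup {d : ℝ | ∃ e : (ℝ × ℝ) ≃L[ℝ] (ℝ × ℝ), d = newtonDistance (φ ∘ e)}

/-- `φ` is adapted in its original coordinates. -/
def IsAdapted (φ : ℝ × ℝ → ℝ) : Prop :=
  newtonDistance φ = newtonHeight φ

/-- `φ` is linearly adapted in its original coordinates. -/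
def IsLinearlyAdapted (φ : ℝ × ℝ → ℝ) : Prop :=
  newtonDistance φ = linearHeight φ

/-- The line `L_w = {t : w₁ t₁ + w₂ t₂ = 1}`. -/
def weightLine (w : ℝ × ℝ) : Set (ℝ × ℝ) :=
  {t | w.1 * t.1 + w.2 * t.2 = 1}

/-- `w` is a weight (with nonnegative entries) and `L_w` is a supporting line to `N`. The polyhedra
`N` considered here are unbounded upwards, hence lie on the side `w₁ t₁ + w₂ t₂ ≥ 1` of `L_w`. -/
def IsSupportingWeight (N : Set (ℝ × ℝ)) (w : ℝ × ℝ) : Prop :=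
  0 ≤ w.1 ∧ 0 ≤ w.2 ∧ (∀ t ∈ N, 1 ≤ w.1 * t.1 + w.2 * t.2) ∧ (weightLine w ∩ N).Nonempty

/-- `κ` is the weight attached to the principal face of `N`. If the principal face is an edge
(so that `(d, d)` is not a vertex), then `L_κ` is the line containing this edge, i.e. the supporting
line through `(d, d)`. If it is the vertex `(d, d)`, then `L_κ` contains the edge of `N`
that has `(d, d)` as its left endpoint. -/
def IsPrincipalWeight (N : Set (ℝ × ℝ)) (κ : ℝ × ℝ) : Prop :=
  IsSupportingWeight N κ ∧
    (bisectrixParam N, bisectrixParam N) ∈ weightLine κ ∧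
    ((bisectrixParam N, bisectrixParam N) ∈ N.extremePoints ℝ →
      ∃ t ∈ weightLine κ ∩ N, bisectrixParam N < t.1)

/-! ### Adapted coordinates and the augmented Newton polyhedron -/

/-- `φ^a(y) = φ(y₁, y₂ + ψ(y₁))`: the function `φ` in the coordinates
`y₁ = x₁`, `y₂ = x₂ - ψ(x₁)`. -/
def sheared (φ : ℝ × ℝ → ℝ) (ψ : ℝ → ℝ) : ℝ × ℝ → ℝ :=
  fun y => φ (y.1, y.2 + ψ y.1)

/-- `ψ` is smooth near the origin, `ψ(0) = 0`, and `φ` is adapted in the coordinates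
`y₁ = x₁`, `y₂ = x₂ - ψ(x₁)`. -/
def IsAdaptingShear (φ : ℝ × ℝ → ℝ) (ψ : ℝ → ℝ) : Prop :=
  ψ 0 = 0 ∧ (∃ U : Set ℝ, IsOpen U ∧ (0 : ℝ) ∈ U ∧ ContDiffOn ℝ ∞ ψ U) ∧
    newtonDistance (sheared φ ψ) = newtonHeight φ

/-- The ray of all points of `L_κ` that are not below the lowest point `P` of `L_κ ∩ N`. -/
def upperRay (κ : ℝ × ℝ) (N : Set (ℝ × ℝ)) : Set (ℝ × ℝ) :=
  {t | t ∈ weightLine κ ∧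
    ∃ P ∈ weightLine κ ∩ N, (∀ Q ∈ weightLine κ ∩ N, P.2 ≤ Q.2) ∧ P.2 ≤ t.2}

/-- The augmented Newton polyhedron built from `N = 𝓝(φ^a)` and the principal weight `κ` of
the original function `φ`. -/
def augmentedPolyhedron (κ : ℝ × ℝ) (N : Set (ℝ × ℝ)) : Set (ℝ × ℝ) :=
  convexHull ℝ (N ∪ upperRay κ N)

/-- `V 0, …, V n` are the vertices of `N`, ordered from left to right. -/
def IsVertexList (N : Set (ℝ × ℝ)) (n : ℕ) (V : ℕ → ℝ × ℝ) : Prop :=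
  StrictMonoOn (fun l => (V l).1) (Set.Iic n) ∧ V '' Set.Iic n = N.extremePoints ℝ

/-- The edges `γ_l`, `0 ≤ l ≤ n + 1`, of the Newton polyhedron with vertices `V 0, …, V n`. -/
def polyEdge (n : ℕ) (V : ℕ → ℝ × ℝ) (l : ℕ) : Set (ℝ × ℝ) :=
  if l = 0 then {t | t.1 = (V 0).1 ∧ (V 0).2 ≤ t.2}
  else if l ≤ n then segment ℝ (V (l - 1)) (V l)
  else {t | (V n).1 ≤ t.1 ∧ t.2 = (V n).2}

/-- The number `a_l` for which the line containing `γ_l` has slope `-1 / a_l`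
(so `a_l = κ₂^l / κ₁^l`, with `a_0 = 0` and `a_{n+1} = ∞`). -/
def edgeRatio (n : ℕ) (V : ℕ → ℝ × ℝ) (l : ℕ) : EReal :=
  if l = 0 then 0
  else if l ≤ n then ((((V l).1 - (V (l - 1)).1) / ((V (l - 1)).2 - (V l).2) : ℝ) : EReal)
  else ⊤

/-- `l₀` is the index with `a_{l₀} > m ≥ a_{l₀ - 1}`. -/
def IsFirstIndex (n : ℕ) (V : ℕ → ℝ × ℝ) (m : ℝ) (l₀ : ℕ) : Prop :=
  1 ≤ l₀ ∧ l₀ ≤ n + 1 ∧ edgeRatio n V (l₀ - 1) ≤ (m : EReal) ∧ (m : EReal) < edgeRatio n V l₀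

/-- `l` is the index of the principal face of `N` if this is an edge, and the index of the edge to
the left of the principal face if this is a vertex. -/
def IsPrincipalIndex (N : Set (ℝ × ℝ)) (n : ℕ) (V : ℕ → ℝ × ℝ) (l : ℕ) : Prop :=
  ((bisectrixParam N, bisectrixParam N) ∈ N.extremePoints ℝ →
    l ≤ n ∧ V l = (bisectrixParam N, bisectrixParam N)) ∧
  ((bisectrixParam N, bisectrixParam N) ∉ N.extremePoints ℝ →
    l ≤ n + 1 ∧ (bisectrixParam N, bisectrixParam N) ∈ polyEdge n V l)

/-! ### The conditions on the exponents; `q₁ = p₁'` and `q₃ = p₃'` are the dual exponents -/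

/-- `1 / q`, which is `0` for `q = ∞`. -/
def recip (q : ℝ≥0∞) : ℝ := (q⁻¹).toReal

/-- `(1 + m) w₁ / p₁' + 1 / p₃' ≤ (w₁ + w₂) / 2`. -/
def WeightCond (m : ℝ) (w : ℝ × ℝ) (q₁ q₃ : ℝ≥0∞) : Prop :=
  (1 + m) * w.1 * recip q₁ + recip q₃ ≤ (w.1 + w.2) / 2

/-- The condition for all weights whose line supports `N`. -/
def RawConds (N : Set (ℝ × ℝ)) (m : ℝ) (q₁ q₃ : ℝ≥0∞) : Prop :=
  ∀ w, IsSupportingWeight N w → WeightCond m w q₁ q₃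

/-- The condition for the weight `κ^l` whose line contains `γ_l`. It is void if the line containing
`γ_l` passes through the origin and so has no weight (`γ_{n+1}` may lie on the axis `t₂ = 0`, which
corresponds to `κ₂^{n+1} = ∞`). -/
def EdgeCond (n : ℕ) (V : ℕ → ℝ × ℝ) (m : ℝ) (l : ℕ) (q₁ q₃ : ℝ≥0∞) : Prop :=
  ∀ w, polyEdge n V l ⊆ weightLine w → WeightCond m w q₁ q₃

/-- The finite system: the edges `γ_l`, `l₀ ≤ l ≤ n + 1`, and the weight `κ`. -/
def EdgeConds (n : ℕ) (V : ℕ → ℝ × ℝ) (l₀ : ℕ) (κ : ℝ × ℝ) (m : ℝ) (q₁ q₃ : ℝ≥0∞) : Prop :=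
  (∀ l, l₀ ≤ l → l ≤ n + 1 → EdgeCond n V m l q₁ q₃) ∧ WeightCond m κ q₁ q₃

/-- `1 / (d(φ) p₁') + 1 / p₃' ≤ 1 / (2 d(φ))`. -/
def DistanceCond (φ : ℝ × ℝ → ℝ) (q₁ q₃ : ℝ≥0∞) : Prop :=
  1 / newtonDistance φ * recip q₁ + recip q₃ ≤ 1 / (2 * newtonDistance φ)

/-- `1 / p₃' ≤ 1 / (2 h(φ))`. -/
def HeightCond (φ : ℝ × ℝ → ℝ) (q₃ : ℝ≥0∞) : Prop :=
  recip q₃ ≤ 1 / (2 * newtonHeight φ)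

/-! ### The mixed norm restriction estimate -/

/-- The point of the graph of `φ` above `x`. -/
def graphPoint (φ : ℝ × ℝ → ℝ) (x : ℝ × ℝ) : EuclideanSpace ℝ (Fin 3) :=
  !₂[x.1, x.2, φ x]

/-- The density `(1 + |∇φ|²)^{1/2}` of the surface measure of the graph of `φ`. -/
def surfaceDensity (φ : ℝ × ℝ → ℝ) (x : ℝ × ℝ) : ℝ :=
  Real.sqrt (1 + (fderiv ℝ φ x (1, 0)) ^ 2 + (fderiv ℝ φ x (0, 1)) ^ 2)

/-- The norm of `L^{p₃}_{x₃}(L^{p₁}_{(x₁,x₂)})`. -/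
def mixedNorm (p₁ p₃ : ℝ≥0∞) (f : EuclideanSpace ℝ (Fin 3) → ℂ) : ℝ≥0∞ :=
  eLpNorm (fun x₃ : ℝ =>
    eLpNorm (fun x : ℝ × ℝ => f !₂[x.1, x.2, x₃]) p₁ volume) p₃ volume

/-- The estimate `(∫_S |f̂|² ρ dσ)^{1/2} ≤ C ‖f‖` for all Schwartz functions `f`, where `S` is the
graph of `φ` over `Ω` and a function `ρ` on `S` is written as a function of `x ∈ Ω`. -/
def RestrictionEstimate (Ω : Set (ℝ × ℝ)) (φ ρ : ℝ × ℝ → ℝ) (p₁ p₃ : ℝ≥0∞) : Prop :=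
  ∃ C : ℝ≥0, ∀ f : 𝓢(EuclideanSpace ℝ (Fin 3), ℂ),
    (∫⁻ x in Ω, ‖𝓕 (f : EuclideanSpace ℝ (Fin 3) → ℂ) (graphPoint φ x)‖ₑ ^ 2 *
        ENNReal.ofReal (ρ x * surfaceDensity φ x)) ^ (1 / 2 : ℝ) ≤
      C * mixedNorm p₁ p₃ f

end MixedRestriction

end

open MixedRestriction

/-! All necessary conditions come from one Knapp example. A Schwartz function whose Fourier
transform is constant on a box with half-sides l₀, l₁, l₂ turns the estimate into |E|^{1/2} ≲ (l₀
l₁)^{1/p₁'} l₂^{1/p₃'} for every set E over which the graph lies in the box and ρ is bounded below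
(`RestrictionEstimate.knapp`). Let E be the image of {|y₁| ≤ ε^{w₁}, |y₂| ≤ ε^{w₂}} under a local
coordinate change e. Its area is ≳ ε^{w₁+w₂}, and φ = O(ε) on E if 𝓝(φ∘e) lies above L_w and w has
positive entries. If E lies in a box with sides O(ε^{v₁}), O(ε^{v₂}), then ε → 0 gives (v₁+v₂)/p₁' +
1/p₃' ≤ (w₁+w₂)/2 (`RestrictionEstimate.exponent_le`); weights with a zero entry are reached by a
limit.

Three choices are made. With e = id and v = w = κ this is the first half of (A), as κ₁+κ₂ = 1/d(φ).
With e arbitrary and v = 0 it is 1/p₃' ≤ (w₁+w₂)/2; separating (d',d') from 𝓝(φ∘e) for d' < d(φ∘e)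
provides w with w₁+w₂ < 1/d', and the second half of (A) follows. With e the shear by ψ and v = (w₁,
m w₁) it is (B). This needs ψ = O(|x₁|^k) with k ≥ m, and w₂ ≥ m w₁; the latter is what the ray
added to 𝓝(φ^a) encodes (`isSupportingWeight_augmentedPolyhedron_iff`).

The bound on ψ is a counting of zeros (`exists_order_of_newtonDistance_lt`). A shear of order k acts
on the face polynomial of weight (1,k) by the translation z ↦ z + c with c ≠ 0. If k < m, a sheared
polynomial vanishing to too high an order at 0 would give the original one more zeros, at 0 and c
together, than its degree allows; so such a shear cannot increase the Newton distance. If k ≥ m,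
then L_κ still supports 𝓝(φ^a) and its face keeps a point at height at least d(φ). As d(φ^a) > d(φ),
the whole face then lies above the bisectrix.

For the finite system, L_κ passes through the vertex V (l₀ - 1). A supporting line no steeper than
L_κ touches a vertex V j with j ≥ l₀ - 1, and its weight lies between those of the adjacent edges
(of κ, if j = l₀ - 1). The condition is affine in the weight, so it interpolates
(`EdgeConds.weightCond`). Past the principal edge w₁ does not exceed its principal value while w₁ +
w₂ is at least 1/d(φ^a), so those conditions are weaker. -/

noncomputable section

namespace MixedRestriction

open Filter Finset

/-! ### Taylor expansion at the origin -/

/-- `g` is smooth in an open neighbourhood of the origin. -/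
def SmoothNearZero {E : Type*} [NormedAddCommGroup E] [NormedSpace ℝ E] (g : E → ℝ) : Prop :=
  ∃ U : Set E, IsOpen U ∧ (0 : E) ∈ U ∧ ContDiffOn ℝ ∞ g U

/-- The derivative of the remainder of f is the remainder of f' of one order less, so induction and
the mean value inequality on |y| ≤ |x| suffice. Dropping the factor 1/M! lets C pass through
unchanged. -/
lemma abs_sub_taylor_sum_le (M : ℕ) :
    ∀ {f : ℝ → ℝ} {δ C : ℝ}, ContDiffOn ℝ ∞ f (Metric.ball 0 δ) →
      (∀ x ∈ Metric.ball (0 : ℝ) δ, |iteratedDeriv M f x| ≤ C) →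
      ∀ x ∈ Metric.ball (0 : ℝ) δ,
        |f x - ∑ j ∈ range M, iteratedDeriv j f 0 / (j.factorial : ℝ) * x ^ j| ≤ C * |x| ^ M := by
  induction M with
  | zero =>
    intro f δ C _ hC x hx
    simpa using hC x hx
  | succ M ih =>
    intro f δ C hf hC x hx
    have hf' : ContDiffOn ℝ ∞ (deriv f) (Metric.ball 0 δ) :=
      hf.deriv_of_isOpen Metric.isOpen_ball (by simp)
    have hC' : ∀ x ∈ Metric.ball (0 : ℝ) δ, |iteratedDeriv M (deriv f) x| ≤ C := by
      intro y hy
      rw [← iteratedDeriv_succ']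
      exact hC y hy
    have key := ih hf' hC'
    have hC0 : 0 ≤ C := (abs_nonneg _).trans (hC x hx)
    set h : ℝ → ℝ := fun x => f x -
      ∑ j ∈ range (M + 1), iteratedDeriv j f 0 / (j.factorial : ℝ) * x ^ j with hh
    have hsub : Metric.closedBall (0 : ℝ) |x| ⊆ Metric.ball 0 δ := by
      intro y hy
      simp only [Metric.mem_closedBall, dist_zero_right, Real.norm_eq_abs, Metric.mem_ball] at *
      linarith
    have hder : ∀ y ∈ Metric.closedBall (0 : ℝ) |x|, HasDerivWithinAt h
        (deriv f y - ∑ j ∈ range M, iteratedDeriv j (deriv f) 0 / (j.factorial : ℝ) * y ^ j)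
        (Metric.closedBall (0 : ℝ) |x|) y := by
      intro y hy
      apply HasDerivAt.hasDerivWithinAt
      apply HasDerivAt.sub
      · exact ((hf.differentiableOn (by simp)).differentiableAt
          (Metric.isOpen_ball.mem_nhds (hsub hy))).hasDerivAt
      · have : ∀ j ∈ range (M + 1), HasDerivAt
            (fun x : ℝ => iteratedDeriv j f 0 / (j.factorial : ℝ) * x ^ j)
            (iteratedDeriv j f 0 / (j.factorial : ℝ) * (j * y ^ (j - 1))) y := by
          intro j _
          exact (hasDerivAt_pow j y).const_mul _
        have h2 := HasDerivAt.fun_sum this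
        convert h2 using 1
        rw [sum_range_succ']
        simp only [Nat.cast_zero, zero_mul, mul_zero, add_zero]
        apply sum_congr rfl
        intro j _
        rw [iteratedDeriv_succ', Nat.factorial_succ]
        have : (j.factorial : ℝ) ≠ 0 := by positivity
        have : ((j : ℝ) + 1) ≠ 0 := by positivity
        push_cast
        field_simp
    have hb : ∀ y ∈ Metric.closedBall (0 : ℝ) |x|,
        ‖deriv f y - ∑ j ∈ range M, iteratedDeriv j (deriv f) 0 / (j.factorial : ℝ) * y ^ j‖
          ≤ C * |x| ^ M := by
      intro y hy
      refine (key y (hsub hy)).trans ?_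
      have : |y| ≤ |x| := by simpa using hy
      gcongr
    have := (convex_closedBall (0 : ℝ) |x|).norm_image_sub_le_of_norm_hasDerivWithin_le hder hb
      (x := 0) (y := x) (by simp) (by simp)
    have h0 : h 0 = 0 := by
      simp [hh, sum_range_succ']
    rw [h0] at this
    simp only [sub_zero, Real.norm_eq_abs] at this
    rw [pow_succ, ← mul_assoc]
    exact this

/-- The partial derivative in the second variable. -/
def partialTwo (g : ℝ × ℝ → ℝ) : ℝ × ℝ → ℝ := fun x => fderiv ℝ g x (0, 1)

lemma ContDiffOn.partialTwo_iterate {g : ℝ × ℝ → ℝ} {U : Set (ℝ × ℝ)} (hU : IsOpen U)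
    (hg : ContDiffOn ℝ ∞ g U) (b : ℕ) : ContDiffOn ℝ ∞ (partialTwo^[b] g) U := by
  induction b with
  | zero => exact hg
  | succ b ih =>
    rw [Function.iterate_succ_apply']
    exact (ih.fderiv_of_isOpen hU (m := ∞) (by simp)).clm_apply contDiffOn_const

/-- Identifies the slice derivatives in `partialAtZero` with a jointly smooth function. -/
lemma iteratedDeriv_slice {g : ℝ × ℝ → ℝ} {U : Set (ℝ × ℝ)} (hU : IsOpen U)
    (hg : ContDiffOn ℝ ∞ g U) (b : ℕ) (s t : ℝ) (h : (s, t) ∈ U) :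
    iteratedDeriv b (fun t => g (s, t)) t = (partialTwo^[b] g) (s, t) := by
  induction b generalizing t with
  | zero => simp
  | succ b ih =>
    rw [iteratedDeriv_succ, Function.iterate_succ_apply']
    have hev : iteratedDeriv b (fun t => g (s, t)) =ᶠ[𝓝 t] fun t => (partialTwo^[b] g) (s, t) := by
      have : ∀ᶠ t' in 𝓝 t, (s, t') ∈ U :=
        (Continuous.prodMk_right s).continuousAt.eventually (hU.mem_nhds h)
      filter_upwards [this] with t' ht' using ih t' ht'
    rw [hev.deriv_eq]
    have hd : HasFDerivAt (partialTwo^[b] g) (fderiv ℝ (partialTwo^[b] g) (s, t)) (s, t) :=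
      (((ContDiffOn.partialTwo_iterate hU hg b).differentiableOn (by simp)).differentiableAt
        (hU.mem_nhds h)).hasFDerivAt
    have hc : HasDerivAt (fun t : ℝ => (s, t)) ((0 : ℝ), (1 : ℝ)) t :=
      (hasDerivAt_const t s).prodMk (hasDerivAt_id t)
    exact (hd.comp_hasDerivAt t hc).deriv

/-- The Taylor coefficients of `g` at the origin. -/
def taylorCoeff (g : ℝ × ℝ → ℝ) (α : ℕ × ℕ) : ℝ :=
  partialAtZero g α.1 α.2 / ((α.1.factorial : ℝ) * (α.2.factorial : ℝ))

lemma taylorCoeff_ne_zero {g : ℝ × ℝ → ℝ} {α : ℕ × ℕ} :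
    taylorCoeff g α ≠ 0 ↔ α ∈ taylorSupport g := by
  have h1 : (α.1.factorial : ℝ) ≠ 0 := by positivity
  have h2 : (α.2.factorial : ℝ) ≠ 0 := by positivity
  simp [taylorCoeff, taylorSupport, h1, h2]

lemma exists_bound_near_zero {E : Type*} [NormedAddCommGroup E] {G : E → ℝ}
    {U : Set E} (hU : IsOpen U) (h0 : (0 : E) ∈ U) (hG : ContinuousOn G U) :
    ∃ δ > 0, Metric.ball 0 δ ⊆ U ∧ ∀ x ∈ Metric.ball 0 δ, |G x| ≤ |G 0| + 1 := by
  have h1 : ∀ᶠ x in 𝓝 (0 : E), |G x| < |G 0| + 1 :=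
    ((hG.continuousAt (hU.mem_nhds h0)).abs).eventually_lt_const (by simp)
  obtain ⟨δ, hδ, hb⟩ := Metric.eventually_nhds_iff_ball.1 (h1.and (hU.mem_nhds h0))
  exact ⟨δ, hδ, fun x hx => (hb x hx).2, fun x hx => (hb x hx).1.le⟩

lemma SmoothNearZero.exists_taylor_one {f : ℝ → ℝ} (hf : SmoothNearZero f) (M : ℕ) :
    ∃ C ≥ 0, ∃ δ > 0, ∀ x : ℝ, |x| < δ →
      |f x - ∑ j ∈ range M, iteratedDeriv j f 0 / (j.factorial : ℝ) * x ^ j| ≤ C * |x| ^ M := by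
  obtain ⟨U, hU, h0, hf⟩ := hf
  have hc : ContinuousOn (iteratedDeriv M f) U := by
    refine (hf.continuousOn_iteratedDerivWithin (m := M) (by exact_mod_cast le_top)
      hU.uniqueDiffOn).congr ?_
    intro x hx
    exact (iteratedDerivWithin_of_isOpen hU hx).symm
  obtain ⟨δ, hδ, hsub, hb⟩ := exists_bound_near_zero hU h0 hc
  refine ⟨|iteratedDeriv M f 0| + 1, by positivity, δ, hδ, fun x hx => ?_⟩
  exact abs_sub_taylor_sum_le M (hf.mono hsub) hb x (by simpa using hx)

/-- Expansion in the second variable, then of each coefficient in the first. This matches the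
iterated derivatives in `partialAtZero` and yields a square of exponents instead of a triangle; the
additional terms are harmless. -/
lemma SmoothNearZero.exists_taylor_two {g : ℝ × ℝ → ℝ} (hg : SmoothNearZero g) (M : ℕ) :
    ∃ C ≥ 0, ∃ δ > 0, ∀ x : ℝ × ℝ, ‖x‖ < δ →
      |g x - ∑ α ∈ range M ×ˢ range M, taylorCoeff g α * (x.1 ^ α.1 * x.2 ^ α.2)|
        ≤ C * ‖x‖ ^ M := by
  obtain ⟨U, hU, h0, hg⟩ := hg
  obtain ⟨δ₀, hδ₀, hsub, hb⟩ := exists_bound_near_zero hU h0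
    (ContDiffOn.partialTwo_iterate hU hg M).continuousOn
  set C₀ := |(partialTwo^[M] g) 0| + 1
  have hC₀ : 0 ≤ C₀ := by positivity
  -- the slices of the derivatives in the second variable
  set G : ℕ → ℝ → ℝ := fun b s => iteratedDeriv b (fun t => g (s, t)) 0 with hG
  have hGs : ∀ b, SmoothNearZero (G b) := by
    intro b
    refine ⟨(fun s : ℝ => (s, (0 : ℝ))) ⁻¹' U, hU.preimage (by fun_prop), h0, ?_⟩
    have : ContDiffOn ℝ ∞ (fun s : ℝ => (partialTwo^[b] g) (s, 0))
        ((fun s : ℝ => (s, (0 : ℝ))) ⁻¹' U) :=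
      (ContDiffOn.partialTwo_iterate hU hg b).comp (by fun_prop) (fun s hs => hs)
    exact this.congr fun s hs => iteratedDeriv_slice hU hg b s 0 hs
  choose C hC δ hδ hT using fun b => (hGs b).exists_taylor_one M
  obtain ⟨δ₁, hδ₁, hδ₁le⟩ : ∃ δ₁ > 0, ∀ b ∈ range M, δ₁ ≤ δ b := by
    clear hT
    induction M with
    | zero => exact ⟨1, one_pos, by simp⟩
    | succ n _ =>
      obtain ⟨b, -, hb⟩ := exists_min_image (range (n + 1)) δ ⟨0, by simp⟩
      exact ⟨δ b, hδ b, hb⟩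
  refine ⟨C₀ + ∑ b ∈ range M, C b, by have := sum_nonneg (s := range M) fun b _ => hC b; positivity,
    min (min δ₀ δ₁) 1, by positivity, ?_⟩
  rintro ⟨s, t⟩ hx
  simp only [lt_min_iff] at hx
  obtain ⟨⟨hx0, hx1⟩, hx2⟩ := hx
  have hs : |s| ≤ ‖(s, t)‖ := norm_fst_le (s, t)
  have ht : |t| ≤ ‖(s, t)‖ := norm_snd_le (s, t)
  have hslice : ContDiffOn ℝ ∞ (fun t => g (s, t)) (Metric.ball 0 δ₀) := by
    refine hg.comp (by fun_prop) fun t' ht' => hsub ?_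
    simp only [Metric.mem_ball, dist_zero_right, Real.norm_eq_abs, Prod.norm_def, sup_lt_iff] at *
    exact ⟨hx0.1, ht'⟩
  have e1 := abs_sub_taylor_sum_le M hslice (C := C₀) (by
    intro t' ht'
    have hmem : (s, t') ∈ Metric.ball (0 : ℝ × ℝ) δ₀ := by
      simp only [Metric.mem_ball, dist_zero_right, Real.norm_eq_abs, Prod.norm_def,
        sup_lt_iff] at *
      exact ⟨hx0.1, ht'⟩
    rw [iteratedDeriv_slice hU hg M s t' (hsub hmem)]
    exact hb _ hmem) t (by simpa using lt_of_le_of_lt ht hx0)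
  have e2 : |∑ b ∈ range M, G b s / (b.factorial : ℝ) * t ^ b -
      ∑ α ∈ range M ×ˢ range M, taylorCoeff g α * (s ^ α.1 * t ^ α.2)|
      ≤ ∑ b ∈ range M, C b * ‖(s, t)‖ ^ M := by
    rw [sum_product_right, ← sum_sub_distrib]
    refine (abs_sum_le_sum_abs _ _).trans (sum_le_sum fun b hb' => ?_)
    have h3 := hT b s (lt_of_lt_of_le (lt_of_le_of_lt hs hx1) (hδ₁le b hb'))
    have h4 : G b s / (b.factorial : ℝ) * t ^ b - ∑ a ∈ range M,
        taylorCoeff g (a, b) * (s ^ a * t ^ b) = (G b s - ∑ a ∈ range M,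
          iteratedDeriv a (G b) 0 / (a.factorial : ℝ) * s ^ a) * (t ^ b / (b.factorial : ℝ)) := by
      rw [sub_mul, sum_mul]
      congr 1
      · ring
      · refine sum_congr rfl fun a _ => ?_
        simp only [taylorCoeff, partialAtZero, hG]
        ring
    rw [h4, abs_mul]
    have h5 : |t ^ b / (b.factorial : ℝ)| ≤ 1 := by
      rw [abs_div, abs_pow, Nat.abs_cast]
      apply div_le_one_of_le₀ _ (by positivity)
      calc |t| ^ b ≤ 1 := pow_le_one₀ (abs_nonneg _) (ht.trans hx2.le)
        _ ≤ _ := by exact_mod_cast Nat.factorial_pos b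
    have hCb := hC b
    calc _ ≤ C b * |s| ^ M * 1 := by
          gcongr
      _ ≤ C b * ‖(s, t)‖ ^ M := by
        rw [mul_one]
        gcongr
  calc _ ≤ |g (s, t) - ∑ b ∈ range M, G b s / (b.factorial : ℝ) * t ^ b| +
        |∑ b ∈ range M, G b s / (b.factorial : ℝ) * t ^ b -
          ∑ α ∈ range M ×ˢ range M, taylorCoeff g α * (s ^ α.1 * t ^ α.2)| := abs_sub_le _ _ _
    _ ≤ C₀ * ‖(s, t)‖ ^ M + ∑ b ∈ range M, C b * ‖(s, t)‖ ^ M := by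
      refine add_le_add (e1.trans ?_) e2
      gcongr
    _ = _ := by rw [← sum_mul, ← add_mul]

/-! ### Principal parts with respect to a weight -/

/-- The restriction to `x₁ = 1` of the part of `g` that is homogeneous of degree `r` with respect
to the weight `w`. The natural number `M` bounds the exponents that are taken into account. -/
def facePoly (g : ℝ × ℝ → ℝ) (w : ℝ × ℝ) (r : ℝ) (M : ℕ) : Polynomial ℝ :=
  ∑ α ∈ range M ×ˢ range M with w.1 * (α.1 : ℝ) + w.2 * (α.2 : ℝ) = r,
    Polynomial.monomial α.2 (taylorCoeff g α)

section FacePoly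

variable {g : ℝ × ℝ → ℝ} {w : ℝ × ℝ} {r : ℝ} {M : ℕ}

lemma facePoly_coeff (b : ℕ) : (facePoly g w r M).coeff b =
    ∑ α ∈ range M ×ˢ range M with w.1 * (α.1 : ℝ) + w.2 * (α.2 : ℝ) = r,
      if α.2 = b then taylorCoeff g α else 0 := by
  simp [facePoly, Polynomial.coeff_monomial]

lemma exists_of_facePoly_coeff_ne_zero {b : ℕ} (h : (facePoly g w r M).coeff b ≠ 0) :
    ∃ a, (a, b) ∈ taylorSupport g ∧ w.1 * (a : ℝ) + w.2 * (b : ℝ) = r := by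
  rw [facePoly_coeff] at h
  obtain ⟨⟨a, b'⟩, hα, hne⟩ := exists_ne_zero_of_sum_ne_zero h
  simp only [mem_filter] at hα
  by_cases hb : b' = b
  · subst hb
    simp only [if_true] at hne
    exact ⟨a, taylorCoeff_ne_zero.1 hne, hα.2⟩
  · simp [hb] at hne

/-- On the line w₁a + w₂b = r the exponent b determines a because w₁ > 0, so no two Taylor
coefficients are added up. The bounds on M keep α inside the range of summation. -/
lemma facePoly_coeff_ne_zero (hw1 : 0 < w.1) (hw2 : 0 < w.2) (hM1 : r < M * w.1)
    (hM2 : r < M * w.2) {α : ℕ × ℕ} (hα : α ∈ taylorSupport g)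
    (hr : w.1 * (α.1 : ℝ) + w.2 * (α.2 : ℝ) = r) : (facePoly g w r M).coeff α.2 ≠ 0 := by
  rw [facePoly_coeff, sum_eq_single α]
  · simpa using taylorCoeff_ne_zero.2 hα
  · rintro ⟨a, b⟩ hβ hne
    simp only [mem_filter] at hβ
    rw [if_neg]
    rintro rfl
    apply hne
    have : w.1 * (a : ℝ) = w.1 * (α.1 : ℝ) := by linarith [hβ.2]
    have : (a : ℝ) = α.1 := mul_left_cancel₀ hw1.ne' this
    ext
    · exact_mod_cast this
    · rfl
  · intro h
    exfalso
    apply h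
    simp only [mem_filter, mem_product, mem_range]
    refine ⟨⟨?_, ?_⟩, hr⟩
    · by_contra hcon
      have : (M : ℝ) ≤ α.1 := by exact_mod_cast not_lt.1 hcon
      have h2 : 0 ≤ w.2 * (α.2 : ℝ) := by positivity
      nlinarith
    · by_contra hcon
      have : (M : ℝ) ≤ α.2 := by exact_mod_cast not_lt.1 hcon
      have h2 : 0 ≤ w.1 * (α.1 : ℝ) := by positivity
      nlinarith

lemma facePoly_eval (z : ℝ) : (facePoly g w r M).eval z =
    ∑ α ∈ range M ×ˢ range M,
      if w.1 * (α.1 : ℝ) + w.2 * (α.2 : ℝ) = r then taylorCoeff g α * z ^ α.2 else 0 := by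
  rw [facePoly, Polynomial.eval_finsetSum, sum_filter]
  simp only [Polynomial.eval_monomial]

/-- `facePoly` is the limit of the anisotropic dilates of `g`. -/
lemma tendsto_facePoly (hg : SmoothNearZero g) (hw1 : 0 < w.1) (hw2 : 0 < w.2)
    (hM1 : r < M * w.1) (hM2 : r < M * w.2)
    (hT : ∀ α ∈ taylorSupport g, r ≤ w.1 * (α.1 : ℝ) + w.2 * (α.2 : ℝ))
    {z : ℝ → ℝ} {z₀ : ℝ} (hz : Tendsto z (𝓝[>] 0) (𝓝 z₀)) :
    Tendsto (fun t : ℝ => t ^ (-r) * g (t ^ w.1, t ^ w.2 * z t)) (𝓝[>] 0)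
      (𝓝 ((facePoly g w r M).eval z₀)) := by
  obtain ⟨C, hC, δ, hδ, hb⟩ := hg.exists_taylor_two M
  have hpow : ∀ s : ℝ, 0 < s → Tendsto (fun t : ℝ => t ^ s) (𝓝[>] 0) (𝓝 0) := by
    intro s hs
    have := (Real.continuousAt_rpow_const 0 s (Or.inr hs.le)).tendsto
    rw [Real.zero_rpow hs.ne'] at this
    exact this.mono_left nhdsWithin_le_nhds
  have hpos : ∀ᶠ t : ℝ in 𝓝[>] 0, 0 < t := eventually_mem_nhdsWithin
  have hx : Tendsto (fun t : ℝ => (t ^ w.1, t ^ w.2 * z t)) (𝓝[>] 0) (𝓝 0) := by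
    have := (hpow _ hw1).prodMk_nhds ((hpow _ hw2).mul hz)
    rw [zero_mul] at this
    exact this
  have hsmall : ∀ᶠ t : ℝ in 𝓝[>] 0, ‖((t ^ w.1, t ^ w.2 * z t) : ℝ × ℝ)‖ < δ := by
    have := hx.norm
    rw [norm_zero] at this
    exact this.eventually_lt_const hδ
  -- the Taylor polynomial
  have hmain : Tendsto (fun t : ℝ => ∑ α ∈ range M ×ˢ range M,
      taylorCoeff g α * (t ^ (w.1 * (α.1 : ℝ) + w.2 * (α.2 : ℝ) - r) * z t ^ α.2)) (𝓝[>] 0)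
      (𝓝 ((facePoly g w r M).eval z₀)) := by
    rw [facePoly_eval]
    apply tendsto_finsetSum
    intro α _
    by_cases hα : α ∈ taylorSupport g
    · rcases (hT α hα).eq_or_lt with h | h
      · rw [if_pos h.symm, ← h]
        simpa using (hz.pow α.2).const_mul (taylorCoeff g α)
      · rw [if_neg h.ne']
        have := ((hpow _ (sub_pos.2 h)).mul (hz.pow α.2)).const_mul (taylorCoeff g α)
        simpa using this
    · have : taylorCoeff g α = 0 := by
        by_contra hcon
        exact hα (taylorCoeff_ne_zero.1 hcon)
      simp [this]
  -- the remainder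
  have hrem : Tendsto (fun t : ℝ => C * (t ^ (M * w.1 - r) + t ^ (M * w.2 - r) * |z t| ^ M))
      (𝓝[>] 0) (𝓝 0) := by
    have := ((hpow _ (sub_pos.2 hM1)).add
      ((hpow _ (sub_pos.2 hM2)).mul (hz.abs.pow M))).const_mul C
    simpa using this
  have hdiff : Tendsto (fun t : ℝ => t ^ (-r) * g (t ^ w.1, t ^ w.2 * z t) -
      ∑ α ∈ range M ×ˢ range M,
        taylorCoeff g α * (t ^ (w.1 * (α.1 : ℝ) + w.2 * (α.2 : ℝ) - r) * z t ^ α.2)) (𝓝[>] 0)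
      (𝓝 0) := by
    apply squeeze_zero_norm' _ hrem
    filter_upwards [hpos, hsmall] with t ht hts
    have h1 := hb _ hts
    have h2 : ∑ α ∈ range M ×ˢ range M,
        taylorCoeff g α * (t ^ (w.1 * (α.1 : ℝ) + w.2 * (α.2 : ℝ) - r) * z t ^ α.2) =
        t ^ (-r) * ∑ α ∈ range M ×ˢ range M,
          taylorCoeff g α * ((t ^ w.1) ^ α.1 * (t ^ w.2 * z t) ^ α.2) := by
      rw [mul_sum]
      refine sum_congr rfl fun α _ => ?_
      rw [sub_eq_add_neg, Real.rpow_add ht, Real.rpow_add ht, Real.rpow_mul ht.le,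
        Real.rpow_mul ht.le, Real.rpow_natCast, Real.rpow_natCast, mul_pow]
      ring
    rw [h2, ← mul_sub, norm_mul, Real.norm_eq_abs, abs_of_pos (Real.rpow_pos_of_pos ht _),
      Real.norm_eq_abs]
    have h3 : ‖((t ^ w.1, t ^ w.2 * z t) : ℝ × ℝ)‖ ^ M ≤
        (t ^ w.1) ^ M + (t ^ w.2 * |z t|) ^ M := by
      rw [Prod.norm_def]
      simp only [Real.norm_eq_abs, abs_mul, abs_of_pos (Real.rpow_pos_of_pos ht _)]
      rcases max_choice (t ^ w.1) (t ^ w.2 * |z t|) with h | h <;> rw [h]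
      · have : 0 ≤ (t ^ w.2 * |z t|) ^ M := by positivity
        linarith
      · have : 0 ≤ (t ^ w.1) ^ M := by positivity
        linarith
    calc _ ≤ t ^ (-r) * (C * ((t ^ w.1) ^ M + (t ^ w.2 * |z t|) ^ M)) := by
          gcongr
          exact h1.trans (by gcongr)
      _ = _ := by
        rw [sub_eq_add_neg, sub_eq_add_neg, Real.rpow_add ht, Real.rpow_add ht,
          mul_comm (M : ℝ), mul_comm (M : ℝ), Real.rpow_mul ht.le,
          Real.rpow_mul ht.le, Real.rpow_natCast, Real.rpow_natCast, mul_pow]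
        ring
  have := hdiff.add hmain
  simpa using this

end FacePoly

/-- With such an M the Taylor remainder of order M is o(t^r) on boxes with side lengths of order
t^{w₁} and t^{w₂}. -/
lemma exists_nat_mul_gt (r : ℝ) {w : ℝ × ℝ} (hw1 : 0 < w.1) (hw2 : 0 < w.2) :
    ∃ M : ℕ, r < M * w.1 ∧ r < M * w.2 := by
  obtain ⟨M, hM⟩ := exists_nat_gt (max (r / w.1) (r / w.2))
  rw [max_lt_iff, div_lt_iff₀ hw1, div_lt_iff₀ hw2] at hM
  exact ⟨M, hM⟩

/-- If the Newton polyhedron of `g` lies above `L_w`, then `g` is of size `O(ε)` on the box with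
side lengths `ε ^ w₁` and `ε ^ w₂`. -/
lemma SmoothNearZero.exists_bound_on_box {g : ℝ × ℝ → ℝ} (hg : SmoothNearZero g) {w : ℝ × ℝ}
    (hw1 : 0 < w.1) (hw2 : 0 < w.2)
    (hT : ∀ α ∈ taylorSupport g, 1 ≤ w.1 * (α.1 : ℝ) + w.2 * (α.2 : ℝ)) :
    ∃ C ≥ 0, ∃ ε₀ > 0, ∀ ε, 0 < ε → ε < ε₀ → ∀ y : ℝ × ℝ, |y.1| ≤ ε ^ w.1 → |y.2| ≤ ε ^ w.2 →
      |g y| ≤ C * ε := by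
  obtain ⟨M, hM1, hM2⟩ := exists_nat_mul_gt 1 hw1 hw2
  obtain ⟨C, hC, δ, hδ, hb⟩ := hg.exists_taylor_two M
  have hpow : ∀ s : ℝ, 0 < s → ∀ᶠ t : ℝ in 𝓝 0, t ^ s < δ := by
    intro s hs
    have := (Real.continuousAt_rpow_const 0 s (Or.inr hs.le)).tendsto
    rw [Real.zero_rpow hs.ne'] at this
    exact this.eventually_lt_const hδ
  obtain ⟨ε₁, hε₁, hsm⟩ := Metric.eventually_nhds_iff_ball.1 ((hpow _ hw1).and (hpow _ hw2))
  refine ⟨∑ α ∈ range M ×ˢ range M, |taylorCoeff g α| + C, by positivity, min ε₁ 1,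
    by positivity, ?_⟩
  intro ε hε hεlt y hy1 hy2
  rw [lt_min_iff] at hεlt
  have hsm' := hsm ε (by simpa [abs_of_pos hε] using hεlt.1)
  have hle : ∀ s : ℝ, 1 ≤ s → ε ^ s ≤ ε := by
    intro s hs
    simpa using Real.rpow_le_rpow_of_exponent_ge hε hεlt.2.le hs
  have hnorm : ‖y‖ < δ := by
    rw [Prod.norm_def, sup_lt_iff]
    exact ⟨lt_of_le_of_lt hy1 hsm'.1, lt_of_le_of_lt hy2 hsm'.2⟩
  have h1 := hb y hnorm
  have h2 : ‖y‖ ^ M ≤ ε := by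
    rw [Prod.norm_def]
    simp only [Real.norm_eq_abs]
    rcases max_choice |y.1| |y.2| with h | h <;> rw [h]
    · calc |y.1| ^ M ≤ (ε ^ w.1) ^ M := by gcongr
        _ = ε ^ (w.1 * M) := by rw [Real.rpow_mul hε.le, Real.rpow_natCast]
        _ ≤ ε := hle _ (by linarith)
    · calc |y.2| ^ M ≤ (ε ^ w.2) ^ M := by gcongr
        _ = ε ^ (w.2 * M) := by rw [Real.rpow_mul hε.le, Real.rpow_natCast]
        _ ≤ ε := hle _ (by linarith)
  have h3 : |∑ α ∈ range M ×ˢ range M, taylorCoeff g α * (y.1 ^ α.1 * y.2 ^ α.2)| ≤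
      (∑ α ∈ range M ×ˢ range M, |taylorCoeff g α|) * ε := by
    rw [sum_mul]
    refine (abs_sum_le_sum_abs _ _).trans (sum_le_sum fun α _ => ?_)
    by_cases hα : α ∈ taylorSupport g
    · rw [abs_mul, abs_mul, abs_pow, abs_pow]
      gcongr
      calc |y.1| ^ α.1 * |y.2| ^ α.2 ≤ (ε ^ w.1) ^ α.1 * (ε ^ w.2) ^ α.2 := by gcongr
        _ = ε ^ (w.1 * (α.1 : ℝ) + w.2 * (α.2 : ℝ)) := by
          rw [Real.rpow_add hε, Real.rpow_mul hε.le, Real.rpow_mul hε.le, Real.rpow_natCast,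
            Real.rpow_natCast]
        _ ≤ ε := hle _ (hT α hα)
    · have : taylorCoeff g α = 0 := by
        by_contra hcon
        exact hα (taylorCoeff_ne_zero.1 hcon)
      simp [this]
  calc |g y| ≤ |g y - ∑ α ∈ range M ×ˢ range M, taylorCoeff g α * (y.1 ^ α.1 * y.2 ^ α.2)| +
        |∑ α ∈ range M ×ˢ range M, taylorCoeff g α * (y.1 ^ α.1 * y.2 ^ α.2)| := by
        simpa using abs_sub_le (g y) _ 0
    _ ≤ C * ε + (∑ α ∈ range M ×ˢ range M, |taylorCoeff g α|) * ε := by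
      refine add_le_add (h1.trans ?_) h3
      gcongr
    _ = _ := by ring

open scoped Pointwise

/-! ### Convex geometry of Newton polyhedra -/

/-- Dickson's lemma. It makes the Newton polyhedron a compact convex set plus a quadrant, hence
closed, and lets linear functions attain their minima on the Taylor support. -/
lemma exists_finite_generators (T : Set (ℕ × ℕ)) :
    ∃ T₀ : Set (ℕ × ℕ), T₀.Finite ∧ T₀ ⊆ T ∧ ∀ α ∈ T, ∃ β ∈ T₀, β ≤ α := by
  have hP : T.IsPWO := Set.isPWO_of_wellQuasiOrderedLE T
  refine ⟨{x | Minimal (· ∈ T) x}, ?_, fun x hx => hx.prop, fun α hα => ?_⟩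
  · have hanti : IsAntichain (· ≤ ·) {x | Minimal (· ∈ T) x} := setOfPred_minimal_antichain _
    exact hanti.finite_of_partiallyWellOrderedOn (hP.mono fun x hx => hx.prop)
  · obtain ⟨b, hb, hmin⟩ := hP.exists_le_minimal hα
    exact ⟨b, hmin, hb⟩

section Polyhedron

variable {g : ℝ × ℝ → ℝ}

lemma convex_newtonPolyhedron : Convex ℝ (newtonPolyhedron g) := convex_convexHull ℝ _

lemma mem_newtonPolyhedron_of_le {α : ℕ × ℕ} (hα : α ∈ taylorSupport g) {t : ℝ × ℝ}
    (h1 : (α.1 : ℝ) ≤ t.1) (h2 : (α.2 : ℝ) ≤ t.2) : t ∈ newtonPolyhedron g :=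
  subset_convexHull ℝ _ (Set.mem_biUnion hα ⟨h1, h2⟩)

lemma le_of_mem_newtonPolyhedron {w : ℝ × ℝ} {r : ℝ} (hw1 : 0 ≤ w.1) (hw2 : 0 ≤ w.2)
    (h : ∀ α ∈ taylorSupport g, r ≤ w.1 * (α.1 : ℝ) + w.2 * (α.2 : ℝ)) :
    ∀ t ∈ newtonPolyhedron g, r ≤ w.1 * t.1 + w.2 * t.2 := by
  have hconv : Convex ℝ {t : ℝ × ℝ | r ≤ w.1 * t.1 + w.2 * t.2} := by
    intro x hx y hy a b ha hb hab
    simp only [Set.mem_ofPred_eq, Prod.fst_add, Prod.smul_fst, smul_eq_mul, Prod.snd_add,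
      Prod.smul_snd] at *
    have : r = a * r + b * r := by rw [← add_mul, hab, one_mul]
    nlinarith [mul_le_mul_of_nonneg_left hx ha, mul_le_mul_of_nonneg_left hy hb]
  intro t ht
  refine convexHull_min ?_ hconv ht
  intro t ht
  simp only [Set.mem_iUnion] at ht
  obtain ⟨α, hα, h1, h2⟩ := ht
  refine (h α hα).trans ?_
  gcongr

lemma nonneg_of_mem_newtonPolyhedron {t : ℝ × ℝ} (ht : t ∈ newtonPolyhedron g) :
    0 ≤ t.1 ∧ 0 ≤ t.2 := by
  constructor
  · simpa using le_of_mem_newtonPolyhedron (w := (1, 0)) (r := 0) (by simp) (by simp)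
      (by intro α _; simp) t ht
  · simpa using le_of_mem_newtonPolyhedron (w := (0, 1)) (r := 0) (by simp) (by simp)
      (by intro α _; simp) t ht

lemma newtonPolyhedron_eq_add {T₀ : Set (ℕ × ℕ)} (hsub : T₀ ⊆ taylorSupport g)
    (hgen : ∀ α ∈ taylorSupport g, ∃ β ∈ T₀, β ≤ α) :
    newtonPolyhedron g =
      convexHull ℝ ((fun α : ℕ × ℕ => ((α.1 : ℝ), (α.2 : ℝ))) '' T₀) + Set.Ici (0 : ℝ × ℝ) := by
  have hIci : convexHull ℝ (Set.Ici (0 : ℝ × ℝ)) = Set.Ici 0 := (convex_Ici _).convexHull_eq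
  rw [← hIci, ← convexHull_add, newtonPolyhedron]
  congr 1
  ext t
  simp only [Set.mem_iUnion, Set.mem_ofPred_eq, Set.mem_add, Set.mem_image, Set.mem_Ici]
  constructor
  · rintro ⟨α, hα, h1, h2⟩
    obtain ⟨β, hβ, hle⟩ := hgen α hα
    refine ⟨_, ⟨β, hβ, rfl⟩, t - ((β.1 : ℝ), (β.2 : ℝ)), ?_, by simp⟩
    have e1 : (β.1 : ℝ) ≤ α.1 := by exact_mod_cast hle.1
    have e2 : (β.2 : ℝ) ≤ α.2 := by exact_mod_cast hle.2
    rw [Prod.le_def]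
    simp only [Prod.fst_zero, Prod.fst_sub, Prod.snd_zero, Prod.snd_sub]
    constructor <;> linarith
  · rintro ⟨_, ⟨β, hβ, rfl⟩, q, hq, rfl⟩
    rw [Prod.le_def] at hq
    refine ⟨β, hsub hβ, ?_, ?_⟩
    · simpa using hq.1
    · simpa using hq.2

lemma isClosed_newtonPolyhedron : IsClosed (newtonPolyhedron g) := by
  obtain ⟨T₀, hfin, hsub, hgen⟩ := exists_finite_generators (taylorSupport g)
  rw [newtonPolyhedron_eq_add hsub hgen]
  exact isClosed_Ici.add_left_of_isCompact ((hfin.image _).isCompact_convexHull (𝕜 := ℝ))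

lemma add_mem_newtonPolyhedron {t q : ℝ × ℝ} (ht : t ∈ newtonPolyhedron g) (h1 : 0 ≤ q.1)
    (h2 : 0 ≤ q.2) : t + q ∈ newtonPolyhedron g := by
  rw [newtonPolyhedron_eq_add (Set.Subset.refl _) fun α hα => ⟨α, hα, le_rfl⟩] at ht ⊢
  obtain ⟨p, hp, q', hq', rfl⟩ := ht
  refine ⟨p, hp, q' + q, ?_, by simp [add_assoc]⟩
  rw [Set.mem_Ici, Prod.le_def] at hq' ⊢
  simp only [Prod.fst_zero, Prod.snd_zero, Prod.fst_add, Prod.snd_add] at *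
  constructor <;> linarith [hq'.1, hq'.2]

lemma exists_min_taylorSupport (hfin : FiniteType g) {w : ℝ × ℝ} (hw1 : 0 ≤ w.1) (hw2 : 0 ≤ w.2) :
    ∃ α ∈ taylorSupport g, ∀ β ∈ taylorSupport g,
      w.1 * (α.1 : ℝ) + w.2 * (α.2 : ℝ) ≤ w.1 * (β.1 : ℝ) + w.2 * (β.2 : ℝ) := by
  obtain ⟨T₀, hT₀, hsub, hgen⟩ := exists_finite_generators (taylorSupport g)
  obtain ⟨α₁, hα₁⟩ := hfin
  obtain ⟨β₁, hβ₁, -⟩ := hgen α₁ hα₁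
  obtain ⟨α, hα, hmin⟩ := Set.exists_min_image T₀
    (fun α : ℕ × ℕ => w.1 * (α.1 : ℝ) + w.2 * (α.2 : ℝ)) hT₀ ⟨β₁, hβ₁⟩
  refine ⟨α, hsub hα, fun β hβ => ?_⟩
  obtain ⟨γ, hγ, hle⟩ := hgen β hβ
  refine (hmin γ hγ).trans ?_
  have e1 : (γ.1 : ℝ) ≤ β.1 := by exact_mod_cast hle.1
  have e2 : (γ.2 : ℝ) ≤ β.2 := by exact_mod_cast hle.2
  gcongr

/-- The point t + q is the midpoint of t and t + 2q, both in the polyhedron. -/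
lemma eq_zero_of_add_mem_extremePoints {t q : ℝ × ℝ} (ht : t ∈ newtonPolyhedron g) (h1 : 0 ≤ q.1)
    (h2 : 0 ≤ q.2) (hext : t + q ∈ (newtonPolyhedron g).extremePoints ℝ) : q = 0 := by
  have h3 : t + (q + q) ∈ newtonPolyhedron g :=
    add_mem_newtonPolyhedron ht (by simpa using add_nonneg h1 h1) (by simpa using add_nonneg h2 h2)
  have := (mem_extremePoints_iff_left.1 hext).2 t ht _ h3
    ⟨1 / 2, 1 / 2, by norm_num, by norm_num, by norm_num, by
      ext <;> simp <;> ring⟩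
  simpa using this

lemma exists_taylorSupport_of_mem_extremePoints {t : ℝ × ℝ}
    (ht : t ∈ (newtonPolyhedron g).extremePoints ℝ) :
    ∃ α ∈ taylorSupport g, t = ((α.1 : ℝ), (α.2 : ℝ)) := by
  have := extremePoints_convexHull_subset ht
  simp only [Set.mem_iUnion] at this
  obtain ⟨α, hα, h1, h2⟩ := this
  refine ⟨α, hα, ?_⟩
  have hN : ((α.1 : ℝ), (α.2 : ℝ)) ∈ newtonPolyhedron g :=
    mem_newtonPolyhedron_of_le hα le_rfl le_rfl
  have h0 := eq_zero_of_add_mem_extremePoints (q := t - ((α.1 : ℝ), (α.2 : ℝ))) hN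
    (by simpa using h1) (by simpa using h2) (by simpa using ht)
  exact sub_eq_zero.1 h0

lemma isExtreme_setOf_linear_eq {A : Set (ℝ × ℝ)} {w : ℝ × ℝ} {c : ℝ}
    (h : ∀ t ∈ A, c ≤ w.1 * t.1 + w.2 * t.2) :
    IsExtreme ℝ A {t ∈ A | w.1 * t.1 + w.2 * t.2 = c} := by
  refine ⟨fun t ht => ht.1, ?_⟩
  rintro x hx y hy z ⟨-, hz⟩ ⟨a, b, ha, hb, hab, rfl⟩
  refine ⟨hx, ?_⟩
  simp only [Prod.fst_add, Prod.smul_fst, smul_eq_mul, Prod.snd_add, Prod.smul_snd] at hz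
  have h1 := h x hx
  have h2 := h y hy
  have e1 : a * (w.1 * x.1 + w.2 * x.2 - c) + b * (w.1 * y.1 + w.2 * y.2 - c) = 0 := by
    linear_combination hz - c * hab
  have e2 : 0 ≤ b * (w.1 * y.1 + w.2 * y.2 - c) := mul_nonneg hb.le (by linarith)
  have e3 : a * (w.1 * x.1 + w.2 * x.2 - c) ≤ 0 := by linarith
  have e4 : w.1 * x.1 + w.2 * x.2 - c ≤ 0 := by
    by_contra hcon
    exact absurd e3 (not_le.2 (mul_pos ha (not_le.1 hcon)))
  linarith

/-- A linear function with nonnegative coefficients that attains its minimum over the Newton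
polyhedron at `t₀` attains it at a vertex; a second, strictly positive linear function `u` may
be asked not to increase. -/
lemma exists_extremePoint_of_min {w u t₀ : ℝ × ℝ} (hu1 : 0 < u.1) (hu2 : 0 < u.2)
    (ht₀ : t₀ ∈ newtonPolyhedron g)
    (hmin : ∀ t ∈ newtonPolyhedron g, w.1 * t₀.1 + w.2 * t₀.2 ≤ w.1 * t.1 + w.2 * t.2) :
    ∃ v ∈ (newtonPolyhedron g).extremePoints ℝ,
      w.1 * v.1 + w.2 * v.2 = w.1 * t₀.1 + w.2 * t₀.2 ∧
        u.1 * v.1 + u.2 * v.2 ≤ u.1 * t₀.1 + u.2 * t₀.2 := by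
  set c := w.1 * t₀.1 + w.2 * t₀.2
  set F := {t ∈ newtonPolyhedron g | w.1 * t.1 + w.2 * t.2 = c} with hF
  have hFext : IsExtreme ℝ (newtonPolyhedron g) F := isExtreme_setOf_linear_eq hmin
  have hFcl : IsClosed F :=
    isClosed_newtonPolyhedron.inter (isClosed_eq (by fun_prop) continuous_const)
  set R := u.1 * t₀.1 + u.2 * t₀.2 with hR
  -- The face F may be unbounded. Cutting it by u ≤ R makes it compact, since u is strictly positive
  -- and the polyhedron lies in the first quadrant.
  set K := F ∩ {t | u.1 * t.1 + u.2 * t.2 ≤ R} with hK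
  have hKcomp : IsCompact K := by
    refine (isCompact_Icc (a := ((0 : ℝ), (0 : ℝ)))
      (b := (R / u.1, R / u.2))).of_isClosed_subset
      (hFcl.inter (isClosed_le (by fun_prop) continuous_const)) ?_
    rintro t ⟨⟨ht, -⟩, h2⟩
    have := nonneg_of_mem_newtonPolyhedron ht
    simp only [Set.mem_ofPred_eq] at h2
    rw [Set.mem_Icc, Prod.le_def, Prod.le_def]
    have e1 := mul_nonneg hu1.le this.1
    have e2 := mul_nonneg hu2.le this.2
    refine ⟨this, ?_, ?_⟩
    · simp only
      rw [le_div_iff₀ hu1]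
      linarith
    · simp only
      rw [le_div_iff₀ hu2]
      linarith
  obtain ⟨s, hsK, hs⟩ := hKcomp.exists_isMinOn ⟨t₀, ⟨ht₀, rfl⟩, le_refl R⟩
    (f := fun t : ℝ × ℝ => u.1 * t.1 + u.2 * t.2) (by fun_prop)
  have hmin2 : ∀ t ∈ F, u.1 * s.1 + u.2 * s.2 ≤ u.1 * t.1 + u.2 * t.2 := by
    intro t ht
    by_cases h : u.1 * t.1 + u.2 * t.2 ≤ R
    · exact hs (show t ∈ K from ⟨ht, h⟩)
    · exact hsK.2.trans (not_le.1 h).le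
  -- The minimal face G of u on F is compact, and a face of a face is a face, so an extreme point of
  -- G is a vertex of the polyhedron.
  have hGext := isExtreme_setOf_linear_eq hmin2
  set G := {t ∈ F | u.1 * t.1 + u.2 * t.2 = u.1 * s.1 + u.2 * s.2} with hG
  have hGK : G ⊆ K := by
    rintro t ⟨ht, h⟩
    refine ⟨ht, ?_⟩
    have := hsK.2
    simp only [Set.mem_ofPred_eq] at this ⊢
    linarith
  have hGcomp : IsCompact G := hKcomp.of_isClosed_subset
    (hFcl.inter (isClosed_eq (by fun_prop) continuous_const)) hGK
  obtain ⟨v, hv⟩ := hGcomp.extremePoints_nonempty ⟨s, hsK.1, rfl⟩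
  have hvG := extremePoints_subset hv
  exact ⟨v, (hFext.trans hGext).extremePoints_subset_extremePoints hv, hvG.1.2, (hGK hvG).2⟩

/-! ### The Newton distance -/

lemma newtonDistance_le {t : ℝ} (ht : (t, t) ∈ newtonPolyhedron g) : newtonDistance g ≤ t :=
  csInf_le ⟨0, fun _ hs => (nonneg_of_mem_newtonPolyhedron hs).1⟩ ht

lemma newtonDistance_mem (hfin : FiniteType g) :
    (newtonDistance g, newtonDistance g) ∈ newtonPolyhedron g := by
  obtain ⟨α, hα⟩ := hfin
  have hcl : IsClosed {t : ℝ | (t, t) ∈ newtonPolyhedron g} :=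
    isClosed_newtonPolyhedron.preimage (f := fun t : ℝ => (t, t)) (by fun_prop)
  refine hcl.csInf_mem ⟨max α.1 α.2, ?_⟩ ⟨0, fun _ hs => (nonneg_of_mem_newtonPolyhedron hs).1⟩
  exact mem_newtonPolyhedron_of_le hα (le_max_left _ _) (le_max_right _ _)

lemma newtonDistance_pos (hfin : FiniteType g) (h0 : g 0 = 0) : 0 < newtonDistance g := by
  have h := le_of_mem_newtonPolyhedron (g := g) (w := (1, 1)) (r := 1) (by simp) (by simp) (by
    rintro ⟨a, b⟩ hα
    have : (a, b) ≠ (0, 0) := by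
      intro hab
      rw [hab] at hα
      apply hα
      simp only [partialAtZero, iteratedDeriv_zero]
      exact h0
    have h2 : 1 ≤ a + b := by
      by_contra hcon
      apply this
      ext <;> simp <;> omega
    simp only [one_mul]
    exact_mod_cast h2) _ (newtonDistance_mem hfin)
  simp only [one_mul] at h
  linarith

/-- For each `d'` below the Newton distance there is a line above the point `(d', d')` that lies
below the Newton polyhedron. -/
lemma exists_weight_of_lt_newtonDistance (hfin : FiniteType g) {d' : ℝ} (hd' : 0 < d')
    (hlt : d' < newtonDistance g) :
    ∃ w : ℝ × ℝ, 0 ≤ w.1 ∧ 0 ≤ w.2 ∧ w.1 + w.2 < 1 / d' ∧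
      ∀ t ∈ newtonPolyhedron g, 1 ≤ w.1 * t.1 + w.2 * t.2 := by
  have hnot : (d', d') ∉ newtonPolyhedron g := fun h => absurd (newtonDistance_le h) (not_le.2 hlt)
  obtain ⟨f, u, hfu, hN⟩ := geometric_hahn_banach_point_closed convex_newtonPolyhedron
    isClosed_newtonPolyhedron hnot
  have hf : ∀ t : ℝ × ℝ, f t = f (1, 0) * t.1 + f (0, 1) * t.2 := by
    intro t
    have : t = t.1 • ((1 : ℝ), (0 : ℝ)) + t.2 • ((0 : ℝ), (1 : ℝ)) := by ext <;> simp
    conv_lhs => rw [this]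
    rw [map_add, map_smul, map_smul, smul_eq_mul, smul_eq_mul]
    ring
  have hd := newtonDistance_mem hfin
  set d := newtonDistance g
  -- The polyhedron is stable under adding multiples of e. If f e were negative, the multiple s
  -- below would bring f down to exactly u.
  have key : ∀ e : ℝ × ℝ, 0 ≤ e.1 → 0 ≤ e.2 → 0 ≤ f e := by
    intro e h1 h2
    by_contra hneg
    push Not at hneg
    have hlt' : u < f (d, d) := hN _ hd
    set s := (f (d, d) - u) / (- f e)
    have hs : 0 ≤ s := div_nonneg (by linarith) (by linarith)
    have := hN _ (add_mem_newtonPolyhedron hd (q := s • e) (by simpa using mul_nonneg hs h1)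
      (by simpa using mul_nonneg hs h2))
    rw [map_add, map_smul, smul_eq_mul] at this
    have e3 : s * f e = -(f (d, d) - u) := by
      have : f e ≠ 0 := hneg.ne
      simp only [s]
      field_simp
    linarith
  have h1 := key (1, 0) (by simp) (by simp)
  have h2 := key (0, 1) (by simp) (by simp)
  have hdd := hN _ hd
  rw [hf] at hfu hdd
  simp only at hfu hdd
  have hsum : 0 < f (1, 0) + f (0, 1) := by
    by_contra hcon
    nlinarith
  have hu : 0 < u := by nlinarith
  refine ⟨(f (1, 0) / u, f (0, 1) / u), by positivity, by positivity, ?_, ?_⟩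
  · simp only
    rw [← add_div, div_lt_div_iff₀ hu hd']
    linarith
  · intro t ht
    have := hN t ht
    rw [hf] at this
    have e : f (1, 0) / u * t.1 + f (0, 1) / u * t.2 = (f (1, 0) * t.1 + f (0, 1) * t.2) / u := by
      ring
    simp only [e]
    rw [le_div_iff₀ hu]
    linarith

end Polyhedron

open Polynomial

/-! ### Newton polyhedra under coordinate changes -/

lemma tendsto_rpow_nhdsGT_zero {s : ℝ} (hs : 0 < s) :
    Tendsto (fun t : ℝ => t ^ s) (𝓝[>] 0) (𝓝 0) := by
  have := (Real.continuousAt_rpow_const 0 s (Or.inr hs.le)).tendsto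
  rw [Real.zero_rpow hs.ne'] at this
  exact this.mono_left nhdsWithin_le_nhds

/-- If the anisotropic dilates of `g`, normalized by `t ^ (-r)`, converge, then the Newton
polyhedron of `g` lies in `{w₁ t₁ + w₂ t₂ ≥ r}`. -/
lemma le_of_tendsto_dilates {g : ℝ × ℝ → ℝ} (hg : SmoothNearZero g) {w : ℝ × ℝ} {r : ℝ}
    (hw1 : 0 < w.1) (hw2 : 0 < w.2) {F : ℝ → ℝ}
    (hF : ∀ z, Tendsto (fun t : ℝ => t ^ (-r) * g (t ^ w.1, t ^ w.2 * z)) (𝓝[>] 0) (𝓝 (F z))) :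
    ∀ α ∈ taylorSupport g, r ≤ w.1 * (α.1 : ℝ) + w.2 * (α.2 : ℝ) := by
  intro β hβ
  obtain ⟨α, hα, hmin⟩ := exists_min_taylorSupport ⟨β, hβ⟩ hw1.le hw2.le
  refine le_trans ?_ (hmin β hβ)
  set r' := w.1 * (α.1 : ℝ) + w.2 * (α.2 : ℝ) with hr'
  by_contra hlt
  push Not at hlt
  obtain ⟨M, hM1, hM2⟩ := exists_nat_mul_gt r' hw1 hw2
  -- With r' < r, the dilates normalized by t ^ (-r') tend to 0 for every z, although their limit is
  -- the face polynomial of degree r', which has a nonzero coefficient at α.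
  have hzero : facePoly g w r' M = 0 := by
    apply Polynomial.funext
    intro z
    have h1 := tendsto_facePoly hg hw1 hw2 hM1 hM2 hmin (z := fun _ => z) tendsto_const_nhds
    have h2 := (tendsto_rpow_nhdsGT_zero (sub_pos.2 hlt)).mul (hF z)
    rw [zero_mul] at h2
    have h3 : (fun t : ℝ => t ^ (r - r') * (t ^ (-r) * g (t ^ w.1, t ^ w.2 * z))) =ᶠ[𝓝[>] 0]
        fun t : ℝ => t ^ (-r') * g (t ^ w.1, t ^ w.2 * z) := by
      filter_upwards [self_mem_nhdsWithin] with t ht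
      rw [← mul_assoc, ← Real.rpow_add ht]
      congr 2
      ring
    rw [eval_zero]
    exact tendsto_nhds_unique h1 (h2.congr' h3)
  have := facePoly_coeff_ne_zero hw1 hw2 hM1 hM2 hα hr'.symm
  rw [hzero] at this
  simp at this

/-- The effect of a shear on the Newton polyhedron and on the principal part for a weight `w`, if
the function defining the shear is of `w`-degree at least `w₂`. -/
lemma facePoly_sheared {φ : ℝ × ℝ → ℝ} {ψ : ℝ → ℝ} (hφ : SmoothNearZero φ)
    (hs : SmoothNearZero (sheared φ ψ)) {w : ℝ × ℝ} {r c : ℝ} {M : ℕ}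
    (hw1 : 0 < w.1) (hw2 : 0 < w.2) (hM1 : r < M * w.1) (hM2 : r < M * w.2)
    (hT : ∀ α ∈ taylorSupport φ, r ≤ w.1 * (α.1 : ℝ) + w.2 * (α.2 : ℝ))
    (hψ : Tendsto (fun t : ℝ => t ^ (-w.2) * ψ (t ^ w.1)) (𝓝[>] 0) (𝓝 c)) :
    (∀ α ∈ taylorSupport (sheared φ ψ), r ≤ w.1 * (α.1 : ℝ) + w.2 * (α.2 : ℝ)) ∧
      facePoly (sheared φ ψ) w r M = (facePoly φ w r M).comp (X + C c) := by
  -- The dilates of the sheared function at z are those of φ at the moving point z +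
  -- t^{-w₂}ψ(t^{w₁}) → z + c. This is why `tendsto_facePoly` lets z depend on t.
  have key : ∀ z, Tendsto (fun t : ℝ => t ^ (-r) * sheared φ ψ (t ^ w.1, t ^ w.2 * z)) (𝓝[>] 0)
      (𝓝 ((facePoly φ w r M).eval (z + c))) := by
    intro z
    have hz : Tendsto (fun t : ℝ => z + t ^ (-w.2) * ψ (t ^ w.1)) (𝓝[>] 0) (𝓝 (z + c)) :=
      hψ.const_add z
    refine (tendsto_facePoly hφ hw1 hw2 hM1 hM2 hT hz).congr' ?_
    filter_upwards [self_mem_nhdsWithin] with t ht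
    have ht' : (0 : ℝ) < t := ht
    have : t ^ w.2 * (z + t ^ (-w.2) * ψ (t ^ w.1)) = t ^ w.2 * z + ψ (t ^ w.1) := by
      rw [mul_add, ← mul_assoc, ← Real.rpow_add ht']
      simp
    simp only [sheared, this]
  have hT' := le_of_tendsto_dilates hs hw1 hw2 key
  refine ⟨hT', Polynomial.funext fun z => ?_⟩
  have h1 := tendsto_facePoly hs hw1 hw2 hM1 hM2 hT' (z := fun _ => z) tendsto_const_nhds
  rw [tendsto_nhds_unique h1 (key z)]
  simp

lemma SmoothNearZero.sheared {φ : ℝ × ℝ → ℝ} {ψ : ℝ → ℝ} (hφ : SmoothNearZero φ)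
    (hψ : SmoothNearZero ψ) (hψ0 : ψ 0 = 0) : SmoothNearZero (sheared φ ψ) := by
  obtain ⟨U, hU, h0U, hφ⟩ := hφ
  obtain ⟨W, hW, h0W, hψ⟩ := hψ
  have hsm : ContDiffOn ℝ ∞ (fun y : ℝ × ℝ => (y.1, y.2 + ψ y.1)) (Prod.fst ⁻¹' W) := by
    refine contDiffOn_fst.prodMk (contDiffOn_snd.add (hψ.comp contDiffOn_fst fun y hy => hy))
  refine ⟨Prod.fst ⁻¹' W ∩ (fun y : ℝ × ℝ => (y.1, y.2 + ψ y.1)) ⁻¹' U,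
    hsm.continuousOn.isOpen_inter_preimage (hW.preimage continuous_fst) hU, ⟨h0W, ?_⟩, ?_⟩
  · simp only [Set.mem_preimage, Prod.fst_zero, Prod.snd_zero, hψ0, add_zero]
    exact h0U
  · exact hφ.comp (hsm.mono Set.inter_subset_left) fun y hy => hy.2

/-- The limit is the translation constant c of `facePoly_sheared`. Only the Taylor term of order k
can survive, and it does so only if it has w-degree exactly w₂. -/
lemma tendsto_of_iteratedDeriv_eq_zero {ψ : ℝ → ℝ} (hψ : SmoothNearZero ψ) {k : ℕ}
    (hk : ∀ j < k, iteratedDeriv j ψ 0 = 0) {w : ℝ × ℝ} (hw1 : 0 < w.1) (hw : w.2 ≤ k * w.1) :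
    Tendsto (fun t : ℝ => t ^ (-w.2) * ψ (t ^ w.1)) (𝓝[>] 0)
      (𝓝 (if w.2 = k * w.1 then iteratedDeriv k ψ 0 / (k.factorial : ℝ) else 0)) := by
  obtain ⟨C, hC, δ, hδ, hb⟩ := hψ.exists_taylor_one (k + 1)
  set a := iteratedDeriv k ψ 0 / (k.factorial : ℝ) with ha
  have hsum : ∀ x : ℝ, ∑ j ∈ Finset.range (k + 1),
      iteratedDeriv j ψ 0 / (j.factorial : ℝ) * x ^ j = a * x ^ k := by
    intro x
    rw [Finset.sum_range_succ, Finset.sum_eq_zero, zero_add]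
    intro j hj
    rw [hk j (Finset.mem_range.1 hj)]
    simp
  have hmain : Tendsto (fun t : ℝ => a * t ^ (k * w.1 - w.2)) (𝓝[>] 0)
      (𝓝 (if w.2 = k * w.1 then a else 0)) := by
    split_ifs with h
    · rw [← h]
      simp
    · have := (tendsto_rpow_nhdsGT_zero (sub_pos.2 (lt_of_le_of_ne hw h))).const_mul a
      simpa using this
  have hrem : Tendsto (fun t : ℝ => C * t ^ ((k + 1) * w.1 - w.2)) (𝓝[>] 0) (𝓝 0) := by
    have := (tendsto_rpow_nhdsGT_zero (s := (k + 1) * w.1 - w.2) (by linarith)).const_mul C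
    simpa using this
  have hdiff : Tendsto (fun t : ℝ => t ^ (-w.2) * ψ (t ^ w.1) - a * t ^ (k * w.1 - w.2)) (𝓝[>] 0)
      (𝓝 0) := by
    apply squeeze_zero_norm' _ hrem
    filter_upwards [self_mem_nhdsWithin,
      (tendsto_rpow_nhdsGT_zero hw1).eventually_lt_const hδ] with t ht hts
    have ht' : (0 : ℝ) < t := ht
    have hpos := Real.rpow_pos_of_pos ht' w.1
    have h1 := hb (t ^ w.1) (by rwa [abs_of_pos hpos])
    rw [hsum, abs_of_pos hpos] at h1
    have e1 : t ^ (-w.2) * ψ (t ^ w.1) - a * t ^ (k * w.1 - w.2) =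
        t ^ (-w.2) * (ψ (t ^ w.1) - a * (t ^ w.1) ^ k) := by
      rw [sub_eq_add_neg (k * w.1 : ℝ), Real.rpow_add ht', mul_comm (k : ℝ), Real.rpow_mul ht'.le,
        Real.rpow_natCast]
      ring
    have e2 : C * t ^ ((k + 1) * w.1 - w.2) = t ^ (-w.2) * (C * (t ^ w.1) ^ (k + 1)) := by
      rw [sub_eq_add_neg, Real.rpow_add ht', mul_comm ((k : ℝ) + 1), Real.rpow_mul ht'.le]
      have : (t ^ w.1) ^ ((k : ℝ) + 1) = (t ^ w.1) ^ (k + 1) := by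
        rw [← Real.rpow_natCast]
        push_cast
        rfl
      rw [this]
      ring
    rw [e1, e2, norm_mul, Real.norm_eq_abs, abs_of_pos (Real.rpow_pos_of_pos ht' _)]
    gcongr
    exact h1
  simpa using hdiff.add hmain

lemma SmoothNearZero.exists_bound_pow {ψ : ℝ → ℝ} (hψ : SmoothNearZero ψ) {k : ℕ}
    (hk : ∀ j < k, iteratedDeriv j ψ 0 = 0) :
    ∃ A ≥ 0, ∃ δ > 0, ∀ x : ℝ, |x| < δ → |ψ x| ≤ A * |x| ^ k := by
  obtain ⟨A, hA, δ, hδ, hb⟩ := hψ.exists_taylor_one k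
  refine ⟨A, hA, δ, hδ, fun x hx => ?_⟩
  have := hb x hx
  rwa [Finset.sum_eq_zero, sub_zero] at this
  intro j hj
  rw [hk j (Finset.mem_range.1 hj)]
  simp

/-- A coordinate change does not increase the order of vanishing. -/
lemma exists_taylorSupport_comp {φ : ℝ × ℝ → ℝ} (hφ : SmoothNearZero φ)
    {e : OpenPartialHomeomorph (ℝ × ℝ) (ℝ × ℝ)} (he : IsCoordChange e)
    (hs : SmoothNearZero (φ ∘ e)) {α : ℕ × ℕ} (hα : α ∈ taylorSupport φ) :
    ∃ β ∈ taylorSupport (φ ∘ e), β.1 + β.2 ≤ α.1 + α.2 := by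
  obtain ⟨h0, he0, -, hsymm⟩ := he
  by_contra hcon
  push Not at hcon
  set n := α.1 + α.2 with hn
  -- If φ ∘ e vanished to order n + 1, so would φ, because the inverse of e is O(‖x‖).
  obtain ⟨C₁, hC₁, δ₁, hδ₁, hb₁⟩ := hs.exists_taylor_two (n + 1)
  have hbound : ∀ y : ℝ × ℝ, ‖y‖ < min δ₁ 1 → |(φ ∘ e) y| ≤
      (C₁ + ∑ β ∈ Finset.range (n + 1) ×ˢ Finset.range (n + 1), |taylorCoeff (φ ∘ e) β|) *
        ‖y‖ ^ (n + 1) := by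
    intro y hy
    rw [lt_min_iff] at hy
    have h1 := hb₁ y hy.1
    have h2 : |∑ β ∈ Finset.range (n + 1) ×ˢ Finset.range (n + 1),
        taylorCoeff (φ ∘ e) β * (y.1 ^ β.1 * y.2 ^ β.2)| ≤
        (∑ β ∈ Finset.range (n + 1) ×ˢ Finset.range (n + 1), |taylorCoeff (φ ∘ e) β|) *
          ‖y‖ ^ (n + 1) := by
      rw [Finset.sum_mul]
      refine (Finset.abs_sum_le_sum_abs _ _).trans (Finset.sum_le_sum fun β _ => ?_)
      by_cases hβ : β ∈ taylorSupport (φ ∘ e)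
      · rw [abs_mul, abs_mul, abs_pow, abs_pow]
        gcongr
        calc |y.1| ^ β.1 * |y.2| ^ β.2 ≤ ‖y‖ ^ β.1 * ‖y‖ ^ β.2 := by
              gcongr
              · exact norm_fst_le y
              · exact norm_snd_le y
          _ = ‖y‖ ^ (β.1 + β.2) := (pow_add _ _ _).symm
          _ ≤ ‖y‖ ^ (n + 1) := pow_le_pow_of_le_one (norm_nonneg _) hy.2.le (hcon β hβ)
      · have : taylorCoeff (φ ∘ e) β = 0 := by
          by_contra hcon
          exact hβ (taylorCoeff_ne_zero.1 hcon)
        simp [this]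
    have h3 := abs_sub_le ((φ ∘ e) y) (∑ β ∈ Finset.range (n + 1) ×ˢ Finset.range (n + 1),
        taylorCoeff (φ ∘ e) β * (y.1 ^ β.1 * y.2 ^ β.2)) 0
    simp only [sub_zero] at h3
    rw [add_mul]
    exact h3.trans (add_le_add h1 h2)
  set C₂ := C₁ + ∑ β ∈ Finset.range (n + 1) ×ˢ Finset.range (n + 1), |taylorCoeff (φ ∘ e) β|
  have hC₂ : 0 ≤ C₂ := by positivity
  have h0t : (0 : ℝ × ℝ) ∈ e.target := by
    rw [← he0]
    exact e.map_source h0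
  have hsymm0 : e.symm 0 = 0 := by
    conv_lhs => rw [← he0]
    exact e.left_inv h0
  have hdiff : DifferentiableAt ℝ e.symm 0 :=
    (hsymm.differentiableOn (by simp)).differentiableAt (e.open_target.mem_nhds h0t)
  obtain ⟨K, hK⟩ := hdiff.isBigO_sub.bound
  have hcont : Tendsto (fun x => ‖e.symm x‖) (𝓝 0) (𝓝 0) := by
    have := hdiff.continuousAt.tendsto.norm
    rwa [hsymm0, norm_zero] at this
  have hφb : ∀ᶠ x in 𝓝 (0 : ℝ × ℝ), |φ x| ≤ C₂ * (K * ‖x‖) ^ (n + 1) := by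
    filter_upwards [hK, hcont.eventually_lt_const (show 0 < min δ₁ 1 by positivity),
      e.open_target.mem_nhds h0t] with x hx hx1 hx2
    have := hbound _ hx1
    rw [Function.comp_apply, e.right_inv hx2] at this
    refine this.trans ?_
    rw [hsymm0, sub_zero, sub_zero] at hx
    gcongr
  -- The exponent n + 1/2 is below n + 1, so the limit is 0, and above n, so the resulting bound on
  -- the Taylor support excludes α.
  have hlim : ∀ z, Tendsto (fun t : ℝ => t ^ (-((n : ℝ) + 1 / 2)) *
      φ (t ^ (1 : ℝ × ℝ).1, t ^ (1 : ℝ × ℝ).2 * z)) (𝓝[>] 0) (𝓝 ((fun _ => 0) z)) := by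
    intro z
    simp only [Prod.fst_one, Prod.snd_one, Real.rpow_one]
    have hx : Tendsto (fun t : ℝ => (t, t * z)) (𝓝[>] 0) (𝓝 (0 : ℝ × ℝ)) := by
      have : Continuous fun t : ℝ => (t, t * z) := by fun_prop
      have := this.tendsto 0
      rw [zero_mul] at this
      exact this.mono_left nhdsWithin_le_nhds
    have hz : Tendsto (fun t : ℝ => C₂ * (K * ‖((1 : ℝ), z)‖) ^ (n + 1) * t ^ (1 / 2 : ℝ)) (𝓝[>] 0)
        (𝓝 0) := by
      have := (tendsto_rpow_nhdsGT_zero (s := 1 / 2) (by norm_num)).const_mul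
        (C₂ * (K * ‖((1 : ℝ), z)‖) ^ (n + 1))
      simpa using this
    apply squeeze_zero_norm' _ hz
    filter_upwards [hx.eventually hφb, self_mem_nhdsWithin] with t ht htpos
    have ht' : (0 : ℝ) < t := htpos
    have e1 : ‖(t, t * z)‖ = t * ‖((1 : ℝ), z)‖ := by
      have : (t, t * z) = t • ((1 : ℝ), z) := by ext <;> simp
      rw [this, norm_smul, Real.norm_eq_abs, abs_of_pos ht']
    rw [e1] at ht
    rw [norm_mul, Real.norm_eq_abs, abs_of_pos (Real.rpow_pos_of_pos ht' _), Real.norm_eq_abs]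
    calc _ ≤ t ^ (-((n : ℝ) + 1 / 2)) * (C₂ * (K * (t * ‖((1 : ℝ), z)‖)) ^ (n + 1)) := by
          gcongr
      _ = C₂ * (K * ‖((1 : ℝ), z)‖) ^ (n + 1) * (t ^ (-((n : ℝ) + 1 / 2)) * t ^ (n + 1)) := by
        rw [show K * (t * ‖((1 : ℝ), z)‖) = (K * ‖((1 : ℝ), z)‖) * t by ring, mul_pow]
        ring
      _ = _ := by
        rw [← Real.rpow_natCast t (n + 1), ← Real.rpow_add ht']
        congr 2
        push_cast
        ring
  have := le_of_tendsto_dilates hφ (w := 1) (by simp) (by simp) hlim α hα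
  simp only [Prod.fst_one, Prod.snd_one, one_mul] at this
  have hn' : (n : ℝ) = α.1 + α.2 := by rw [hn]; push_cast; rfl
  linarith

lemma IsCoordChange.smoothNearZero_comp {φ : ℝ × ℝ → ℝ} (hφ : SmoothNearZero φ)
    {e : OpenPartialHomeomorph (ℝ × ℝ) (ℝ × ℝ)} (he : IsCoordChange e) :
    SmoothNearZero (φ ∘ e) := by
  obtain ⟨U, hU, h0U, hφ⟩ := hφ
  refine ⟨e.source ∩ e ⁻¹' U, e.isOpen_inter_preimage hU, ⟨he.1, ?_⟩, ?_⟩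
  · simpa [he.2.1] using h0U
  · exact hφ.comp (he.2.2.1.mono Set.inter_subset_left) fun y hy => hy.2

/-- The order of vanishing of φ bounds all these distances. Without a bound the real supremum
defining the height would take its default value 0. -/
lemma bddAbove_newtonDistance_comp {φ : ℝ × ℝ → ℝ} (hφ : SmoothNearZero φ) (hfin : FiniteType φ) :
    BddAbove {d : ℝ | ∃ e : OpenPartialHomeomorph (ℝ × ℝ) (ℝ × ℝ),
      IsCoordChange e ∧ d = newtonDistance (φ ∘ e)} := by
  obtain ⟨α, hα⟩ := hfin
  refine ⟨((α.1 + α.2 : ℕ) : ℝ), ?_⟩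
  rintro d ⟨e, he, rfl⟩
  obtain ⟨β, hβ, hle⟩ := exists_taylorSupport_comp hφ he (he.smoothNearZero_comp hφ) hα
  apply newtonDistance_le
  apply mem_newtonPolyhedron_of_le hβ
  · simp only
    exact_mod_cast (Nat.le_add_right _ _).trans hle
  · simp only
    exact_mod_cast (Nat.le_add_left _ _).trans hle

lemma isCoordChange_refl : IsCoordChange (OpenPartialHomeomorph.refl (ℝ × ℝ)) :=
  ⟨by simp, by simp, by simpa using contDiffOn_id, by simpa using contDiffOn_id⟩

lemma newtonDistance_le_newtonHeight {φ : ℝ × ℝ → ℝ} (hφ : SmoothNearZero φ)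
    (hfin : FiniteType φ) : newtonDistance φ ≤ newtonHeight φ :=
  le_csSup (bddAbove_newtonDistance_comp hφ hfin)
    ⟨OpenPartialHomeomorph.refl _, isCoordChange_refl, rfl⟩

lemma exists_coordChange_of_lt_newtonHeight {φ : ℝ × ℝ → ℝ} {d' : ℝ}
    (h : d' < newtonHeight φ) :
    ∃ e : OpenPartialHomeomorph (ℝ × ℝ) (ℝ × ℝ),
      IsCoordChange e ∧ d' < newtonDistance (φ ∘ e) := by
  have hne : {d : ℝ | ∃ e : OpenPartialHomeomorph (ℝ × ℝ) (ℝ × ℝ),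
      IsCoordChange e ∧ d = newtonDistance (φ ∘ e)}.Nonempty :=
    ⟨_, OpenPartialHomeomorph.refl _, isCoordChange_refl, rfl⟩
  obtain ⟨d, ⟨e, he, rfl⟩, hlt⟩ := exists_lt_of_lt_csSup hne h
  exact ⟨e, he, hlt⟩

/-! ### Shears that increase the Newton distance -/

/-- For face polynomials: the uppermost point of a face survives a shear acting by translation. -/
lemma coeff_natDegree_comp_X_add_C_ne_zero {q : ℝ[X]} (hq : q ≠ 0) (c : ℝ) :
    (q.comp (X + C c)).coeff q.natDegree ≠ 0 := by
  have h1 : (q.comp (X + C c)).natDegree = q.natDegree := by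
    rw [natDegree_comp, natDegree_X_add_C, mul_one]
  rw [← h1, coeff_natDegree, leadingCoeff_comp (by simp), leadingCoeff_X_add_C, one_pow, mul_one]
  exact leadingCoeff_ne_zero.2 hq

/-- The zeros of q at 0 and at c have multiplicities at least b and r, and 0 ≠ c. -/
lemma natDegree_ge_of_dvd {q : ℝ[X]} (hq : q ≠ 0) {c : ℝ} (hc : c ≠ 0) {b r : ℕ}
    (hb : X ^ b ∣ q) (hr : X ^ r ∣ q.comp (X + C c)) : b + r ≤ q.natDegree := by
  obtain ⟨u, hu⟩ := hr
  have h1 : (X - C c) ^ r ∣ q := by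
    refine ⟨u.comp (X - C c), ?_⟩
    have h2 : (q.comp (X + C c)).comp (X - C c) = q := by
      rw [comp_assoc]
      simp
    rw [← h2, hu]
    simp
  have hcop : IsCoprime (X ^ b : ℝ[X]) ((X - C c) ^ r) := by
    apply IsCoprime.pow
    have := isCoprime_X_sub_C_of_isUnit_sub (R := ℝ) (a := 0) (b := c) (by simpa using hc)
    simpa using this
  have h3 := natDegree_le_of_dvd (hcop.mul_dvd hb h1) hq
  rwa [natDegree_mul (by simp) (pow_ne_zero _ (X_sub_C_ne_zero c)), natDegree_pow, natDegree_pow,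
    natDegree_X, natDegree_X_sub_C, mul_one, mul_one] at h3

/-- A convex set that meets the line `t₁ + k t₂ = (1 + k) β` on both sides of the bisectrix
contains `(β, β)`. -/
lemma diagonal_mem_of_convex {N : Set (ℝ × ℝ)} (hN : Convex ℝ N) {k β : ℝ} {p q : ℝ × ℝ}
    (hp : p ∈ N) (hq : q ∈ N) (hpl : p.1 + k * p.2 = (1 + k) * β)
    (hql : q.1 + k * q.2 = (1 + k) * β) (hp2 : β ≤ p.2) (hq2 : q.2 ≤ β) : (β, β) ∈ N := by
  rcases eq_or_lt_of_le (hq2.trans hp2) with h | h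
  · have e1 : p.2 = β := le_antisymm (h ▸ hq2) hp2
    have e2 : p.1 = β := by
      rw [e1] at hpl
      linarith
    have : p = (β, β) := Prod.ext e2 e1
    rwa [← this]
  · have hpos : 0 < p.2 - q.2 := sub_pos.2 h
    have hmem := hN hp hq (a := (β - q.2) / (p.2 - q.2)) (b := (p.2 - β) / (p.2 - q.2))
      (div_nonneg (by linarith) hpos.le) (div_nonneg (by linarith) hpos.le) (by
        rw [← add_div]
        rw [div_eq_one_iff_eq hpos.ne']
        ring)
    convert hmem using 1
    have e1 : p.1 = (1 + k) * β - k * p.2 := by linarith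
    have e2 : q.1 = (1 + k) * β - k * q.2 := by linarith
    ext
    · simp only [Prod.fst_add, Prod.smul_fst, smul_eq_mul, e1, e2]
      field_simp
      ring
    · simp only [Prod.snd_add, Prod.smul_snd, smul_eq_mul]
      field_simp
      ring

section Shear

variable {φ : ℝ × ℝ → ℝ} {ψ : ℝ → ℝ} {κ : ℝ × ℝ}

/-- A shear whose order `k` is smaller than `κ₂ / κ₁` does not increase the Newton distance. -/
lemma newtonDistance_sheared_le_of_order_lt (hφ : SmoothNearZero φ) (hfin : FiniteType φ)
    (hφ0 : φ 0 = 0) (hψ : SmoothNearZero ψ) (hψ0 : ψ 0 = 0) (hκ1 : 0 ≤ κ.1)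
    (hκN : ∀ t ∈ newtonPolyhedron φ, 1 ≤ κ.1 * t.1 + κ.2 * t.2)
    (hκd : κ.1 * newtonDistance φ + κ.2 * newtonDistance φ = 1)
    {k : ℕ} (hk1 : 1 ≤ k) (hk : ∀ j < k, iteratedDeriv j ψ 0 = 0) (hkne : iteratedDeriv k ψ 0 ≠ 0)
    (hlt : k * κ.1 < κ.2) : newtonDistance (sheared φ ψ) ≤ newtonDistance φ := by
  have hd := newtonDistance_mem hfin
  have hdpos := newtonDistance_pos hfin hφ0
  set d := newtonDistance φ with hd_def
  have hk1' : (1 : ℝ) ≤ k := by exact_mod_cast hk1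
  have hkpos : (0 : ℝ) < k := by linarith
  -- For this weight the leading term of ψ is homogeneous of degree w₂, so the shear translates the
  -- face polynomial by a nonzero constant.
  set w : ℝ × ℝ := (1, k) with hw
  have hw1 : 0 < w.1 := one_pos
  have hw2 : 0 < w.2 := hkpos
  obtain ⟨α, hα, hmin⟩ := exists_min_taylorSupport hfin hw1.le hw2.le
  set s := w.1 * (α.1 : ℝ) + w.2 * (α.2 : ℝ) with hs
  have hsd : s ≤ (1 + k) * d := by
    have := le_of_mem_newtonPolyhedron hw1.le hw2.le hmin _ hd
    simp only [hw] at this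
    linarith
  -- points of the face lie above the height `d`
  have habove : ∀ a b : ℕ, (a, b) ∈ taylorSupport φ → (a : ℝ) + k * b = s → d ≤ b := by
    intro a b hab hline
    have h1 := hκN ((a : ℝ), (b : ℝ)) (mem_newtonPolyhedron_of_le hab le_rfl le_rfl)
    simp only at h1
    have h2 : κ.1 * ((a : ℝ) + k * b) ≤ κ.1 * ((1 + k) * d) := by
      rw [hline]
      gcongr
    have h3 : 0 ≤ (κ.2 - k * κ.1) * (b - d) := by nlinarith
    by_contra hcon
    nlinarith
  obtain ⟨M, hM1, hM2⟩ := exists_nat_mul_gt s hw1 hw2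
  have hc : iteratedDeriv k ψ 0 / (k.factorial : ℝ) ≠ 0 := div_ne_zero hkne (by positivity)
  have hlim := tendsto_of_iteratedDeriv_eq_zero hψ hk hw1 (show w.2 ≤ k * w.1 by simp [hw])
  rw [if_pos (by simp [hw])] at hlim
  obtain ⟨hTa, hface⟩ := facePoly_sheared hφ (hφ.sheared hψ hψ0) hw1 hw2 hM1 hM2 hmin hlim
  set c := iteratedDeriv k ψ 0 / (k.factorial : ℝ)
  set q := facePoly φ w s M
  have hqα : q.coeff α.2 ≠ 0 := facePoly_coeff_ne_zero hw1 hw2 hM1 hM2 hα hs.symm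
  have hq0 : q ≠ 0 := by
    intro h
    rw [h] at hqα
    simp at hqα
  set β := s / (1 + k) with hβ
  have hβs : (1 + k) * β = s := by
    rw [hβ]
    field_simp
  have hβd : β ≤ d := by
    rw [hβ, div_le_iff₀ (by linarith)]
    linarith
  have hspos : 0 < s := by
    have h1 := habove α.1 α.2 hα (by simp [hs, hw])
    have : s = α.1 + k * α.2 := by simp [hs, hw]
    have h2 : (0 : ℝ) ≤ α.1 := by positivity
    nlinarith
  have hβpos : 0 < β := by positivity
  have hXb : X ^ ⌈d⌉₊ ∣ q := by
    rw [X_pow_dvd_iff]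
    intro b hb
    by_contra hne
    obtain ⟨a, hab, hline⟩ := exists_of_facePoly_coeff_ne_zero hne
    have := habove a b hab (by simpa [hw] using hline)
    exact absurd (Nat.ceil_le.2 this) (not_le.2 hb)
  have hdeg : (k : ℝ) * q.natDegree ≤ s := by
    obtain ⟨a, -, hline⟩ := exists_of_facePoly_coeff_ne_zero
      (show q.coeff q.natDegree ≠ 0 from leadingCoeff_ne_zero.2 hq0)
    have h2 : (0 : ℝ) ≤ a := by positivity
    simp only [hw] at hline
    linarith
  -- the face of the sheared function reaches the lower side of the bisectrix
  obtain ⟨a, b, hab, hline, hba⟩ : ∃ a b : ℕ, (a, b) ∈ taylorSupport (sheared φ ψ) ∧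
      (a : ℝ) + k * b = s ∧ (b : ℝ) ≤ β := by
    by_contra hcon
    push Not at hcon
    have hXr : X ^ (⌊β⌋₊ + 1) ∣ q.comp (X + C c) := by
      rw [X_pow_dvd_iff]
      intro b hb
      by_contra hne
      rw [← hface] at hne
      obtain ⟨a, hab, hline⟩ := exists_of_facePoly_coeff_ne_zero hne
      have h1 := hcon a b hab (by simpa [hw] using hline)
      have h2 : (b : ℝ) ≤ ⌊β⌋₊ := by exact_mod_cast Nat.lt_succ_iff.1 hb
      have h3 := Nat.floor_le hβpos.le
      linarith
    have h1 := natDegree_ge_of_dvd hq0 hc hXb hXr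
    have h2 : ((⌈d⌉₊ : ℝ) + (⌊β⌋₊ + 1)) ≤ q.natDegree := by exact_mod_cast h1
    have h3 := Nat.le_ceil d
    have h4 := Nat.lt_floor_add_one β
    -- The zeros at 0 and c force deg q > d + β ≥ 2β, whereas k · deg q ≤ s = (1 + k)β ≤ 2kβ because
    -- k ≥ 1.
    have h5 : 2 * β < q.natDegree := by linarith
    nlinarith
  obtain ⟨a', ha', hline'⟩ := exists_of_facePoly_coeff_ne_zero
    (show (facePoly (sheared φ ψ) w s M).coeff q.natDegree ≠ 0 by
      rw [hface]
      exact coeff_natDegree_comp_X_add_C_ne_zero hq0 c)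
  have htop : d ≤ q.natDegree := by
    obtain ⟨a'', ha'', hline''⟩ := exists_of_facePoly_coeff_ne_zero
      (show q.coeff q.natDegree ≠ 0 from leadingCoeff_ne_zero.2 hq0)
    exact habove _ _ ha'' (by simpa [hw] using hline'')
  have hmem : (β, β) ∈ newtonPolyhedron (sheared φ ψ) := by
    refine diagonal_mem_of_convex convex_newtonPolyhedron (k := k)
      (mem_newtonPolyhedron_of_le ha' le_rfl le_rfl : ((a' : ℝ), (q.natDegree : ℝ)) ∈ _)
      (mem_newtonPolyhedron_of_le hab le_rfl le_rfl : ((a : ℝ), (b : ℝ)) ∈ _) ?_ ?_ ?_ ?_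
    · rw [hβs]
      simpa [hw] using hline'
    · rw [hβs]
      exact hline
    · exact hβd.trans htop
    · exact hba
  exact (newtonDistance_le hmem).trans hβd

/-- If the principal face lies on a horizontal line, then a shear by a flat function does not
increase the Newton distance. -/
lemma newtonDistance_sheared_le_of_flat (hφ : SmoothNearZero φ) (hfin : FiniteType φ)
    (hψ : SmoothNearZero ψ) (hψ0 : ψ 0 = 0) (hκ1 : κ.1 = 0) (hκ2 : 0 < κ.2)
    (hκN : ∀ t ∈ newtonPolyhedron φ, 1 ≤ κ.1 * t.1 + κ.2 * t.2)
    (hκd : κ.1 * newtonDistance φ + κ.2 * newtonDistance φ = 1)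
    (hflat : ∀ j, iteratedDeriv j ψ 0 = 0) : newtonDistance (sheared φ ψ) ≤ newtonDistance φ := by
  have hd := newtonDistance_mem hfin
  set d := newtonDistance φ with hd_def
  -- The vertex has height d because κ₁ = 0; that u = (1, 1) does not increase then puts its first
  -- coordinate at or below d.
  obtain ⟨v, hv, hv1, hv2⟩ := exists_extremePoint_of_min (w := κ) (u := (1, 1)) one_pos one_pos hd
    (by simpa only [hκd] using hκN)
  obtain ⟨α, hα, rfl⟩ := exists_taylorSupport_of_mem_extremePoints hv
  simp only [hκ1, zero_mul, zero_add, one_mul] at hv1 hv2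
  have hα2 : (α.2 : ℝ) = d := mul_left_cancel₀ hκ2.ne' hv1
  have hα1 : (α.1 : ℝ) ≤ d := by linarith
  have hge : ∀ β ∈ taylorSupport φ, α.2 ≤ β.2 := by
    intro β hβ
    have := hκN ((β.1 : ℝ), (β.2 : ℝ)) (mem_newtonPolyhedron_of_le hβ le_rfl le_rfl)
    simp only [hκ1, zero_mul, zero_add] at this hκd
    have h2 : κ.2 * (α.2 : ℝ) ≤ κ.2 * (β.2 : ℝ) := by
      rw [hα2]
      linarith
    exact_mod_cast le_of_mul_le_mul_left h2 hκ2
  -- With k > α₁ a minimizer of the weight (1, k) cannot lie higher than α, since one step up costs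
  -- more than α₁. So it has the height of α and lies at or to the left of it. The shear, being
  -- flat, leaves this face polynomial unchanged.
  set k := α.1 + 1 with hk
  have hkpos : (0 : ℝ) < k := by positivity
  set w : ℝ × ℝ := (1, k) with hw
  have hw1 : 0 < w.1 := one_pos
  have hw2 : 0 < w.2 := hkpos
  obtain ⟨β, hβ, hmin⟩ := exists_min_taylorSupport hfin hw1.le hw2.le
  have hβα := hmin α hα
  simp only [hw, one_mul] at hβα
  have hβα' : β.1 + k * β.2 ≤ α.1 + k * α.2 := by exact_mod_cast hβα
  have hβ2 : β.2 = α.2 := by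
    refine le_antisymm ?_ (hge β hβ)
    by_contra hcon
    have : k * (α.2 + 1) ≤ k * β.2 := Nat.mul_le_mul_left k (not_le.1 hcon)
    rw [mul_add] at this
    omega
  have hβ1 : β.1 ≤ α.1 := by
    rw [hβ2] at hβα'
    omega
  set s := w.1 * (β.1 : ℝ) + w.2 * (β.2 : ℝ) with hs
  obtain ⟨M, hM1, hM2⟩ := exists_nat_mul_gt s hw1 hw2
  have hlim := tendsto_of_iteratedDeriv_eq_zero hψ (k := k) (fun j _ => hflat j) hw1
    (show w.2 ≤ k * w.1 by simp [hw])
  rw [if_pos (by simp [hw]), hflat, zero_div] at hlim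
  obtain ⟨-, hface⟩ := facePoly_sheared hφ (hφ.sheared hψ hψ0) hw1 hw2 hM1 hM2 hmin hlim
  have hne := facePoly_coeff_ne_zero hw1 hw2 hM1 hM2 hβ hs.symm
  rw [C_0, add_zero, comp_X] at hface
  rw [← hface] at hne
  obtain ⟨a, ha, hline⟩ := exists_of_facePoly_coeff_ne_zero hne
  simp only [hs, hw, one_mul] at hline
  have ha1 : (a : ℝ) = β.1 := by linarith
  have hβ1' : (β.1 : ℝ) ≤ α.1 := by exact_mod_cast hβ1
  apply newtonDistance_le
  refine mem_newtonPolyhedron_of_le ha ?_ ?_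
  · simp only
    linarith
  · simp only [hβ2]
    exact hα2.le

/-- If the weight `κ` satisfies `κ₂ ≤ k κ₁`, then a shear of order at least `k` keeps the
supporting line `L_κ` and the upper endpoint of the face on it. -/
lemma exists_mem_weightLine_sheared (hφ : SmoothNearZero φ) (hfin : FiniteType φ)
    (hψ : SmoothNearZero ψ) (hψ0 : ψ 0 = 0) (hκ1 : 0 < κ.1) (hκ2 : 0 < κ.2)
    (hκN : ∀ t ∈ newtonPolyhedron φ, 1 ≤ κ.1 * t.1 + κ.2 * t.2)
    (hκd : κ.1 * newtonDistance φ + κ.2 * newtonDistance φ = 1)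
    {k : ℕ} (hk : ∀ j < k, iteratedDeriv j ψ 0 = 0) (hle : κ.2 ≤ k * κ.1) :
    (∀ t ∈ newtonPolyhedron (sheared φ ψ), 1 ≤ κ.1 * t.1 + κ.2 * t.2) ∧
      FiniteType (sheared φ ψ) ∧
      ∃ t ∈ weightLine κ ∩ newtonPolyhedron (sheared φ ψ), newtonDistance φ ≤ t.2 := by
  have hd := newtonDistance_mem hfin
  set d := newtonDistance φ with hd_def
  -- On L_κ this u equals 1 + t₁, so the vertex found lies at or to the left of (d, d), hence at
  -- height at least d.
  obtain ⟨v, hv, hv1, hv2⟩ := exists_extremePoint_of_min (w := κ) (u := (κ.1 + 1, κ.2))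
    (by simp only; linarith) hκ2 hd (by simpa only [hκd] using hκN)
  obtain ⟨α, hα, rfl⟩ := exists_taylorSupport_of_mem_extremePoints hv
  simp only at hv1 hv2
  rw [hκd] at hv1
  have hα1 : (α.1 : ℝ) ≤ d := by linarith
  have hα2 : d ≤ α.2 := by
    have : κ.1 * (α.1 : ℝ) ≤ κ.1 * d := by gcongr
    exact le_of_mul_le_mul_left (by linarith) hκ2
  have hT : ∀ β ∈ taylorSupport φ, 1 ≤ κ.1 * (β.1 : ℝ) + κ.2 * (β.2 : ℝ) := fun β hβ =>
    hκN ((β.1 : ℝ), (β.2 : ℝ)) (mem_newtonPolyhedron_of_le hβ le_rfl le_rfl)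
  obtain ⟨M, hM1, hM2⟩ := exists_nat_mul_gt 1 hκ1 hκ2
  obtain ⟨hTa, hface⟩ := facePoly_sheared hφ (hφ.sheared hψ hψ0) hκ1 hκ2 hM1 hM2 hT
    (tendsto_of_iteratedDeriv_eq_zero hψ hk hκ1 hle)
  have hqα := facePoly_coeff_ne_zero hκ1 hκ2 hM1 hM2 hα hv1
  set q := facePoly φ κ 1 M
  have hq0 : q ≠ 0 := by
    intro h
    rw [h] at hqα
    simp at hqα
  have hdeg : (α.2 : ℝ) ≤ q.natDegree := by exact_mod_cast le_natDegree_of_ne_zero hqα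
  have hcoeff := coeff_natDegree_comp_X_add_C_ne_zero hq0
    (if κ.2 = k * κ.1 then iteratedDeriv k ψ 0 / (k.factorial : ℝ) else 0)
  rw [← hface] at hcoeff
  obtain ⟨a, ha, hline⟩ := exists_of_facePoly_coeff_ne_zero hcoeff
  exact ⟨le_of_mem_newtonPolyhedron hκ1.le hκ2.le hTa, ⟨_, ha⟩, ((a : ℝ), (q.natDegree : ℝ)),
    ⟨hline, mem_newtonPolyhedron_of_le ha le_rfl le_rfl⟩, hα2.trans hdeg⟩

/-- The structure of a shear that increases the Newton distance. -/
theorem exists_order_of_newtonDistance_lt (hφ : SmoothNearZero φ) (hfin : FiniteType φ)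
    (hφ0 : φ 0 = 0) (hψ : SmoothNearZero ψ) (hψ0 : ψ 0 = 0)
    (hκ : IsPrincipalWeight (newtonPolyhedron φ) κ) (hκle : κ.1 ≤ κ.2)
    (hlt : newtonDistance φ < newtonDistance (sheared φ ψ)) :
    0 < κ.1 ∧
      (∃ k : ℕ, κ.2 ≤ k * κ.1 ∧
        ∃ A ≥ 0, ∃ δ > 0, ∀ x : ℝ, |x| < δ → |ψ x| ≤ A * |x| ^ k) ∧
      FiniteType (sheared φ ψ) ∧
      (∀ t ∈ newtonPolyhedron (sheared φ ψ), 1 ≤ κ.1 * t.1 + κ.2 * t.2) ∧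
      (weightLine κ ∩ newtonPolyhedron (sheared φ ψ)).Nonempty ∧
      ∀ t ∈ weightLine κ ∩ newtonPolyhedron (sheared φ ψ), t.1 < t.2 := by
  obtain ⟨⟨hκ1, -, hκN, -⟩, hκd, -⟩ := hκ
  change κ.1 * newtonDistance φ + κ.2 * newtonDistance φ = 1 at hκd
  have hdpos := newtonDistance_pos hfin hφ0
  have hκ2 : 0 < κ.2 := by
    by_contra hcon
    nlinarith
  have hcase : 0 < κ.1 ∧ ∃ k : ℕ, κ.2 ≤ k * κ.1 ∧ ∀ j < k, iteratedDeriv j ψ 0 = 0 := by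
    by_cases hk : ∃ k, iteratedDeriv k ψ 0 ≠ 0
    · classical
      have hmin : ∀ j < Nat.find hk, iteratedDeriv j ψ 0 = 0 := fun j hj =>
        not_not.1 (Nat.find_min hk hj)
      have hne := Nat.find_spec hk
      set k := Nat.find hk
      have hk1 : 1 ≤ k := by
        by_contra hcon
        have : k = 0 := by omega
        rw [this] at hne
        simp [hψ0] at hne
      have hle : κ.2 ≤ k * κ.1 := by
        by_contra hcon
        exact absurd (newtonDistance_sheared_le_of_order_lt hφ hfin hφ0 hψ hψ0 hκ1 hκN hκd hk1 hmin
          hne (not_le.1 hcon)) (not_le.2 hlt)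
      refine ⟨?_, k, hle, hmin⟩
      by_contra hcon
      have : κ.1 = 0 := le_antisymm (not_lt.1 hcon) hκ1
      rw [this, mul_zero] at hle
      linarith
    · push Not at hk
      have hpos : 0 < κ.1 := by
        by_contra hcon
        exact absurd (newtonDistance_sheared_le_of_flat hφ hfin hψ hψ0
          (le_antisymm (not_lt.1 hcon) hκ1) hκ2 hκN hκd hk) (not_le.2 hlt)
      -- All derivatives of ψ vanish here, so any sufficiently large k will do.
      obtain ⟨k, hk'⟩ := exists_nat_ge (κ.2 / κ.1)
      exact ⟨hpos, k, (div_le_iff₀ hpos).1 hk', fun j _ => hk j⟩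
  obtain ⟨hpos, k, hle, hk⟩ := hcase
  obtain ⟨hN, hfa, v, hv, hv2⟩ := exists_mem_weightLine_sheared hφ hfin hψ hψ0 hpos hκ2 hκN hκd
    hk hle
  refine ⟨hpos, ⟨k, hle, hψ.exists_bound_pow hk⟩, hfa, hN, ⟨v, hv⟩, fun t ht => ?_⟩
  -- A point of the face on or below the bisectrix, joined to the point v at height at least d(φ),
  -- would put (d(φ), d(φ)) into the new polyhedron.
  by_contra hcon
  push Not at hcon
  have hline : ∀ s ∈ weightLine κ, s.1 + κ.2 / κ.1 * s.2 = (1 + κ.2 / κ.1) * newtonDistance φ := by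
    intro s hs
    have hs' : κ.1 * s.1 + κ.2 * s.2 = 1 := hs
    field_simp
    linarith
  have ht' : κ.1 * t.1 + κ.2 * t.2 = 1 := ht.1
  have hle2 : t.2 ≤ newtonDistance φ := by
    by_contra h
    push Not at h
    nlinarith
  exact absurd (newtonDistance_le (diagonal_mem_of_convex convex_newtonPolyhedron hv.2 ht.2
    (hline v hv.1) (hline t ht.1) hv2 hle2)) (not_le.2 hlt)

end Shear

/-! ### Dilations of Schwartz functions -/

/-- The diagonal dilation of `ℝ³` with factors `l i`. -/
def dilation (l : Fin 3 → ℝ) (hl : ∀ i, l i ≠ 0) :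
    EuclideanSpace ℝ (Fin 3) ≃L[ℝ] EuclideanSpace ℝ (Fin 3) :=
  LinearEquiv.toContinuousLinearEquiv
    { toFun := fun x => WithLp.toLp 2 fun i => l i * x i
      invFun := fun x => WithLp.toLp 2 fun i => (l i)⁻¹ * x i
      map_add' := fun x y => by
        ext i
        simp [mul_add]
      map_smul' := fun c x => by
        ext i
        simp [mul_left_comm]
      left_inv := fun x => by
        ext i
        simp [hl i]
      right_inv := fun x => by
        ext i
        simp [hl i] }

section Dilation

variable {l : Fin 3 → ℝ} (hl : ∀ i, l i ≠ 0)

lemma dilation_apply (x : EuclideanSpace ℝ (Fin 3)) (i : Fin 3) :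
    dilation l hl x i = l i * x i := rfl

lemma dilation_symm_apply (x : EuclideanSpace ℝ (Fin 3)) (i : Fin 3) :
    (dilation l hl).symm x i = (l i)⁻¹ * x i := rfl

lemma det_dilation :
    LinearMap.det ((dilation l hl : EuclideanSpace ℝ (Fin 3) ≃L[ℝ] EuclideanSpace ℝ (Fin 3)) :
      EuclideanSpace ℝ (Fin 3) →ₗ[ℝ] EuclideanSpace ℝ (Fin 3)) = l 0 * l 1 * l 2 := by
  rw [← LinearMap.det_toMatrix (EuclideanSpace.basisFun (Fin 3) ℝ).toBasis]
  have : LinearMap.toMatrix (EuclideanSpace.basisFun (Fin 3) ℝ).toBasis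
      (EuclideanSpace.basisFun (Fin 3) ℝ).toBasis
      ((dilation l hl : EuclideanSpace ℝ (Fin 3) ≃L[ℝ] EuclideanSpace ℝ (Fin 3)) :
        EuclideanSpace ℝ (Fin 3) →ₗ[ℝ] EuclideanSpace ℝ (Fin 3)) = Matrix.diagonal l := by
    ext i j
    rw [LinearMap.toMatrix_apply]
    by_cases h : i = j
    · subst h
      simp [dilation_apply]
    · simp [dilation_apply, h]
  rw [this, Matrix.det_diagonal, Fin.prod_univ_three]

lemma fourier_comp_dilation (hpos : ∀ i, 0 < l i) (f : EuclideanSpace ℝ (Fin 3) → ℂ)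
    (ξ : EuclideanSpace ℝ (Fin 3)) :
    𝓕 (f ∘ dilation l hl) ξ = ((l 0 * l 1 * l 2)⁻¹ : ℝ) • 𝓕 f ((dilation l hl).symm ξ) := by
  have hp : 0 < l 0 * l 1 * l 2 := mul_pos (mul_pos (hpos 0) (hpos 1)) (hpos 2)
  rw [Real.fourier_eq, Real.fourier_eq]
  have hinner : ∀ x, inner ℝ (dilation l hl x) ((dilation l hl).symm ξ) = inner ℝ x ξ := by
    intro x
    simp only [PiLp.inner_apply, dilation_apply, dilation_symm_apply, RCLike.inner_apply,
      conj_trivial]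
    refine Finset.sum_congr rfl fun i _ => ?_
    have := hl i
    field_simp
  have hmap : Measure.map (dilation l hl) volume =
      ENNReal.ofReal ((l 0 * l 1 * l 2)⁻¹) • (volume : Measure (EuclideanSpace ℝ (Fin 3))) := by
    have h := Measure.map_linearMap_addHaar_eq_smul_addHaar
      (volume : Measure (EuclideanSpace ℝ (Fin 3)))
      (f := ((dilation l hl : EuclideanSpace ℝ (Fin 3) ≃L[ℝ] EuclideanSpace ℝ (Fin 3)) :
        EuclideanSpace ℝ (Fin 3) →ₗ[ℝ] EuclideanSpace ℝ (Fin 3)))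
      (by rw [det_dilation]; exact hp.ne')
    rw [det_dilation, abs_of_pos (inv_pos.2 hp)] at h
    exact h
  have h2 := ((dilation l hl).toHomeomorph.measurableEmbedding).integral_map (μ := volume)
    (g := fun y => Real.fourierChar (-(inner ℝ y ((dilation l hl).symm ξ))) • f y)
  have h3 : (fun x => Real.fourierChar (-(inner ℝ x ξ)) • (f ∘ dilation l hl) x) =
      fun x => Real.fourierChar (-(inner ℝ (dilation l hl x) ((dilation l hl).symm ξ))) •
        f (dilation l hl x) := by
    funext x
    rw [hinner]
    rfl
  rw [h3]
  refine h2.symm.trans ?_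
  have h4 : Measure.map (dilation l hl).toHomeomorph volume =
      Measure.map (dilation l hl) volume := rfl
  rw [h4, hmap, integral_smul_measure, ENNReal.toReal_ofReal (inv_nonneg.2 hp.le)]

end Dilation

lemma map_volume_prodMap_mul {a b : ℝ} (ha : 0 < a) (hb : 0 < b) :
    Measure.map (Prod.map (a * ·) (b * ·)) (volume : Measure (ℝ × ℝ)) =
      ENNReal.ofReal ((a * b)⁻¹) • volume := by
  rw [Measure.volume_eq_prod, ← Measure.map_prod_map _ _ (by fun_prop) (by fun_prop),
    Real.map_volume_mul_left ha.ne', Real.map_volume_mul_left hb.ne', Measure.prod_smul_left,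
    Measure.prod_smul_right, smul_smul, ← ENNReal.ofReal_mul (abs_nonneg _), ← abs_mul, mul_inv,
    abs_of_pos (by positivity)]

/-- The inner and the outer norm scale separately, each by its Jacobian to the power -1/p. The
inequality suffices for the test functions. -/
lemma mixedNorm_comp_dilation_le (p₁ p₃ : ℝ≥0∞) {l : Fin 3 → ℝ} (hl : ∀ i, l i ≠ 0)
    (hpos : ∀ i, 0 < l i) (f : EuclideanSpace ℝ (Fin 3) → ℂ) :
    mixedNorm p₁ p₃ (f ∘ dilation l hl) ≤
      ENNReal.ofReal ((l 0 * l 1)⁻¹ ^ (1 / p₁).toReal * (l 2)⁻¹ ^ (1 / p₃).toReal) *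
        mixedNorm p₁ p₃ f := by
  have h01 : 0 < l 0 * l 1 := mul_pos (hpos 0) (hpos 1)
  have h2 : 0 < l 2 := hpos 2
  have hinner : ∀ x₃ : ℝ, eLpNorm (fun x : ℝ × ℝ => (f ∘ dilation l hl) !₂[x.1, x.2, x₃]) p₁ volume
      = ENNReal.ofReal ((l 0 * l 1)⁻¹ ^ (1 / p₁).toReal) *
        eLpNorm (fun x : ℝ × ℝ => f !₂[x.1, x.2, l 2 * x₃]) p₁ volume := by
    intro x₃
    have hemb : MeasurableEmbedding (Prod.map (l 0 * ·) (l 1 * ·) : ℝ × ℝ → ℝ × ℝ) :=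
      (measurableEmbedding_mulLeft₀ (hl 0)).prodMap (measurableEmbedding_mulLeft₀ (hl 1))
    have e1 := hemb.eLpNorm_map_measure (μ := volume) (p := p₁)
      (g := fun x : ℝ × ℝ => f !₂[x.1, x.2, l 2 * x₃])
    rw [map_volume_prodMap_mul (hpos 0) (hpos 1),
      eLpNorm_smul_measure_of_ne_zero (ENNReal.ofReal_pos.2 (inv_pos.2 h01)).ne', smul_eq_mul,
      ENNReal.ofReal_rpow_of_pos (inv_pos.2 h01)] at e1
    rw [e1]
    congr 1
    funext x
    simp only [Function.comp_apply]
    congr 1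
    ext i
    fin_cases i <;> simp [dilation_apply]
  have houter : eLpNorm (fun x₃ : ℝ =>
      eLpNorm (fun x : ℝ × ℝ => f !₂[x.1, x.2, l 2 * x₃]) p₁ volume) p₃ volume =
      ENNReal.ofReal ((l 2)⁻¹ ^ (1 / p₃).toReal) * mixedNorm p₁ p₃ f := by
    have e1 := (measurableEmbedding_mulLeft₀ (hl 2)).eLpNorm_map_measure (μ := volume) (p := p₃)
      (g := fun x₃ : ℝ => eLpNorm (fun x : ℝ × ℝ => f !₂[x.1, x.2, x₃]) p₁ volume)
    rw [Real.map_volume_mul_left (hl 2), abs_of_pos (inv_pos.2 h2),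
      eLpNorm_smul_measure_of_ne_zero (by simpa using h2), smul_eq_mul,
      ENNReal.ofReal_rpow_of_pos (inv_pos.2 h2)] at e1
    exact e1.symm
  rw [mixedNorm]
  simp_rw [hinner]
  calc _ ≤ ENNReal.ofReal ((l 0 * l 1)⁻¹ ^ (1 / p₁).toReal) * eLpNorm (fun x₃ : ℝ =>
        eLpNorm (fun x : ℝ × ℝ => f !₂[x.1, x.2, l 2 * x₃]) p₁ volume) p₃ volume := by
        apply eLpNorm_le_nnreal_smul_eLpNorm_of_ae_le_mul'
        exact Eventually.of_forall fun x => le_of_eq rfl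
    _ = _ := by
      rw [houter, ENNReal.ofReal_mul (by positivity), mul_assoc]

/-- Decay of order k₁ + k₃ in ℝ³ dominates a product of decay of order k₁ in (x₁, x₂) and of order
k₃ in x₃. Finiteness makes the constant in the Knapp inequality a real number. -/
lemma mixedNorm_schwartz_lt_top (p₁ p₃ : ℝ≥0∞) (f : 𝓢(EuclideanSpace ℝ (Fin 3), ℂ)) :
    mixedNorm p₁ p₃ f < ⊤ := by
  obtain ⟨k₁, hk₁⟩ := Measure.HasTemperateGrowth.exists_eLpNorm_lt_top p₁
    (μ := (volume : Measure (ℝ × ℝ))) inferInstance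
  obtain ⟨k₃, hk₃⟩ := Measure.HasTemperateGrowth.exists_eLpNorm_lt_top p₃
    (μ := (volume : Measure ℝ)) inferInstance
  set A := 2 ^ (k₁ + k₃) *
    (Finset.Iic (k₁ + k₃, 0)).sup (fun m => SchwartzMap.seminorm ℝ m.1 m.2) f with hA
  have hbound : ∀ (x : ℝ × ℝ) (x₃ : ℝ), ‖f !₂[x.1, x.2, x₃]‖ ≤
      A * (1 + ‖x₃‖) ^ (-k₃ : ℝ) * ‖(1 + ‖x‖) ^ (-k₁ : ℝ)‖ := by
    intro x x₃
    set y : EuclideanSpace ℝ (Fin 3) := !₂[x.1, x.2, x₃] with hy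
    have h1 := SchwartzMap.one_add_le_sup_seminorm_apply (𝕜 := ℝ) (m := (k₁ + k₃, 0)) le_rfl le_rfl
      f y
    rw [norm_iteratedFDeriv_zero, ← hA] at h1
    have hx0 : ‖y 0‖ ≤ ‖y‖ := PiLp.norm_apply_le y 0
    have hx1 : ‖y 1‖ ≤ ‖y‖ := PiLp.norm_apply_le y 1
    have hx2 : ‖y 2‖ ≤ ‖y‖ := PiLp.norm_apply_le y 2
    have hx : ‖x‖ ≤ ‖y‖ := by
      rw [Prod.norm_def]
      exact max_le hx0 hx1
    have hx3 : ‖x₃‖ ≤ ‖y‖ := hx2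
    have p1 : 0 < 1 + ‖x‖ := by positivity
    have p3 : 0 < 1 + ‖x₃‖ := by positivity
    rw [Real.norm_of_nonneg (Real.rpow_nonneg p1.le _), Real.rpow_neg p1.le, Real.rpow_neg p3.le,
      Real.rpow_natCast, Real.rpow_natCast]
    have h2 : (1 + ‖x‖) ^ k₁ * (1 + ‖x₃‖) ^ k₃ * ‖f y‖ ≤ A := by
      refine le_trans ?_ h1
      rw [pow_add]
      gcongr
    have h3 : 0 < (1 + ‖x‖) ^ k₁ * (1 + ‖x₃‖) ^ k₃ := by positivity
    calc ‖f y‖ = ((1 + ‖x‖) ^ k₁ * (1 + ‖x₃‖) ^ k₃ * ‖f y‖) *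
          (((1 + ‖x₃‖) ^ k₃)⁻¹ * ((1 + ‖x‖) ^ k₁)⁻¹) := by
          field_simp
      _ ≤ A * (((1 + ‖x₃‖) ^ k₃)⁻¹ * ((1 + ‖x‖) ^ k₁)⁻¹) := by gcongr
      _ = _ := by ring
  have hA0 : 0 ≤ A := by positivity
  set B := eLpNorm (fun x : ℝ × ℝ => (1 + ‖x‖) ^ (-k₁ : ℝ)) p₁ volume with hB
  have hinner : ∀ x₃ : ℝ, eLpNorm (fun x : ℝ × ℝ => f !₂[x.1, x.2, x₃]) p₁ volume ≤
      ((ENNReal.ofReal A * B).toNNReal : ℝ≥0∞) * ‖(1 + ‖x₃‖) ^ (-k₃ : ℝ)‖ₑ := by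
    intro x₃
    refine (eLpNorm_le_mul_eLpNorm_of_ae_le_mul
      (Eventually.of_forall fun x => hbound x x₃) p₁).trans ?_
    rw [ENNReal.coe_toNNReal (ENNReal.mul_lt_top ENNReal.ofReal_lt_top hk₁).ne,
      ENNReal.ofReal_mul hA0, Real.enorm_of_nonneg (by positivity)]
    exact le_of_eq (by ring)
  refine lt_of_le_of_lt (eLpNorm_le_nnreal_smul_eLpNorm_of_ae_le_mul'
    (g := fun x₃ : ℝ => (1 + ‖x₃‖) ^ (-k₃ : ℝ)) (Eventually.of_forall fun x₃ => hinner x₃) p₃) ?_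
  exact ENNReal.mul_lt_top ENNReal.coe_lt_top hk₃

/-- There is a Schwartz function whose Fourier transform is `1` on a ball. -/
lemma exists_schwartz_fourier_eq_one :
    ∃ f : 𝓢(EuclideanSpace ℝ (Fin 3), ℂ), ∀ ξ : EuclideanSpace ℝ (Fin 3), ‖ξ‖ ≤ 2 →
      𝓕 (f : EuclideanSpace ℝ (Fin 3) → ℂ) ξ = 1 := by
  -- The inner radius 2 exceeds √3, so the ball contains the cube [-1, 1]³, to which boxes will be
  -- rescaled.
  let χ : ContDiffBump (0 : EuclideanSpace ℝ (Fin 3)) := ⟨2, 3, by norm_num, by norm_num⟩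
  have hsupp : HasCompactSupport fun x => ((χ x : ℝ) : ℂ) :=
    χ.hasCompactSupport.comp_left (g := fun r : ℝ => (r : ℂ)) (by simp)
  have hsm : ContDiff ℝ ∞ fun x => ((χ x : ℝ) : ℂ) := Complex.ofRealCLM.contDiff.comp χ.contDiff
  refine ⟨𝓕⁻ (hsupp.toSchwartzMap hsm), fun ξ hξ => ?_⟩
  rw [← SchwartzMap.fourier_coe, FourierTransform.fourier_fourierInv_eq,
    HasCompactSupport.toSchwartzMap_toFun, χ.one_of_mem_closedBall (by simpa using hξ)]
  simp

/-! ### Knapp type examples -/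

lemma one_le_surfaceDensity (φ : ℝ × ℝ → ℝ) (x : ℝ × ℝ) : 1 ≤ surfaceDensity φ x := by
  rw [surfaceDensity, Real.one_le_sqrt]
  nlinarith [sq_nonneg (fderiv ℝ φ x (1, 0)), sq_nonneg (fderiv ℝ φ x (0, 1))]

/-- Testing the restriction estimate with dilates of a fixed Schwartz function. -/
lemma RestrictionEstimate.knapp {Ω : Set (ℝ × ℝ)} {φ ρ : ℝ × ℝ → ℝ} {p₁ p₃ : ℝ≥0∞}
    (hR : RestrictionEstimate Ω φ ρ p₁ p₃) :
    ∃ A : ℝ, 0 ≤ A ∧ ∀ l : Fin 3 → ℝ, (∀ i, 0 < l i) → ∀ E : Set (ℝ × ℝ), MeasurableSet E →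
      E ⊆ Ω → (∀ x ∈ E, |x.1| ≤ l 0 ∧ |x.2| ≤ l 1 ∧ |φ x| ≤ l 2) → ∀ c₀ : ℝ,
      (∀ x ∈ E, c₀ ≤ ρ x * surfaceDensity φ x) →
      (ENNReal.ofReal c₀ * volume E) ^ (1 / 2 : ℝ) ≤
        ENNReal.ofReal (A * ((l 0 * l 1) ^ (1 - (1 / p₁).toReal) *
          l 2 ^ (1 - (1 / p₃).toReal))) := by
  obtain ⟨C, hC⟩ := hR
  obtain ⟨f₀, hf₀⟩ := exists_schwartz_fourier_eq_one
  have hfin := mixedNorm_schwartz_lt_top p₁ p₃ f₀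
  refine ⟨C * (mixedNorm p₁ p₃ f₀).toReal, by positivity, ?_⟩
  intro l hpos E hE hEΩ hbox c₀ hc₀
  have hl : ∀ i, l i ≠ 0 := fun i => (hpos i).ne'
  have h01 : 0 < l 0 * l 1 := mul_pos (hpos 0) (hpos 1)
  have h2 : 0 < l 2 := hpos 2
  have hJ : 0 < l 0 * l 1 * l 2 := mul_pos h01 h2
  set f := SchwartzMap.compCLMOfContinuousLinearEquiv ℂ (dilation l hl) f₀ with hf
  have hcoe : (f : EuclideanSpace ℝ (Fin 3) → ℂ) = f₀ ∘ dilation l hl := rfl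
  have hest := hC f
  rw [hcoe] at hest
  have hF : ∀ x ∈ E, ‖𝓕 ((f₀ : EuclideanSpace ℝ (Fin 3) → ℂ) ∘ dilation l hl) (graphPoint φ x)‖ₑ =
      ENNReal.ofReal (l 0 * l 1 * l 2)⁻¹ := by
    intro x hx
    obtain ⟨b0, b1, b2⟩ := hbox x hx
    rw [fourier_comp_dilation hl hpos, hf₀]
    · rw [enorm_smul, enorm_one, mul_one, Real.enorm_of_nonneg (inv_nonneg.2 hJ.le)]
    · rw [EuclideanSpace.norm_eq, Real.sqrt_le_left (by norm_num)]
      rw [Fin.sum_univ_three]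
      have key : ∀ i, |graphPoint φ x i| ≤ l i →
          ‖(dilation l hl).symm (graphPoint φ x) i‖ ^ 2 ≤ 1 := by
        intro i hi
        rw [dilation_symm_apply, Real.norm_eq_abs, sq_le_one_iff_abs_le_one, abs_abs, abs_mul,
          abs_inv, abs_of_pos (hpos i), inv_mul_le_one₀ (hpos i)]
        exact hi
      have k0 := key 0 b0
      have k1 := key 1 b1
      have k2 := key 2 b2
      linarith
  have hlow : ENNReal.ofReal (l 0 * l 1 * l 2)⁻¹ * (ENNReal.ofReal c₀ * volume E) ^ (1 / 2 : ℝ) ≤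
      (∫⁻ x in Ω, ‖𝓕 ((f₀ : EuclideanSpace ℝ (Fin 3) → ℂ) ∘ dilation l hl) (graphPoint φ x)‖ₑ ^ 2 *
        ENNReal.ofReal (ρ x * surfaceDensity φ x)) ^ (1 / 2 : ℝ) := by
    calc _ = (ENNReal.ofReal (l 0 * l 1 * l 2)⁻¹ ^ 2 * (ENNReal.ofReal c₀ * volume E)) ^
          (1 / 2 : ℝ) := by
          rw [ENNReal.mul_rpow_of_nonneg (_ ^ 2) _ (by norm_num), ← ENNReal.rpow_natCast,
            ← ENNReal.rpow_mul]
          norm_num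
      _ = (∫⁻ _ in E, ENNReal.ofReal (l 0 * l 1 * l 2)⁻¹ ^ 2 * ENNReal.ofReal c₀) ^
          (1 / 2 : ℝ) := by
          rw [setLIntegral_const, mul_assoc (_ ^ 2)]
      _ ≤ (∫⁻ x in E, ‖𝓕 ((f₀ : EuclideanSpace ℝ (Fin 3) → ℂ) ∘ dilation l hl)
          (graphPoint φ x)‖ₑ ^ 2 * ENNReal.ofReal (ρ x * surfaceDensity φ x)) ^ (1 / 2 : ℝ) := by
          apply ENNReal.rpow_le_rpow _ (by norm_num)
          apply setLIntegral_mono' hE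
          intro x hx
          rw [hF x hx]
          gcongr
          exact hc₀ x hx
      _ ≤ _ := by
          apply ENNReal.rpow_le_rpow _ (by norm_num)
          exact lintegral_mono_set hEΩ
  have hall := (hlow.trans hest).trans (mul_le_mul_right
    (mixedNorm_comp_dilation_le p₁ p₃ hl hpos f₀) (C : ℝ≥0∞))
  -- Multiplying by the Jacobian cancels its inverse on the left and turns the powers -1/p on the
  -- right into 1 - 1/p.
  have hmul := mul_le_mul_right hall (ENNReal.ofReal (l 0 * l 1 * l 2))
  rw [← mul_assoc, ← ENNReal.ofReal_mul hJ.le, mul_inv_cancel₀ hJ.ne', ENNReal.ofReal_one,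
    one_mul] at hmul
  refine hmul.trans (le_of_eq ?_)
  rw [← ENNReal.ofReal_toReal hfin.ne, ← ENNReal.ofReal_coe_nnreal,
    ← ENNReal.ofReal_mul (by positivity), ← ENNReal.ofReal_mul (by positivity),
    ← ENNReal.ofReal_mul (by positivity), ENNReal.toReal_ofReal ENNReal.toReal_nonneg]
  congr 1
  rw [Real.rpow_sub h01, Real.rpow_sub h2, Real.rpow_one, Real.rpow_one, Real.inv_rpow h01.le,
    Real.inv_rpow h2.le]
  field_simp

lemma recip_eq_one_sub {p q : ℝ≥0∞} (h : p.HolderConjugate q) : recip q = 1 - (1 / p).toReal := by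
  have h1 : p⁻¹ + q⁻¹ = 1 := ENNReal.holderConjugate_iff.1 h
  have hp : p⁻¹ ≠ ⊤ := fun hc => by simp [hc] at h1
  have hq : q⁻¹ ≠ ⊤ := fun hc => by simp [hc] at h1
  have h2 := congrArg ENNReal.toReal h1
  rw [ENNReal.toReal_add hp hq, ENNReal.toReal_one] at h2
  rw [recip, one_div]
  linarith

lemma exponent_le_of_forall_small {a b c A ε₁ : ℝ} (hc : 0 < c) (hε₁ : 0 < ε₁)
    (h : ∀ ε, 0 < ε → ε < ε₁ → c * ε ^ a ≤ A * ε ^ b) : b ≤ a := by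
  by_contra hlt
  push Not at hlt
  have hlim : Tendsto (fun ε : ℝ => A * ε ^ (b - a)) (𝓝[>] 0) (𝓝 0) := by
    simpa using (tendsto_rpow_nhdsGT_zero (sub_pos.2 hlt)).const_mul A
  have hge : c ≤ 0 := by
    refine ge_of_tendsto hlim ?_
    filter_upwards [Ioo_mem_nhdsGT hε₁] with ε hε
    have h1 := h ε hε.1 hε.2
    have hpos := Real.rpow_pos_of_pos hε.1 a
    rw [Real.rpow_sub hε.1, mul_div_assoc', le_div_iff₀ hpos]
    exact h1
  linarith

/-- The inverse map on the image is K-Lipschitz, and Lebesgue measure on the plane with the sup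
metric is the two-dimensional Hausdorff measure. No Jacobian is needed. -/
lemma volume_le_mul_volume_image {e : ℝ × ℝ → ℝ × ℝ} {B : Set (ℝ × ℝ)} {K : ℝ≥0}
    (h : ∀ y ∈ B, ∀ y' ∈ B, dist y y' ≤ K * dist (e y) (e y')) :
    volume B ≤ (K : ℝ≥0∞) ^ (2 : ℝ) * volume (e '' B) := by
  have hinj : Set.InjOn e B := by
    intro y hy y' hy' heq
    have := h y hy y' hy'
    rw [heq, dist_self, mul_zero] at this
    exact dist_le_zero.1 this
  have hleft := hinj.leftInvOn_invFunOn
  have hlip : LipschitzOnWith K (Function.invFunOn e B) (e '' B) := by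
    apply LipschitzOnWith.of_dist_le_mul
    rintro _ ⟨y, hy, rfl⟩ _ ⟨y', hy', rfl⟩
    rw [hleft hy, hleft hy']
    exact h y hy y' hy'
  have := hlip.hausdorffMeasure_image_le (d := 2) (by norm_num)
  rwa [hausdorffMeasure_prod_real, hleft.image_image] at this

/-- A Knapp type argument: the restriction estimate bounds the exponents if the image under `e` of
the box with side lengths `ε ^ w₁` and `ε ^ w₂` is contained in a box with side lengths
`ε ^ v₁` and `ε ^ v₂` on which `φ` is of size `ε`. -/
theorem RestrictionEstimate.exponent_le {Ω : Set (ℝ × ℝ)} (hΩ : IsOpen Ω)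
    (h0Ω : (0 : ℝ × ℝ) ∈ Ω) {φ ρ : ℝ × ℝ → ℝ} (hρ : Continuous ρ) (hρ0 : 0 < ρ 0)
    {p₁ p₃ q₁ q₃ : ℝ≥0∞} (hp₁ : p₁.HolderConjugate q₁) (hp₃ : p₃.HolderConjugate q₃)
    (hR : RestrictionEstimate Ω φ ρ p₁ p₃) {e : ℝ × ℝ → ℝ × ℝ} (he0 : e 0 = 0) {δ : ℝ}
    (hδ : 0 < δ) (he : ContinuousOn e (Metric.ball 0 δ)) {K : ℝ≥0}
    (hK : ∀ y ∈ Metric.ball (0 : ℝ × ℝ) δ, ∀ y' ∈ Metric.ball (0 : ℝ × ℝ) δ,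
      dist y y' ≤ K * dist (e y) (e y'))
    {w : ℝ × ℝ} (hw1 : 0 < w.1) (hw2 : 0 < w.2) {v : ℝ × ℝ} {C ε₀ : ℝ} (hC : 0 < C) (hε₀ : 0 < ε₀)
    (hbox : ∀ ε, 0 < ε → ε < ε₀ → ∀ y : ℝ × ℝ, |y.1| ≤ ε ^ w.1 → |y.2| ≤ ε ^ w.2 →
      |(e y).1| ≤ C * ε ^ v.1 ∧ |(e y).2| ≤ C * ε ^ v.2 ∧ |φ (e y)| ≤ C * ε) :
    (v.1 + v.2) * recip q₁ + recip q₃ ≤ (w.1 + w.2) / 2 := by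
  obtain ⟨A, hA, hknapp⟩ := hR.knapp
  rw [← recip_eq_one_sub hp₁, ← recip_eq_one_sub hp₃] at hknapp
  set a := recip q₁
  set b := recip q₃
  set c₀ := ρ 0 / 2 with hc₀
  have hc₀pos : 0 < c₀ := by positivity
  have hev : ∀ᶠ y in 𝓝 (0 : ℝ × ℝ), e y ∈ Ω ∧ c₀ < ρ (e y) := by
    have hcont : Tendsto e (𝓝 0) (𝓝 0) := by
      have := (he.continuousAt (Metric.isOpen_ball.mem_nhds (Metric.mem_ball_self hδ))).tendsto
      rwa [he0] at this
    have h1 := hcont.eventually (hΩ.mem_nhds h0Ω)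
    have h2 : ∀ᶠ x in 𝓝 (0 : ℝ × ℝ), c₀ < ρ x :=
      hρ.continuousAt.eventually_const_lt (by rw [hc₀]; linarith)
    exact h1.and (hcont.eventually h2)
  obtain ⟨δ₁, hδ₁, hev⟩ := Metric.eventually_nhds_iff_ball.1 hev
  have hsmall : ∀ᶠ ε in 𝓝[>] (0 : ℝ), ε ^ w.1 < min δ δ₁ ∧ ε ^ w.2 < min δ δ₁ :=
    ((tendsto_rpow_nhdsGT_zero hw1).eventually_lt_const (lt_min hδ hδ₁)).and
      ((tendsto_rpow_nhdsGT_zero hw2).eventually_lt_const (lt_min hδ hδ₁))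
  obtain ⟨ε₁, hε₁, hsmall⟩ := mem_nhdsGT_iff_exists_Ioo_subset.1 hsmall
  -- The box has area 4 ε^{w₁+w₂}, and c₀ = ρ(0)/2 bounds the density below near the origin. The
  -- factor K is the square root of the area distortion K².
  refine exponent_le_of_forall_small (c := (c₀ * 4) ^ (1 / 2 : ℝ))
    (A := K * (A * ((C * C) ^ a * C ^ b))) (ε₁ := min ε₀ ε₁) (by positivity)
    (lt_min hε₀ hε₁) ?_
  intro ε hε hεlt
  rw [lt_min_iff] at hεlt
  obtain ⟨hs1, hs2⟩ := hsmall ⟨hε, hεlt.2⟩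
  set B : Set (ℝ × ℝ) := Set.Icc (-(ε ^ w.1)) (ε ^ w.1) ×ˢ Set.Icc (-(ε ^ w.2)) (ε ^ w.2) with hB
  have hBmem : ∀ y ∈ B, |y.1| ≤ ε ^ w.1 ∧ |y.2| ≤ ε ^ w.2 := by
    rintro y ⟨h1, h2⟩
    exact ⟨abs_le.2 h1, abs_le.2 h2⟩
  have hBball : ∀ y ∈ B, ‖y‖ < min δ δ₁ := by
    intro y hy
    obtain ⟨h1, h2⟩ := hBmem y hy
    rw [Prod.norm_def]
    exact max_lt (lt_of_le_of_lt h1 hs1) (lt_of_le_of_lt h2 hs2)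
  have hBδ : B ⊆ Metric.ball 0 δ := fun y hy => by
    simpa using (hBball y hy).trans_le (min_le_left _ _)
  have hBδ₁ : B ⊆ Metric.ball 0 δ₁ := fun y hy => by
    simpa using (hBball y hy).trans_le (min_le_right _ _)
  have hcomp : IsCompact (e '' B) := (isCompact_Icc.prod isCompact_Icc).image_of_continuousOn
    (he.mono hBδ)
  have hv1 := Real.rpow_pos_of_pos hε v.1
  have hv2 := Real.rpow_pos_of_pos hε v.2
  have hmain := hknapp ![C * ε ^ v.1, C * ε ^ v.2, C * ε]
    (by intro i; fin_cases i <;> simp <;> positivity) (e '' B) hcomp.measurableSet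
    (by
      rintro _ ⟨y, hy, rfl⟩
      exact (hev y (hBδ₁ hy)).1)
    (by
      rintro _ ⟨y, hy, rfl⟩
      obtain ⟨h1, h2⟩ := hBmem y hy
      exact hbox ε hε hεlt.1 y h1 h2) c₀
    (by
      rintro _ ⟨y, hy, rfl⟩
      have h1 := (hev y (hBδ₁ hy)).2
      have h2 := one_le_surfaceDensity φ (e y)
      nlinarith)
  have hvol : volume B = ENNReal.ofReal (4 * ε ^ (w.1 + w.2)) := by
    have p1 := Real.rpow_pos_of_pos hε w.1
    rw [hB, Measure.volume_eq_prod, Measure.prod_prod, Real.volume_Icc, Real.volume_Icc,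
      ← ENNReal.ofReal_mul (by linarith), Real.rpow_add hε]
    congr 1
    ring
  have hle := volume_le_mul_volume_image (B := B) fun y hy y' hy' => hK y (hBδ hy) y' (hBδ hy')
  rw [hvol] at hle
  have h3 : ENNReal.ofReal ((c₀ * 4) ^ (1 / 2 : ℝ) * ε ^ ((w.1 + w.2) / 2)) ≤
      ENNReal.ofReal (K * (A * ((C * ε ^ v.1 * (C * ε ^ v.2)) ^ a * (C * ε) ^ b))) := by
    calc _ = (ENNReal.ofReal c₀ * ENNReal.ofReal (4 * ε ^ (w.1 + w.2))) ^ (1 / 2 : ℝ) := by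
          rw [← ENNReal.ofReal_mul hc₀pos.le, ENNReal.ofReal_rpow_of_pos (by positivity),
            ← mul_assoc, Real.mul_rpow (x := c₀ * 4) (by positivity) (by positivity),
            ← Real.rpow_mul hε.le]
          congr 3
          ring
      _ ≤ (ENNReal.ofReal c₀ * ((K : ℝ≥0∞) ^ (2 : ℝ) * volume (e '' B))) ^ (1 / 2 : ℝ) := by
          gcongr
      _ = (K : ℝ≥0∞) * (ENNReal.ofReal c₀ * volume (e '' B)) ^ (1 / 2 : ℝ) := by
          rw [mul_left_comm, ENNReal.mul_rpow_of_nonneg _ _ (by norm_num), ← ENNReal.rpow_mul]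
          norm_num
      _ ≤ (K : ℝ≥0∞) * ENNReal.ofReal (A * ((C * ε ^ v.1 * (C * ε ^ v.2)) ^ a * (C * ε) ^ b)) := by
          gcongr
          exact hmain
      _ = _ := by
          rw [← ENNReal.ofReal_coe_nnreal, ← ENNReal.ofReal_mul (by positivity)]
  rw [ENNReal.ofReal_le_ofReal_iff (by positivity)] at h3
  refine h3.trans (le_of_eq ?_)
  have e1 : C * ε ^ v.1 * (C * ε ^ v.2) = (C * C) * ε ^ (v.1 + v.2) := by
    rw [Real.rpow_add hε]
    ring
  rw [e1, Real.mul_rpow (by positivity) (by positivity), Real.mul_rpow hC.le hε.le,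
    ← Real.rpow_mul hε.le, Real.rpow_add hε]
  ring

/-! ### Necessary conditions -/

/-- Boxes with sides ε^{w₁}, ε^{w₂} shrink only for positive weights. Weights with a zero entry are
perturbed by η, and η → 0 at the end. -/
lemma le_of_forall_add_mul {a b c d : ℝ} (h : ∀ η : ℝ, 0 < η → a + η * c ≤ b + η * d) : a ≤ b := by
  have h1 : Tendsto (fun η : ℝ => a + η * c) (𝓝[>] 0) (𝓝 (a + 0 * c)) :=
    (Continuous.tendsto (by fun_prop) 0).mono_left nhdsWithin_le_nhds
  have h2 : Tendsto (fun η : ℝ => b + η * d) (𝓝[>] 0) (𝓝 (b + 0 * d)) :=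
    (Continuous.tendsto (by fun_prop) 0).mono_left nhdsWithin_le_nhds
  have := le_of_tendsto_of_tendsto h1 h2 (by
    filter_upwards [self_mem_nhdsWithin] with η hη using h η hη)
  simpa using this

lemma one_le_of_taylorSupport {g : ℝ × ℝ → ℝ} {w u : ℝ × ℝ}
    (hN : ∀ t ∈ newtonPolyhedron g, 1 ≤ w.1 * t.1 + w.2 * t.2) (hu1 : w.1 ≤ u.1)
    (hu2 : w.2 ≤ u.2) : ∀ α ∈ taylorSupport g, 1 ≤ u.1 * (α.1 : ℝ) + u.2 * (α.2 : ℝ) := by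
  intro α hα
  refine (hN ((α.1 : ℝ), (α.2 : ℝ)) (mem_newtonPolyhedron_of_le hα le_rfl le_rfl)).trans ?_
  simp only
  gcongr

section Necessary

variable {Ω : Set (ℝ × ℝ)} {φ ρ : ℝ × ℝ → ℝ} {p₁ p₃ q₁ q₃ : ℝ≥0∞}

/-- The Knapp box in the original coordinates, where both boxes have the same exponents. -/
lemma RestrictionEstimate.weight_le (hΩ : IsOpen Ω)
    (h0Ω : (0 : ℝ × ℝ) ∈ Ω) (hφ : SmoothNearZero φ) (hρ : Continuous ρ) (hρ0 : 0 < ρ 0)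
    (hp₁ : p₁.HolderConjugate q₁) (hp₃ : p₃.HolderConjugate q₃)
    (hR : RestrictionEstimate Ω φ ρ p₁ p₃) {w : ℝ × ℝ} (hw1 : 0 ≤ w.1) (hw2 : 0 ≤ w.2)
    (hN : ∀ t ∈ newtonPolyhedron φ, 1 ≤ w.1 * t.1 + w.2 * t.2) :
    (w.1 + w.2) * recip q₁ + recip q₃ ≤ (w.1 + w.2) / 2 := by
  refine le_of_forall_add_mul (c := 2 * recip q₁) (d := 1) fun η hη => ?_
  set u : ℝ × ℝ := (w.1 + η, w.2 + η) with hu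
  have hu1 : 0 < u.1 := by simp only [hu]; linarith
  have hu2 : 0 < u.2 := by simp only [hu]; linarith
  obtain ⟨C, hC, ε₀, hε₀, hb⟩ := hφ.exists_bound_on_box hu1 hu2
    (one_le_of_taylorSupport hN (by simp only [hu]; linarith) (by simp only [hu]; linarith))
  have := hR.exponent_le hΩ h0Ω hρ hρ0 hp₁ hp₃ (e := id) rfl one_pos continuousOn_id (K := 1)
    (by simp) hu1 hu2 (v := u) (C := C + 1) (by linarith) hε₀ (by
      intro ε hε hεlt y hy1 hy2
      have p1 := Real.rpow_nonneg hε.le u.1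
      have p2 := Real.rpow_nonneg hε.le u.2
      refine ⟨?_, ?_, ?_⟩
      · simp only [id]
        nlinarith
      · simp only [id]
        nlinarith
      · have := hb ε hε hεlt y hy1 hy2
        simp only [id]
        nlinarith)
  simp only [hu] at this
  linarith

lemma RestrictionEstimate.distanceCond (hΩ : IsOpen Ω)
    (h0Ω : (0 : ℝ × ℝ) ∈ Ω) (hφ : SmoothNearZero φ) (hfin : FiniteType φ) (hφ0 : φ 0 = 0)
    (hρ : Continuous ρ) (hρ0 : 0 < ρ 0)
    (hp₁ : p₁.HolderConjugate q₁) (hp₃ : p₃.HolderConjugate q₃)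
    (hR : RestrictionEstimate Ω φ ρ p₁ p₃) {κ : ℝ × ℝ}
    (hκ : IsPrincipalWeight (newtonPolyhedron φ) κ) : DistanceCond φ q₁ q₃ := by
  obtain ⟨⟨h1, h2, hN, -⟩, hd, -⟩ := hκ
  change κ.1 * newtonDistance φ + κ.2 * newtonDistance φ = 1 at hd
  have hpos := newtonDistance_pos hfin hφ0
  have hsum : κ.1 + κ.2 = 1 / newtonDistance φ := by
    rw [eq_div_iff hpos.ne']
    linarith
  have := hR.weight_le hΩ h0Ω hφ hρ hρ0 hp₁ hp₃ h1 h2 hN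
  rw [hsum] at this
  rw [DistanceCond]
  have e : 1 / (2 * newtonDistance φ) = 1 / newtonDistance φ / 2 := by
    rw [div_div, mul_comm]
  rw [e]
  exact this

lemma recip_nonneg (q : ℝ≥0∞) : 0 ≤ recip q := ENNReal.toReal_nonneg

lemma IsCoordChange.exists_antilipschitz {e : OpenPartialHomeomorph (ℝ × ℝ) (ℝ × ℝ)}
    (he : IsCoordChange e) :
    ∃ δ > 0, Metric.ball 0 δ ⊆ e.source ∧ ∃ K : ℝ≥0, ∀ y ∈ Metric.ball (0 : ℝ × ℝ) δ,
      ∀ y' ∈ Metric.ball (0 : ℝ × ℝ) δ, dist y y' ≤ K * dist (e y) (e y') := by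
  obtain ⟨h0, he0, hsm, hsymm⟩ := he
  have h0t : (0 : ℝ × ℝ) ∈ e.target := by
    rw [← he0]
    exact e.map_source h0
  have hcd : ContDiffAt ℝ 1 e.symm 0 :=
    (hsymm.contDiffAt (e.open_target.mem_nhds h0t)).of_le (by exact_mod_cast le_top)
  obtain ⟨K, W, hW, hlip⟩ := hcd.exists_lipschitzOnWith
  have hcont : Tendsto e (𝓝 0) (𝓝 0) := by
    have := (hsm.continuousOn.continuousAt (e.open_source.mem_nhds h0)).tendsto
    rwa [he0] at this
  obtain ⟨δ, hδ, hb⟩ := Metric.eventually_nhds_iff_ball.1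
    ((hcont.eventually hW).and (e.open_source.mem_nhds h0))
  refine ⟨δ, hδ, fun y hy => (hb y hy).2, K, fun y hy y' hy' => ?_⟩
  have := hlip.dist_le_mul (e y) (hb y hy).1 (e y') (hb y' hy').1
  rwa [e.left_inv (hb y hy).2, e.left_inv (hb y' hy').2] at this

/-- For a general coordinate change the image of the box is only enclosed in a box of fixed size in
(x₁, x₂), that is v = 0, and p₁ drops out. -/
lemma RestrictionEstimate.weight_le_of_coordChange (hΩ : IsOpen Ω)
    (h0Ω : (0 : ℝ × ℝ) ∈ Ω) (hφ : SmoothNearZero φ) (hρ : Continuous ρ) (hρ0 : 0 < ρ 0)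
    (hp₁ : p₁.HolderConjugate q₁) (hp₃ : p₃.HolderConjugate q₃)
    (hR : RestrictionEstimate Ω φ ρ p₁ p₃) {e : OpenPartialHomeomorph (ℝ × ℝ) (ℝ × ℝ)}
    (he : IsCoordChange e) {w : ℝ × ℝ} (hw1 : 0 ≤ w.1) (hw2 : 0 ≤ w.2)
    (hN : ∀ t ∈ newtonPolyhedron (φ ∘ e), 1 ≤ w.1 * t.1 + w.2 * t.2) :
    recip q₃ ≤ (w.1 + w.2) / 2 := by
  refine le_of_forall_add_mul (c := 0) (d := 1) fun η hη => ?_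
  set u : ℝ × ℝ := (w.1 + η, w.2 + η) with hu
  have hu1 : 0 < u.1 := by simp only [hu]; linarith
  have hu2 : 0 < u.2 := by simp only [hu]; linarith
  obtain ⟨C, hC, ε₀, hε₀, hb⟩ := (he.smoothNearZero_comp hφ).exists_bound_on_box hu1 hu2
    (one_le_of_taylorSupport hN (by simp only [hu]; linarith) (by simp only [hu]; linarith))
  obtain ⟨δ, hδ, hsrc, K, hK⟩ := he.exists_antilipschitz
  have hcont : ContinuousOn e (Metric.ball 0 δ) := he.2.2.1.continuousOn.mono hsrc
  have hlim : Tendsto e (𝓝 0) (𝓝 0) := by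
    have := (hcont.continuousAt (Metric.isOpen_ball.mem_nhds (Metric.mem_ball_self hδ))).tendsto
    rwa [he.2.1] at this
  obtain ⟨δ₁, hδ₁, hb₁⟩ := Metric.eventually_nhds_iff_ball.1
    (hlim.eventually (Metric.ball_mem_nhds (0 : ℝ × ℝ) one_pos))
  have hsmall : ∀ᶠ ε in 𝓝[>] (0 : ℝ), ε ^ u.1 < δ₁ ∧ ε ^ u.2 < δ₁ :=
    ((tendsto_rpow_nhdsGT_zero hu1).eventually_lt_const hδ₁).and
      ((tendsto_rpow_nhdsGT_zero hu2).eventually_lt_const hδ₁)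
  obtain ⟨ε₁, hε₁, hsmall⟩ := mem_nhdsGT_iff_exists_Ioo_subset.1 hsmall
  have := hR.exponent_le hΩ h0Ω hρ hρ0 hp₁ hp₃ (e := e) he.2.1 hδ hcont hK hu1 hu2 (v := 0)
    (C := C + 1) (by linarith) (lt_min hε₀ hε₁) (by
      intro ε hε hεlt y hy1 hy2
      rw [lt_min_iff] at hεlt
      obtain ⟨s1, s2⟩ := hsmall ⟨hε, hεlt.2⟩
      have hy : ‖y‖ < δ₁ := by
        rw [Prod.norm_def]
        exact max_lt (lt_of_le_of_lt hy1 s1) (lt_of_le_of_lt hy2 s2)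
      have hey := hb₁ y (by simpa using hy)
      rw [dist_zero_right] at hey
      have f1 : |(e y).1| ≤ ‖e y‖ := norm_fst_le (e y)
      have f2 : |(e y).2| ≤ ‖e y‖ := norm_snd_le (e y)
      simp only [Prod.fst_zero, Prod.snd_zero, Real.rpow_zero, mul_one]
      refine ⟨by linarith, by linarith, ?_⟩
      have := hb ε hε hεlt.1 y hy1 hy2
      simp only [Function.comp_apply] at this
      nlinarith)
  simp only [hu, Prod.fst_zero, Prod.snd_zero, add_zero, zero_mul, zero_add] at this
  linarith

/-- Each d' below the height is below some d(φ∘e); a line separating (d', d') from that polyhedron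
gives 1/p₃' ≤ 1/(2d'). Then d' tends to the height. -/
lemma RestrictionEstimate.heightCond (hΩ : IsOpen Ω)
    (h0Ω : (0 : ℝ × ℝ) ∈ Ω) (hφ : SmoothNearZero φ) (hfin : FiniteType φ) (hφ0 : φ 0 = 0)
    (hρ : Continuous ρ) (hρ0 : 0 < ρ 0)
    (hp₁ : p₁.HolderConjugate q₁) (hp₃ : p₃.HolderConjugate q₃)
    (hR : RestrictionEstimate Ω φ ρ p₁ p₃) : HeightCond φ q₃ := by
  have hpos : 0 < newtonHeight φ :=
    (newtonDistance_pos hfin hφ0).trans_le (newtonDistance_le_newtonHeight hφ hfin)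
  rw [HeightCond]
  have key : ∀ d', 0 < d' → d' < newtonHeight φ → recip q₃ * (2 * d') ≤ 1 := by
    intro d' hd' hlt
    obtain ⟨e, he, hlt'⟩ := exists_coordChange_of_lt_newtonHeight hlt
    obtain ⟨α, hα⟩ := hfin
    obtain ⟨β, hβ, -⟩ := exists_taylorSupport_comp hφ he (he.smoothNearZero_comp hφ) hα
    obtain ⟨w, hw1, hw2, hsum, hN⟩ := exists_weight_of_lt_newtonDistance ⟨β, hβ⟩ hd' hlt'
    have h1 := hR.weight_le_of_coordChange hΩ h0Ω hφ hρ hρ0 hp₁ hp₃ he hw1 hw2 hN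
    rw [lt_div_iff₀ hd'] at hsum
    nlinarith
  rw [le_div_iff₀ (by positivity)]
  have hlim : Tendsto (fun d' : ℝ => recip q₃ * (2 * d')) (𝓝[<] (newtonHeight φ))
      (𝓝 (recip q₃ * (2 * newtonHeight φ))) :=
    (Continuous.tendsto (by fun_prop) _).mono_left nhdsWithin_le_nhds
  refine le_of_tendsto hlim ?_
  filter_upwards [Ioo_mem_nhdsLT hpos] with d' hd' using key d' hd'.1 hd'.2

/-- Supporting weights of the augmented polyhedron. -/
lemma isSupportingWeight_augmentedPolyhedron_iff {N : Set (ℝ × ℝ)} {κ w : ℝ × ℝ}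
    (hκ1 : 0 < κ.1) (hκ2 : 0 < κ.2) (hclosed : IsClosed N)
    (hpos : ∀ t ∈ N, 0 ≤ t.1 ∧ 0 ≤ t.2) (hne : (weightLine κ ∩ N).Nonempty) :
    IsSupportingWeight (augmentedPolyhedron κ N) w ↔
      IsSupportingWeight N w ∧ w.1 * κ.2 ≤ w.2 * κ.1 := by
  have hcl : IsClosed (weightLine κ ∩ N) :=
    (isClosed_eq (by fun_prop) continuous_const).inter hclosed
  have hcomp : IsCompact (weightLine κ ∩ N) := by
    refine (isCompact_Icc (a := ((0 : ℝ), (0 : ℝ)))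
      (b := (1 / κ.1, 1 / κ.2))).of_isClosed_subset hcl ?_
    rintro t ⟨ht, htN⟩
    have ht' : κ.1 * t.1 + κ.2 * t.2 = 1 := ht
    obtain ⟨h1, h2⟩ := hpos t htN
    have e1 := mul_nonneg hκ1.le h1
    have e2 := mul_nonneg hκ2.le h2
    rw [Set.mem_Icc, Prod.le_def, Prod.le_def]
    refine ⟨⟨h1, h2⟩, ?_, ?_⟩
    · simp only
      rw [le_div_iff₀ hκ1]
      linarith
    · simp only
      rw [le_div_iff₀ hκ2]
      linarith
  obtain ⟨P, hP, hPmin⟩ := hcomp.exists_isMinOn hne (f := fun t : ℝ × ℝ => t.2) (by fun_prop)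
  have hPline : κ.1 * P.1 + κ.2 * P.2 = 1 := hP.1
  have hsub : N ⊆ augmentedPolyhedron κ N :=
    Set.subset_union_left.trans (subset_convexHull ℝ _)
  -- on the ray, `w` does not decrease in the upward direction
  have hray : ∀ s ∈ weightLine κ, ∀ Q ∈ weightLine κ,
      κ.1 * ((w.1 * s.1 + w.2 * s.2) - (w.1 * Q.1 + w.2 * Q.2)) =
        (w.2 * κ.1 - w.1 * κ.2) * (s.2 - Q.2) := by
    intro s hs Q hQ
    have hs' : κ.1 * s.1 + κ.2 * s.2 = 1 := hs
    have hQ' : κ.1 * Q.1 + κ.2 * Q.2 = 1 := hQ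
    linear_combination w.1 * (hs' - hQ')
  constructor
  · rintro ⟨h1, h2, hN, s, hsline, hs⟩
    have hdir : w.1 * κ.2 ≤ w.2 * κ.1 := by
      by_contra hcon
      push Not at hcon
      -- a point far up on the ray violates the inequality
      set D := w.1 * κ.2 - w.2 * κ.1 with hD
      have hDpos : 0 < D := by simp only [hD]; linarith
      set x := w.1 * P.1 + w.2 * P.2 with hx
      -- At height τ above P the value of w has dropped by |x|, from x to x - |x| ≤ 0.
      set τ := κ.1 * |x| / D with hτ
      have hτ0 : 0 ≤ τ := by positivity
      set s' : ℝ × ℝ := (P.1 - κ.2 / κ.1 * τ, P.2 + τ) with hs'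
      have hs'line : s' ∈ weightLine κ := by
        change κ.1 * (P.1 - κ.2 / κ.1 * τ) + κ.2 * (P.2 + τ) = 1
        field_simp
        linarith
      have hmem : s' ∈ augmentedPolyhedron κ N := by
        refine subset_convexHull ℝ _ (Or.inr ⟨hs'line, P, hP, fun Q hQ => hPmin hQ, ?_⟩)
        simp only [hs']
        linarith
      have e1 := hN s' hmem
      have e2 := hray s' hs'line P hP.1
      have e3 : s'.2 - P.2 = τ := by simp [hs']
      have e4 : D * τ = κ.1 * |x| := by
        rw [hτ]
        field_simp
      rw [e3] at e2
      have e5 : κ.1 * ((w.1 * s'.1 + w.2 * s'.2) - x) = -(κ.1 * |x|) := by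
        rw [e2, ← e4, hD]
        ring
      have e6 : (w.1 * s'.1 + w.2 * s'.2) - x = -|x| := by
        apply mul_left_cancel₀ hκ1.ne'
        rw [e5]
        ring
      linarith [le_abs_self x]
    refine ⟨⟨h1, h2, fun t ht => hN t (hsub ht), ?_⟩, hdir⟩
    -- If L_w missed N, then N would lie strictly above it. So would the ray, which starts at a
    -- point of N and does not decrease w, and hence the convex hull.
    by_contra hempty
    rw [Set.not_nonempty_iff_eq_empty] at hempty
    have hstrict : ∀ t ∈ N, 1 < w.1 * t.1 + w.2 * t.2 := by
      intro t ht
      refine lt_of_le_of_ne (hN t (hsub ht)) fun heq => ?_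
      have : t ∈ weightLine w ∩ N := ⟨heq.symm, ht⟩
      rw [hempty] at this
      exact this
    have hhalf : augmentedPolyhedron κ N ⊆ {t | 1 < w.1 * t.1 + w.2 * t.2} := by
      refine convexHull_min ?_ ?_
      · rintro t (ht | ⟨ht, Q, hQ, -, hle⟩)
        · exact hstrict t ht
        · have e2 := hray t ht Q hQ.1
          have e3 : 0 ≤ (w.2 * κ.1 - w.1 * κ.2) * (t.2 - Q.2) :=
            mul_nonneg (by linarith) (by linarith)
          rw [← e2] at e3
          have e4 := nonneg_of_mul_nonneg_right e3 hκ1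
          have := hstrict Q hQ.2
          simp only [Set.mem_ofPred_eq]
          linarith
      · intro x hx y hy a b ha hb hab
        simp only [Set.mem_ofPred_eq, Prod.fst_add, Prod.smul_fst, smul_eq_mul, Prod.snd_add,
          Prod.smul_snd] at *
        rcases ha.eq_or_lt with rfl | ha'
        · have : b = 1 := by linarith
          subst this
          linarith
        · nlinarith [mul_lt_mul_of_pos_left hx ha', mul_le_mul_of_nonneg_left hy.le hb]
    have hlt : 1 < w.1 * s.1 + w.2 * s.2 := hhalf hs
    have heq : w.1 * s.1 + w.2 * s.2 = 1 := hsline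
    linarith
  · rintro ⟨⟨h1, h2, hN, s, hsline, hs⟩, hdir⟩
    refine ⟨h1, h2, ?_, s, hsline, hsub hs⟩
    have hhalf : augmentedPolyhedron κ N ⊆ {t | 1 ≤ w.1 * t.1 + w.2 * t.2} := by
      refine convexHull_min ?_ ?_
      · rintro t (ht | ⟨ht, Q, hQ, -, hle⟩)
        · exact hN t ht
        · have e2 := hray t ht Q hQ.1
          have e3 : 0 ≤ (w.2 * κ.1 - w.1 * κ.2) * (t.2 - Q.2) :=
            mul_nonneg (by linarith) (by linarith)
          rw [← e2] at e3
          have e4 := nonneg_of_mul_nonneg_right e3 hκ1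
          have := hN Q hQ.2
          simp only [Set.mem_ofPred_eq]
          linarith
      · intro x hx y hy a b ha hb hab
        simp only [Set.mem_ofPred_eq, Prod.fst_add, Prod.smul_fst, smul_eq_mul, Prod.snd_add,
          Prod.smul_snd] at *
        nlinarith [mul_le_mul_of_nonneg_left hx ha, mul_le_mul_of_nonneg_left hy hb]
    exact fun t ht => hhalf ht

lemma exists_antilipschitz_shear {ψ : ℝ → ℝ} (hψ : SmoothNearZero ψ) :
    ∃ δ > 0, ContinuousOn (fun y : ℝ × ℝ => (y.1, y.2 + ψ y.1)) (Metric.ball 0 δ) ∧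
      ∃ K : ℝ≥0, ∀ y ∈ Metric.ball (0 : ℝ × ℝ) δ, ∀ y' ∈ Metric.ball (0 : ℝ × ℝ) δ,
        dist y y' ≤ K * dist (y.1, y.2 + ψ y.1) (y'.1, y'.2 + ψ y'.1) := by
  obtain ⟨U, hU, h0, hψ⟩ := hψ
  have hcd : ContDiffAt ℝ 1 ψ 0 :=
    (hψ.contDiffAt (hU.mem_nhds h0)).of_le (by exact_mod_cast le_top)
  obtain ⟨L, W, hW, hlip⟩ := hcd.exists_lipschitzOnWith
  obtain ⟨δ, hδ, hb⟩ := Metric.mem_nhds_iff.1 hW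
  have hfst : ∀ y ∈ Metric.ball (0 : ℝ × ℝ) δ, y.1 ∈ W := by
    intro y hy
    apply hb
    rw [mem_ball_zero_iff] at hy ⊢
    exact (norm_fst_le y).trans_lt hy
  refine ⟨δ, hδ, ?_, 1 + L, fun y hy y' hy' => ?_⟩
  · exact continuousOn_fst.prodMk (continuousOn_snd.add
      (hlip.continuousOn.comp continuousOn_fst hfst))
  · have h1 := hlip.dist_le_mul y.1 (hfst y hy) y'.1 (hfst y' hy')
    rw [Prod.dist_eq, Prod.dist_eq]
    simp only [Real.dist_eq] at *
    set m := max |y.1 - y'.1| |y.2 + ψ y.1 - (y'.2 + ψ y'.1)| with hm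
    have m1 : |y.1 - y'.1| ≤ m := le_max_left _ _
    have m2 : |y.2 + ψ y.1 - (y'.2 + ψ y'.1)| ≤ m := le_max_right _ _
    have m0 : 0 ≤ m := (abs_nonneg _).trans m1
    have hL : (0 : ℝ) ≤ L := L.2
    have hLm : (L : ℝ) * |y.1 - y'.1| ≤ L * m := by gcongr
    have hLm0 : 0 ≤ (L : ℝ) * m := by positivity
    push_cast
    apply max_le
    · linarith
    · have h2 : y.2 - y'.2 = (y.2 + ψ y.1 - (y'.2 + ψ y'.1)) - (ψ y.1 - ψ y'.1) := by ring
      have h3 : |y.2 - y'.2| ≤ |y.2 + ψ y.1 - (y'.2 + ψ y'.1)| + |ψ y.1 - ψ y'.1| := by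
        rw [h2]
        exact abs_sub _ _
      linarith

/-- On the image of the box, x₂ = y₂ + ψ(y₁) = O(ε^{m w₁}): the first term because w₂ ≥ m w₁, the
second because k ≥ m. Thus v = (w₁, m w₁), which explains the factor (1 + m) w₁. -/
lemma RestrictionEstimate.weight_le_of_shear (hΩ : IsOpen Ω)
    (h0Ω : (0 : ℝ × ℝ) ∈ Ω) (hφ : SmoothNearZero φ) (hρ : Continuous ρ) (hρ0 : 0 < ρ 0)
    (hp₁ : p₁.HolderConjugate q₁) (hp₃ : p₃.HolderConjugate q₃)
    (hR : RestrictionEstimate Ω φ ρ p₁ p₃) {ψ : ℝ → ℝ} (hψ : SmoothNearZero ψ) (hψ0 : ψ 0 = 0)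
    {m : ℝ} (hm : 0 < m) {k : ℕ} (hk : m ≤ k) {A δ : ℝ} (hA : 0 ≤ A) (hδ : 0 < δ)
    (hbound : ∀ x : ℝ, |x| < δ → |ψ x| ≤ A * |x| ^ k)
    {w : ℝ × ℝ} (hw1 : 0 ≤ w.1) (hw2 : 0 ≤ w.2) (hwm : m * w.1 ≤ w.2)
    (hN : ∀ t ∈ newtonPolyhedron (sheared φ ψ), 1 ≤ w.1 * t.1 + w.2 * t.2) :
    WeightCond m w q₁ q₃ := by
  refine le_of_forall_add_mul (c := (1 + m) * recip q₁) (d := (1 + m) / 2) fun η hη => ?_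
  -- Perturbing in the direction (1, m) preserves m u₁ ≤ u₂.
  set u : ℝ × ℝ := (w.1 + η, w.2 + η * m) with hu
  have hηm : 0 < η * m := by positivity
  have hu1 : 0 < u.1 := by simp only [hu]; linarith
  have hu2 : 0 < u.2 := by simp only [hu]; linarith
  have hum : m * u.1 ≤ u.2 := by simp only [hu]; linarith
  obtain ⟨C, hC, ε₀, hε₀, hb⟩ := (hφ.sheared hψ hψ0).exists_bound_on_box hu1 hu2
    (one_le_of_taylorSupport hN (by simp only [hu]; linarith) (by simp only [hu]; linarith))
  obtain ⟨δ₁, hδ₁, hcont, K, hK⟩ := exists_antilipschitz_shear hψ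
  obtain ⟨ε₁, hε₁, hsmall⟩ := mem_nhdsGT_iff_exists_Ioo_subset.1
    ((tendsto_rpow_nhdsGT_zero hu1).eventually_lt_const hδ)
  have := hR.exponent_le hΩ h0Ω hρ hρ0 hp₁ hp₃
    (e := fun y : ℝ × ℝ => (y.1, y.2 + ψ y.1)) (by simp [hψ0]) hδ₁ hcont hK hu1 hu2
    (v := (u.1, m * u.1)) (C := C + 1 + A) (by linarith)
    (lt_min (lt_min hε₀ hε₁) one_pos) (by
      intro ε hε hεlt y hy1 hy2
      rw [lt_min_iff, lt_min_iff] at hεlt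
      obtain ⟨⟨l1, l2⟩, l3⟩ := hεlt
      have s1 : ε ^ u.1 < δ := hsmall ⟨hε, l2⟩
      have p1 := Real.rpow_pos_of_pos hε u.1
      have p2 := Real.rpow_pos_of_pos hε (m * u.1)
      refine ⟨?_, ?_, ?_⟩
      · simp only
        nlinarith
      · simp only
        have b1 : |ψ y.1| ≤ A * ε ^ (m * u.1) := by
          refine (hbound y.1 (lt_of_le_of_lt hy1 s1)).trans ?_
          gcongr
          calc |y.1| ^ k ≤ (ε ^ u.1) ^ k := by gcongr
            _ = ε ^ (u.1 * k) := by rw [Real.rpow_mul hε.le, Real.rpow_natCast]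
            _ ≤ ε ^ (m * u.1) := by
              apply Real.rpow_le_rpow_of_exponent_ge hε l3.le
              nlinarith
        have b2 : |y.2| ≤ ε ^ (m * u.1) :=
          hy2.trans (Real.rpow_le_rpow_of_exponent_ge hε l3.le hum)
        have b3 := abs_add_le y.2 (ψ y.1)
        nlinarith
      · have := hb ε hε l1 y hy1 hy2
        simp only [sheared] at this
        nlinarith)
  simp only [hu] at this
  linarith

end Necessary

/-! ### Vertices and edges of Newton polyhedra -/

section Edges

variable {g : ℝ × ℝ → ℝ} {n : ℕ} {V : ℕ → ℝ × ℝ}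

namespace IsVertexList

lemma mem_extremePoints (hV : IsVertexList (newtonPolyhedron g) n V) {i : ℕ} (hi : i ≤ n) :
    V i ∈ (newtonPolyhedron g).extremePoints ℝ := by
  rw [← hV.2]
  exact ⟨i, hi, rfl⟩

lemma mem (hV : IsVertexList (newtonPolyhedron g) n V) {i : ℕ} (hi : i ≤ n) :
    V i ∈ newtonPolyhedron g := extremePoints_subset (hV.mem_extremePoints hi)

lemma nonneg (hV : IsVertexList (newtonPolyhedron g) n V) {i : ℕ} (hi : i ≤ n) :
    0 ≤ (V i).1 ∧ 0 ≤ (V i).2 := nonneg_of_mem_newtonPolyhedron (hV.mem hi)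

lemma fst_lt (hV : IsVertexList (newtonPolyhedron g) n V) {i j : ℕ} (hij : i < j) (hj : j ≤ n) :
    (V i).1 < (V j).1 := hV.1 (show i ≤ n by omega) hj hij

lemma snd_lt (hV : IsVertexList (newtonPolyhedron g) n V) {i j : ℕ} (hij : i < j) (hj : j ≤ n) :
    (V j).2 < (V i).2 := by
  have h1 := hV.fst_lt hij hj
  by_contra hcon
  push Not at hcon
  have h0 := eq_zero_of_add_mem_extremePoints (hV.mem (show i ≤ n by omega)) (q := V j - V i)
    (by simpa using h1.le) (by simpa using hcon) (by simpa using hV.mem_extremePoints hj)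
  rw [sub_eq_zero] at h0
  rw [h0] at h1
  exact lt_irrefl _ h1

lemma fst_le (hV : IsVertexList (newtonPolyhedron g) n V) {i j : ℕ} (hij : i ≤ j) (hj : j ≤ n) :
    (V i).1 ≤ (V j).1 := by
  rcases hij.eq_or_lt with rfl | h
  · exact le_rfl
  · exact (hV.fst_lt h hj).le

lemma snd_le (hV : IsVertexList (newtonPolyhedron g) n V) {i j : ℕ} (hij : i ≤ j) (hj : j ≤ n) :
    (V j).2 ≤ (V i).2 := by
  rcases hij.eq_or_lt with rfl | h
  · exact le_rfl
  · exact (hV.snd_lt h hj).le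

/-- A vertex lies below the chord between two others. -/
lemma exists_chord (hV : IsVertexList (newtonPolyhedron g) n V) {i j k : ℕ} (hij : i < j)
    (hjk : j < k) (hk : k ≤ n) :
    ∃ θ : ℝ, 0 < θ ∧ θ < 1 ∧ ∀ w : ℝ × ℝ, 0 ≤ w.2 →
      w.1 * (V j).1 + w.2 * (V j).2 ≤
        θ * (w.1 * (V i).1 + w.2 * (V i).2) + (1 - θ) * (w.1 * (V k).1 + w.2 * (V k).2) := by
  have h1 := hV.fst_lt hij (by omega)
  have h2 := hV.fst_lt hjk hk
  have hD : 0 < (V k).1 - (V i).1 := by linarith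
  set θ := ((V k).1 - (V j).1) / ((V k).1 - (V i).1) with hθ
  have hθ0 : 0 < θ := div_pos (by linarith) hD
  have hθ1 : θ < 1 := by
    rw [hθ, div_lt_one hD]
    linarith
  have hθD : θ * ((V k).1 - (V i).1) = (V k).1 - (V j).1 := div_mul_cancel₀ _ hD.ne'
  have hz : θ • V i + (1 - θ) • V k ∈ newtonPolyhedron g :=
    convex_newtonPolyhedron (hV.mem (by omega)) (hV.mem hk) hθ0.le (by linarith) (by ring)
  have hz1 : (V j).1 = θ * (V i).1 + (1 - θ) * (V k).1 := by linarith
  have hz2 : (V j).2 ≤ θ * (V i).2 + (1 - θ) * (V k).2 := by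
    by_contra hcon
    push Not at hcon
    have h0 := eq_zero_of_add_mem_extremePoints hz (q := V j - (θ • V i + (1 - θ) • V k))
      (by simp [hz1]) (by simpa using hcon.le)
      (by simpa using hV.mem_extremePoints (show j ≤ n by omega))
    have := congrArg Prod.snd h0
    simp only [Prod.snd_sub, Prod.snd_add, Prod.smul_snd, smul_eq_mul, Prod.snd_zero] at this
    linarith
  refine ⟨θ, hθ0, hθ1, fun w hw => ?_⟩
  have := mul_le_mul_of_nonneg_left hz2 hw
  rw [hz1]
  nlinarith

lemma exists_touching (hV : IsVertexList (newtonPolyhedron g) n V) {w : ℝ × ℝ}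
    (hw : IsSupportingWeight (newtonPolyhedron g) w) :
    ∃ j ≤ n, w.1 * (V j).1 + w.2 * (V j).2 = 1 := by
  obtain ⟨-, -, hN, t, ht, htN⟩ := hw
  have ht' : w.1 * t.1 + w.2 * t.2 = 1 := ht
  obtain ⟨v, hv, hv1, -⟩ := exists_extremePoint_of_min (w := w) (u := (1, 1)) one_pos one_pos htN
    (by rwa [ht'])
  rw [← hV.2] at hv
  obtain ⟨j, hj, rfl⟩ := hv
  exact ⟨j, hj, by rw [hv1, ht']⟩

/-- A nonnegative linear function attains its minimum over the polyhedron at a vertex. -/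
lemma isSupportingWeight (hV : IsVertexList (newtonPolyhedron g) n V) (hfin : FiniteType g)
    {w : ℝ × ℝ} (hw1 : 0 ≤ w.1) (hw2 : 0 ≤ w.2)
    (h : ∀ i ≤ n, 1 ≤ w.1 * (V i).1 + w.2 * (V i).2) {j : ℕ} (hj : j ≤ n)
    (hj1 : w.1 * (V j).1 + w.2 * (V j).2 = 1) : IsSupportingWeight (newtonPolyhedron g) w := by
  refine ⟨hw1, hw2, ?_, V j, hj1, hV.mem hj⟩
  obtain ⟨α, hα, hmin⟩ := exists_min_taylorSupport hfin hw1 hw2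
  have hmin' := le_of_mem_newtonPolyhedron hw1 hw2 hmin
  obtain ⟨v, hv, hv1, -⟩ := exists_extremePoint_of_min (w := w) (u := (1, 1))
    (t₀ := ((α.1 : ℝ), (α.2 : ℝ))) one_pos one_pos (mem_newtonPolyhedron_of_le hα le_rfl le_rfl)
    hmin'
  rw [← hV.2] at hv
  obtain ⟨i, hi, rfl⟩ := hv
  intro t ht
  have e1 := h i hi
  have e2 := hmin' t ht
  simp only at hv1
  linarith

/-- For any other vertex V i, the nearer endpoint of the edge lies on or below the chord from V i to
the farther one; hence V i cannot lie below the line of the edge. -/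
lemma weight_of_edge (hV : IsVertexList (newtonPolyhedron g) n V) (hfin : FiniteType g) {l : ℕ}
    (hl1 : 1 ≤ l) (hln : l ≤ n) {w : ℝ × ℝ} (hw : polyEdge n V l ⊆ weightLine w) :
    0 < w.1 ∧ 0 < w.2 ∧ w.1 * (V (l - 1)).1 + w.2 * (V (l - 1)).2 = 1 ∧
      w.1 * (V l).1 + w.2 * (V l).2 = 1 ∧ IsSupportingWeight (newtonPolyhedron g) w := by
  have hedge : polyEdge n V l = segment ℝ (V (l - 1)) (V l) := by
    rw [polyEdge, if_neg (by omega), if_pos hln]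
  rw [hedge] at hw
  have e1 : w.1 * (V (l - 1)).1 + w.2 * (V (l - 1)).2 = 1 := hw (left_mem_segment ℝ _ _)
  have e2 : w.1 * (V l).1 + w.2 * (V l).2 = 1 := hw (right_mem_segment ℝ _ _)
  have hx := hV.fst_lt (show l - 1 < l by omega) hln
  have hy := hV.snd_lt (show l - 1 < l by omega) hln
  obtain ⟨n1, n2⟩ := hV.nonneg hln
  obtain ⟨n3, n4⟩ := hV.nonneg (show l - 1 ≤ n by omega)
  have hw1 : 0 < w.1 := by
    by_contra hcon
    push Not at hcon
    rcases le_or_gt w.2 0 with h | h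
    · nlinarith
    · nlinarith
  have hw2 : 0 < w.2 := by
    by_contra hcon
    push Not at hcon
    nlinarith
  refine ⟨hw1, hw2, e1, e2, hV.isSupportingWeight hfin hw1.le hw2.le ?_ hln e2⟩
  intro i hi
  rcases lt_trichotomy i l with h | h | h
  · rcases eq_or_lt_of_le (show i ≤ l - 1 by omega) with rfl | h'
    · exact e1.ge
    · obtain ⟨θ, h0, h1, hc⟩ := hV.exists_chord h' (show l - 1 < l by omega) hln
      have := hc w hw2.le
      rw [e1, e2] at this
      have h3 : θ * 1 ≤ θ * (w.1 * (V i).1 + w.2 * (V i).2) := by linarith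
      exact le_of_mul_le_mul_left h3 h0
  · rw [h]
    exact e2.ge
  · obtain ⟨θ, h0, h1, hc⟩ := hV.exists_chord (show l - 1 < l by omega) h hi
    have := hc w hw2.le
    rw [e1, e2] at this
    have h3 : (1 - θ) * 1 ≤ (1 - θ) * (w.1 * (V i).1 + w.2 * (V i).2) := by linarith
    exact le_of_mul_le_mul_left h3 (by linarith)

lemma weight_of_last_edge (hV : IsVertexList (newtonPolyhedron g) n V) (hfin : FiniteType g)
    {w : ℝ × ℝ} (hw : polyEdge n V (n + 1) ⊆ weightLine w) :
    w.1 = 0 ∧ 0 < w.2 ∧ w.2 * (V n).2 = 1 ∧ IsSupportingWeight (newtonPolyhedron g) w := by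
  have hedge : polyEdge n V (n + 1) = {t | (V n).1 ≤ t.1 ∧ t.2 = (V n).2} := by
    rw [polyEdge, if_neg (by omega), if_neg (by omega)]
  rw [hedge] at hw
  have e1 : w.1 * (V n).1 + w.2 * (V n).2 = 1 := hw ⟨le_rfl, rfl⟩
  have e2 : w.1 * ((V n).1 + 1) + w.2 * (V n).2 = 1 :=
    hw (show ((V n).1 + 1, (V n).2) ∈ {t : ℝ × ℝ | (V n).1 ≤ t.1 ∧ t.2 = (V n).2} from
      ⟨by simp, rfl⟩)
  have hw1 : w.1 = 0 := by linarith
  have e3 : w.2 * (V n).2 = 1 := by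
    rw [hw1] at e1
    linarith
  obtain ⟨-, n2⟩ := hV.nonneg (le_refl n)
  have hw2 : 0 < w.2 := by
    by_contra hcon
    nlinarith
  refine ⟨hw1, hw2, e3, hV.isSupportingWeight hfin hw1.ge hw2.le ?_ le_rfl e1⟩
  intro i hi
  have := mul_le_mul_of_nonneg_left (hV.snd_le hi le_rfl) hw2.le
  rw [hw1]
  linarith

lemma exists_weight_of_edge (hV : IsVertexList (newtonPolyhedron g) n V) {l : ℕ}
    (hl1 : 1 ≤ l) (hln : l ≤ n) : ∃ w : ℝ × ℝ, polyEdge n V l ⊆ weightLine w := by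
  have hedge : polyEdge n V l = segment ℝ (V (l - 1)) (V l) := by
    rw [polyEdge, if_neg (by omega), if_pos hln]
  have hx := hV.fst_lt (show l - 1 < l by omega) hln
  have hy := hV.snd_lt (show l - 1 < l by omega) hln
  obtain ⟨n1, n2⟩ := hV.nonneg hln
  obtain ⟨n3, n4⟩ := hV.nonneg (show l - 1 ≤ n by omega)
  set a := (V (l - 1)).2 - (V l).2 with ha
  set b := (V l).1 - (V (l - 1)).1 with hb
  have ha0 : 0 < a := by linarith
  have hb0 : 0 < b := by linarith
  have hD : 0 < a * (V l).1 + b * (V l).2 := by nlinarith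
  set D := a * (V l).1 + b * (V l).2 with hDdef
  refine ⟨(a / D, b / D), ?_⟩
  rw [hedge]
  rintro t ⟨r, s, hr, hs, hrs, rfl⟩
  change a / D * (r • V (l - 1) + s • V l).1 + b / D * (r • V (l - 1) + s • V l).2 = 1
  simp only [Prod.fst_add, Prod.smul_fst, smul_eq_mul, Prod.snd_add, Prod.smul_snd]
  have e : a * (V (l - 1)).1 + b * (V (l - 1)).2 = D := by
    simp only [hDdef, ha, hb]
    ring
  rw [div_mul_eq_mul_div, div_mul_eq_mul_div, ← add_div, div_eq_one_iff_eq hD.ne']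
  have : a * (r * (V (l - 1)).1 + s * (V l).1) + b * (r * (V (l - 1)).2 + s * (V l).2) =
      r * (a * (V (l - 1)).1 + b * (V (l - 1)).2) + s * D := by
    rw [hDdef]
    ring
  rw [this, e, ← add_mul, hrs, one_mul]

end IsVertexList

/-! ### Comparison of weights -/

/-- If w₁ > u₁, the ratio condition forces w₂ > u₂ as well, and then w exceeds u at x. Thus turning
a line through x to be flatter cannot increase the first weight. -/
lemma fst_le_of_ratio_le {u w x : ℝ × ℝ} (hu1 : 0 < u.1) (hu2 : 0 < u.2) (hx1 : 0 ≤ x.1)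
    (hx2 : 0 ≤ x.2) (hux : 0 < u.1 * x.1 + u.2 * x.2)
    (hle : w.1 * x.1 + w.2 * x.2 ≤ u.1 * x.1 + u.2 * x.2) (hr : w.1 * u.2 ≤ w.2 * u.1) :
    w.1 ≤ u.1 := by
  by_contra hcon
  push Not at hcon
  have h2 : u.2 < w.2 := by
    have : u.2 * u.1 < w.2 * u.1 := by nlinarith
    exact lt_of_mul_lt_mul_right this hu1.le
  have e1 : 0 ≤ (w.1 - u.1) * x.1 := mul_nonneg (by linarith) hx1
  have e2 : 0 ≤ (w.2 - u.2) * x.2 := mul_nonneg (by linarith) hx2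
  have f1 : (w.1 - u.1) * x.1 = 0 := by linarith
  have f2 : (w.2 - u.2) * x.2 = 0 := by linarith
  have g1 : x.1 = 0 := (mul_eq_zero.1 f1).resolve_left (by linarith)
  have g2 : x.2 = 0 := (mul_eq_zero.1 f2).resolve_left (by linarith)
  rw [g1, g2] at hux
  simp at hux

lemma snd_le_of_ratio_le {u w x : ℝ × ℝ} (hu1 : 0 < u.1) (hu2 : 0 < u.2) (hx1 : 0 ≤ x.1)
    (hx2 : 0 ≤ x.2) (hux : 0 < u.1 * x.1 + u.2 * x.2)
    (hle : u.1 * x.1 + u.2 * x.2 ≤ w.1 * x.1 + w.2 * x.2) (hr : w.1 * u.2 ≤ w.2 * u.1) :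
    u.2 ≤ w.2 := by
  by_contra hcon
  push Not at hcon
  have h2 : w.1 < u.1 := by
    have : w.1 * u.2 < u.1 * u.2 := by nlinarith
    exact lt_of_mul_lt_mul_right this hu2.le
  have e1 : 0 ≤ (u.1 - w.1) * x.1 := mul_nonneg (by linarith) hx1
  have e2 : 0 ≤ (u.2 - w.2) * x.2 := mul_nonneg (by linarith) hx2
  have f1 : (u.1 - w.1) * x.1 = 0 := by linarith
  have f2 : (u.2 - w.2) * x.2 = 0 := by linarith
  have g1 : x.1 = 0 := (mul_eq_zero.1 f1).resolve_left (by linarith)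
  have g2 : x.2 = 0 := (mul_eq_zero.1 f2).resolve_left (by linarith)
  rw [g1, g2] at hux
  simp at hux

/-- Two points `x`, `y` with `y` to the lower right of `x` compare the slopes of the lines of two
weights. -/
lemma ratio_le_of_points {u w x y : ℝ × ℝ} (hu : 0 ≤ u.1) (hw : 0 ≤ w.1) (hy : y.2 < x.2)
    (hwxy : w.1 * y.1 + w.2 * y.2 ≤ w.1 * x.1 + w.2 * x.2)
    (huxy : u.1 * x.1 + u.2 * x.2 ≤ u.1 * y.1 + u.2 * y.2) : w.1 * u.2 ≤ w.2 * u.1 := by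
  have h1 : w.1 * (u.2 * (x.2 - y.2)) ≤ w.1 * (u.1 * (y.1 - x.1)) := by
    apply mul_le_mul_of_nonneg_left _ hw
    linarith
  have h2 : u.1 * (w.1 * (y.1 - x.1)) ≤ u.1 * (w.2 * (x.2 - y.2)) := by
    apply mul_le_mul_of_nonneg_left _ hu
    linarith
  have h3 : (w.1 * u.2) * (x.2 - y.2) ≤ (w.2 * u.1) * (x.2 - y.2) := by linarith
  exact le_of_mul_le_mul_right h3 (by linarith)

/-- The weights whose lines pass through x form a line, parametrized by the first entry as x₂ > 0,
and the condition is affine in the weight. -/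
lemma WeightCond.interpolate {m : ℝ} {u v w x : ℝ × ℝ} {q₁ q₃ : ℝ≥0∞} (hx : 0 < x.2)
    (hu : u.1 * x.1 + u.2 * x.2 = 1) (hv : v.1 * x.1 + v.2 * x.2 = 1)
    (hw : w.1 * x.1 + w.2 * x.2 = 1) (hvw : v.1 ≤ w.1) (hwu : w.1 ≤ u.1)
    (hcu : WeightCond m u q₁ q₃) (hcv : WeightCond m v q₁ q₃) : WeightCond m w q₁ q₃ := by
  rw [WeightCond] at *
  rcases eq_or_lt_of_le (hvw.trans hwu) with h | h
  · have e1 : w.1 = u.1 := by linarith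
    have e2 : w.2 = u.2 := by
      apply mul_right_cancel₀ hx.ne'
      rw [e1] at hw
      linarith
    rw [e1, e2]
    exact hcu
  · have key : (u.1 - v.1) * w.2 = (w.1 - v.1) * u.2 + (u.1 - w.1) * v.2 := by
      apply mul_right_cancel₀ hx.ne'
      linear_combination (u.1 - v.1) * hw - (w.1 - v.1) * hu - (u.1 - w.1) * hv
    have h1 := mul_le_mul_of_nonneg_left hcu (sub_nonneg.2 hvw)
    have h2 := mul_le_mul_of_nonneg_left hcv (sub_nonneg.2 hwu)
    have h3 : (u.1 - v.1) * ((1 + m) * w.1 * recip q₁ + recip q₃) ≤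
        (u.1 - v.1) * ((w.1 + w.2) / 2) := by
      have e3 : (u.1 - v.1) * ((w.1 + w.2) / 2) =
          (w.1 - v.1) * ((u.1 + u.2) / 2) + (u.1 - w.1) * ((v.1 + v.2) / 2) := by
        linear_combination key / 2
      rw [e3]
      linarith
    exact le_of_mul_le_mul_left h3 (sub_pos.2 h)

/-! ### The finite system of edge conditions -/

section System

variable {κ : ℝ × ℝ} {m : ℝ} {l₀ : ℕ} {q₁ q₃ : ℝ≥0∞}

/-- The line `L_κ` passes through the vertex `V (l₀ - 1)`. -/
lemma IsFirstIndex.weight_vertex (hV : IsVertexList (newtonPolyhedron g) n V) (hκ1 : 0 < κ.1)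
    (hκ2 : 0 < κ.2) (hκ : IsSupportingWeight (newtonPolyhedron g) κ) (hm : m = κ.2 / κ.1)
    (hl₀ : IsFirstIndex n V m l₀) :
    κ.1 * (V (l₀ - 1)).1 + κ.2 * (V (l₀ - 1)).2 = 1 := by
  obtain ⟨h1, hn, hleft, hright⟩ := hl₀
  have hmκ : m * κ.1 = κ.2 := by
    rw [hm]
    field_simp
  have hge : ∀ i ≤ n, 1 ≤ κ.1 * (V i).1 + κ.2 * (V i).2 := fun i hi => hκ.2.2.1 _ (hV.mem hi)
  have hge0 := hge (l₀ - 1) (by omega)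
  obtain ⟨j, hj, hj1⟩ := hV.exists_touching hκ
  -- Along the edge ending at V (l₀ - 1), a_{l₀-1} ≤ m says that κ does not increase; along the one
  -- starting there, a_{l₀} > m says that it strictly increases. Chords carry both statements over
  -- to a touching vertex j.
  rcases lt_trichotomy j (l₀ - 1) with h | h | h
  · have hx := hV.fst_lt (show l₀ - 1 - 1 < l₀ - 1 by omega) (show l₀ - 1 ≤ n by omega)
    have hy := hV.snd_lt (show l₀ - 1 - 1 < l₀ - 1 by omega) (show l₀ - 1 ≤ n by omega)
    rw [edgeRatio, if_neg (by omega), if_pos (by omega), EReal.coe_le_coe_iff,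
      div_le_iff₀ (by linarith)] at hleft
    have hle : κ.1 * (V (l₀ - 1)).1 + κ.2 * (V (l₀ - 1)).2 ≤
        κ.1 * (V (l₀ - 1 - 1)).1 + κ.2 * (V (l₀ - 1 - 1)).2 := by
      have := mul_le_mul_of_nonneg_left hleft hκ1.le
      rw [← mul_assoc, mul_comm κ.1 m, hmκ] at this
      linarith
    rcases eq_or_lt_of_le (show j ≤ l₀ - 1 - 1 by omega) with rfl | h'
    · linarith
    · obtain ⟨θ, t0, t1, hc⟩ := hV.exists_chord h' (show l₀ - 1 - 1 < l₀ - 1 by omega)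
        (show l₀ - 1 ≤ n by omega)
      have := hc κ hκ2.le
      rw [hj1] at this
      nlinarith
  · rw [← h]
    exact hj1
  · exfalso
    have hx := hV.fst_lt (show l₀ - 1 < l₀ by omega) (show l₀ ≤ n by omega)
    have hy := hV.snd_lt (show l₀ - 1 < l₀ by omega) (show l₀ ≤ n by omega)
    rw [edgeRatio, if_neg (by omega), if_pos (by omega), EReal.coe_lt_coe_iff,
      lt_div_iff₀ (by linarith)] at hright
    have hlt : κ.1 * (V (l₀ - 1)).1 + κ.2 * (V (l₀ - 1)).2 <
        κ.1 * (V l₀).1 + κ.2 * (V l₀).2 := by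
      have := mul_lt_mul_of_pos_left hright hκ1
      rw [← mul_assoc, mul_comm κ.1 m, hmκ] at this
      linarith
    rcases eq_or_lt_of_le (show l₀ ≤ j by omega) with rfl | h'
    · linarith
    · obtain ⟨θ, t0, t1, hc⟩ := hV.exists_chord (show l₀ - 1 < l₀ by omega) h' hj
      have := hc κ hκ2.le
      rw [hj1] at this
      nlinarith

/-- The weights of the edges `γ_l`, `l ≥ l₀`, are supporting weights whose lines are less steep
than `L_κ`. -/
lemma weight_of_edge_of_firstIndex_le (hV : IsVertexList (newtonPolyhedron g) n V)
    (hfin : FiniteType g) (hκ1 : 0 < κ.1)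
    (hκ : IsSupportingWeight (newtonPolyhedron g) κ) (hl₀1 : 1 ≤ l₀)
    (hvert : κ.1 * (V (l₀ - 1)).1 + κ.2 * (V (l₀ - 1)).2 = 1)
    {l : ℕ} (hl : l₀ ≤ l) (hln : l ≤ n + 1) {w : ℝ × ℝ} (hw : polyEdge n V l ⊆ weightLine w) :
    IsSupportingWeight (newtonPolyhedron g) w ∧ w.1 * κ.2 ≤ w.2 * κ.1 := by
  rcases eq_or_lt_of_le hln with rfl | h
  · obtain ⟨h1, h2, -, h3⟩ := hV.weight_of_last_edge hfin hw
    refine ⟨h3, ?_⟩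
    rw [h1, zero_mul]
    positivity
  · obtain ⟨h1, h2, -, e2, h3⟩ := hV.weight_of_edge hfin (by omega) (by omega) hw
    refine ⟨h3, ratio_le_of_points (x := V (l₀ - 1)) (y := V l) hκ1.le h1.le
      (hV.snd_lt (by omega) (by omega)) ?_ ?_⟩
    · rw [e2]
      exact h3.2.2.1 _ (hV.mem (by omega))
    · rw [hvert]
      exact hκ.2.2.1 _ (hV.mem (by omega))

/-- The edge conditions imply the condition for all intermediate weights. -/
lemma EdgeConds.weightCond (hV : IsVertexList (newtonPolyhedron g) n V)
    (hfin : FiniteType g) (hκ1 : 0 < κ.1) (hκ2 : 0 < κ.2)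
    (hκ : IsSupportingWeight (newtonPolyhedron g) κ) (hl₀1 : 1 ≤ l₀) (hl₀n : l₀ ≤ n + 1)
    (hvert : κ.1 * (V (l₀ - 1)).1 + κ.2 * (V (l₀ - 1)).2 = 1)
    (h : EdgeConds n V l₀ κ m q₁ q₃) {w : ℝ × ℝ}
    (hw : IsSupportingWeight (newtonPolyhedron g) w) (hwκ : w.1 * κ.2 ≤ w.2 * κ.1) :
    WeightCond m w q₁ q₃ := by
  have hw1 := hw.1
  have hw2 := hw.2.1
  have hge : ∀ i ≤ n, 1 ≤ w.1 * (V i).1 + w.2 * (V i).2 := fun i hi => hw.2.2.1 _ (hV.mem hi)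
  -- a touching vertex with index at least `l₀ - 1`
  obtain ⟨j, hjn, hjl, hj1⟩ : ∃ j ≤ n, l₀ - 1 ≤ j ∧ w.1 * (V j).1 + w.2 * (V j).2 = 1 := by
    obtain ⟨j, hj, hj1⟩ := hV.exists_touching hw
    rcases le_or_gt (l₀ - 1) j with hle | hlt
    · exact ⟨j, hj, hle, hj1⟩
    -- From V j to V (l₀ - 1) the weight κ does not increase. Neither does w, whose line is no
    -- steeper, so V (l₀ - 1) is touched too.
    · refine ⟨l₀ - 1, by omega, le_rfl, le_antisymm ?_ (hge _ (by omega))⟩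
      have hκj := hκ.2.2.1 _ (hV.mem hj)
      have hx := hV.fst_lt hlt (by omega)
      have hy := hV.snd_lt hlt (by omega)
      have e1 : κ.1 * ((V (l₀ - 1)).1 - (V j).1) ≤ κ.2 * ((V j).2 - (V (l₀ - 1)).2) := by linarith
      have e2 := mul_le_mul_of_nonneg_left e1 hw1
      have e3 := mul_le_mul_of_nonneg_right hwκ (show 0 ≤ (V j).2 - (V (l₀ - 1)).2 by linarith)
      have e4 : κ.1 * (w.1 * ((V (l₀ - 1)).1 - (V j).1)) ≤
          κ.1 * (w.2 * ((V j).2 - (V (l₀ - 1)).2)) := by linarith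
      have e5 := le_of_mul_le_mul_left e4 hκ1
      linarith
  obtain ⟨x1, x2⟩ := hV.nonneg hjn
  -- the weight of the steeper neighbour
  obtain ⟨u, hu1, hu2, hux, huw, hcu⟩ : ∃ u : ℝ × ℝ, 0 < u.1 ∧ 0 < u.2 ∧
      u.1 * (V j).1 + u.2 * (V j).2 = 1 ∧ w.1 * u.2 ≤ w.2 * u.1 ∧ WeightCond m u q₁ q₃ := by
    rcases eq_or_lt_of_le hjl with rfl | hlt
    · exact ⟨κ, hκ1, hκ2, hvert, hwκ, h.2⟩
    · obtain ⟨u, hu⟩ := hV.exists_weight_of_edge (show 1 ≤ j by omega) hjn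
      obtain ⟨h1, h2, h3, h4, h5⟩ := hV.weight_of_edge hfin (show 1 ≤ j by omega) hjn hu
      refine ⟨u, h1, h2, h4, ?_, h.1 j (by omega) (by omega) u hu⟩
      refine ratio_le_of_points (x := V (j - 1)) (y := V j) h1.le hw1
        (hV.snd_lt (by omega) hjn) ?_ (by rw [h3, h4])
      rw [hj1]
      exact hge _ (by omega)
  have hux' : 0 < u.1 * (V j).1 + u.2 * (V j).2 := by rw [hux]; exact one_pos
  have hwu1 : w.1 ≤ u.1 := fst_le_of_ratio_le hu1 hu2 x1 x2 hux' (by rw [hj1, hux]) huw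
  have hwu2 : u.2 ≤ w.2 := snd_le_of_ratio_le hu1 hu2 x1 x2 hux' (by rw [hj1, hux]) huw
  rcases x2.eq_or_lt with hx0 | hxpos
  · -- the vertex lies on the horizontal axis
    rw [← hx0, mul_zero, add_zero] at hj1 hux
    have e1 : w.1 = u.1 := by
      apply mul_right_cancel₀ (b := (V j).1)
      · intro h0
        rw [h0, mul_zero] at hux
        exact zero_ne_one hux
      · rw [hj1, hux]
    -- Compared with u only the right-hand side changes, and w₂ ≥ u₂. Hence no condition for the
    -- edge on the axis is needed.
    rw [WeightCond] at hcu ⊢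
    rw [e1]
    linarith
  · -- the weight of the flatter neighbour
    obtain ⟨v, hvx, hvw, hcv⟩ : ∃ v : ℝ × ℝ, v.1 * (V j).1 + v.2 * (V j).2 = 1 ∧ v.1 ≤ w.1 ∧
        WeightCond m v q₁ q₃ := by
      rcases eq_or_lt_of_le hjn with rfl | hlt
      · have hsub : polyEdge j V (j + 1) ⊆ weightLine (0, 1 / (V j).2) := by
          rw [polyEdge, if_neg (by omega), if_neg (by omega)]
          rintro t ⟨-, ht⟩
          change 0 * t.1 + 1 / (V j).2 * t.2 = 1
          rw [ht]
          field_simp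
          ring
        refine ⟨(0, 1 / (V j).2), ?_, hw1, h.1 (j + 1) (by omega) le_rfl _ hsub⟩
        simp only
        field_simp
        ring
      · obtain ⟨v, hv⟩ := hV.exists_weight_of_edge (show 1 ≤ j + 1 by omega) hlt
        obtain ⟨h1, h2, h3, h4, h5⟩ := hV.weight_of_edge hfin (show 1 ≤ j + 1 by omega) hlt hv
        rw [Nat.add_sub_cancel] at h3
        refine ⟨v, h3, ?_, h.1 (j + 1) (by omega) (by omega) v hv⟩
        have hy := hV.snd_lt (show j < j + 1 by omega) hlt
        have hx := hV.fst_lt (show j < j + 1 by omega) hlt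
        have hge1 := hge (j + 1) hlt
        by_contra hcon
        push Not at hcon
        have e1 : w.2 * ((V j).2 - (V (j + 1)).2) ≤ w.1 * ((V (j + 1)).1 - (V j).1) := by linarith
        have e2 : v.2 * ((V j).2 - (V (j + 1)).2) = v.1 * ((V (j + 1)).1 - (V j).1) := by linarith
        have e3 : w.1 * ((V (j + 1)).1 - (V j).1) < v.1 * ((V (j + 1)).1 - (V j).1) :=
          mul_lt_mul_of_pos_right hcon (by linarith)
        have e4 : w.2 < v.2 := by
          refine lt_of_mul_lt_mul_right (a := (V j).2 - (V (j + 1)).2) ?_ (by linarith)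
          linarith
        have e5 : w.2 * (V j).2 < v.2 * (V j).2 := mul_lt_mul_of_pos_right e4 hxpos
        have e6 : w.1 * (V j).1 ≤ v.1 * (V j).1 := mul_le_mul_of_nonneg_right hcon.le x1
        linarith
    exact WeightCond.interpolate hxpos hux hvx hj1 hvw hwu1 hcu hcv

end System

end Edges

/-! ### Relations between the conditions -/

lemma recip_top : recip ⊤ = 0 := by simp [recip]

lemma recip_le_one_div_iff {q : ℝ≥0∞} (hq : 1 ≤ q) {r : ℝ} (hr : 0 < r) :
    recip q ≤ 1 / r ↔ ENNReal.ofReal r ≤ q := by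
  -- The bound q ≥ 1 excludes q = 0, whose inverse `toReal` would send to 0.
  have hfin : q⁻¹ ≠ ⊤ := ENNReal.inv_ne_top.2 (one_pos.trans_le hq).ne'
  rw [recip, one_div, ← ENNReal.le_ofReal_iff_toReal_le hfin (by positivity),
    ENNReal.ofReal_inv_of_pos hr, ENNReal.inv_le_inv]

lemma recip_le_half_iff {q : ℝ≥0∞} (hq : 1 ≤ q) : recip q ≤ 1 / 2 ↔ 2 ≤ q := by
  simpa using recip_le_one_div_iff hq (two_pos : (0 : ℝ) < 2)

lemma distanceCond_top_right_iff {φ : ℝ × ℝ → ℝ} (hd : 0 < newtonDistance φ) {q : ℝ≥0∞}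
    (hq : 1 ≤ q) : DistanceCond φ q ⊤ ↔ 2 ≤ q := by
  rw [← recip_le_half_iff hq, DistanceCond, recip_top, add_zero, ← one_div_mul_one_div_rev]
  exact mul_le_mul_iff_right₀ (by positivity)

lemma heightCond_top {φ : ℝ × ℝ → ℝ} (hh : 0 < newtonHeight φ) : HeightCond φ ⊤ := by
  rw [HeightCond, recip_top]
  positivity

lemma heightCond_iff {φ : ℝ × ℝ → ℝ} (hh : 0 < newtonHeight φ) {q : ℝ≥0∞} (hq : 1 ≤ q) :
    HeightCond φ q ↔ ENNReal.ofReal (2 * newtonHeight φ) ≤ q :=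
  recip_le_one_div_iff hq (by positivity)

lemma HeightCond.distanceCond_top_left {φ : ℝ × ℝ → ℝ} (hd : 0 < newtonDistance φ)
    (hdh : newtonDistance φ ≤ newtonHeight φ) {q : ℝ≥0∞} (h : HeightCond φ q) :
    DistanceCond φ ⊤ q := by
  rw [DistanceCond, recip_top, mul_zero, zero_add]
  refine h.trans ?_
  gcongr

section Edges

variable {g : ℝ × ℝ → ℝ} {n : ℕ} {V : ℕ → ℝ × ℝ} {κ : ℝ × ℝ} {m : ℝ} {l₀ la : ℕ} {q₁ q₃ : ℝ≥0∞}

lemma IsSupportingWeight.one_div_newtonDistance_le {w : ℝ × ℝ}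
    (hw : IsSupportingWeight (newtonPolyhedron g) w) (hfin : FiniteType g)
    (hd : 0 < newtonDistance g) : 1 / newtonDistance g ≤ w.1 + w.2 := by
  have := hw.2.2.1 _ (newtonDistance_mem hfin)
  rw [div_le_iff₀ hd]
  simp only at this
  linarith

lemma WeightCond.of_top_right {w : ℝ × ℝ} (hm : 0 ≤ m) (hw1 : 0 ≤ w.1) (hwm : m * w.1 ≤ w.2)
    (h : recip q₁ ≤ 1 / 2) : WeightCond m w q₁ ⊤ := by
  rw [WeightCond, recip_top]
  have : (1 + m) * w.1 * recip q₁ ≤ (1 + m) * w.1 * (1 / 2) := by gcongr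
  linarith

lemma rawConds_augmentedPolyhedron_iff (hV : IsVertexList (newtonPolyhedron g) n V)
    (hfin : FiniteType g) (hκ1 : 0 < κ.1) (hκ2 : 0 < κ.2)
    (hκ : IsSupportingWeight (newtonPolyhedron g) κ) (hm : m = κ.2 / κ.1)
    (hl₀ : IsFirstIndex n V m l₀) :
    RawConds (augmentedPolyhedron κ (newtonPolyhedron g)) m q₁ q₃ ↔
      EdgeConds n V l₀ κ m q₁ q₃ := by
  have hvert := hl₀.weight_vertex hV hκ1 hκ2 hκ hm
  have hiff : ∀ w, IsSupportingWeight (augmentedPolyhedron κ (newtonPolyhedron g)) w ↔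
      IsSupportingWeight (newtonPolyhedron g) w ∧ w.1 * κ.2 ≤ w.2 * κ.1 := fun w =>
    isSupportingWeight_augmentedPolyhedron_iff hκ1 hκ2 isClosed_newtonPolyhedron
      (fun _ => nonneg_of_mem_newtonPolyhedron) hκ.2.2.2
  constructor
  · intro h
    refine ⟨fun l hl hln w hw => h w ((hiff w).2 ?_), h κ ((hiff κ).2 ⟨hκ, (mul_comm _ _).le⟩)⟩
    exact weight_of_edge_of_firstIndex_le hV hfin hκ1 hκ hl₀.1 hvert hl hln hw
  · intro h w hw
    obtain ⟨h1, h2⟩ := (hiff w).1 hw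
    exact h.weightCond hV hfin hκ1 hκ2 hκ hl₀.1 hl₀.2.1 hvert h1 h2

/-- Treats both kinds of principal face at once: the vertex V la lies on or below the bisectrix. In
the vertex case with la = 0 the edge to the left is the vertical one, which is why membership is
asserted only for la ≥ 1. -/
lemma IsPrincipalIndex.mem_polyEdge (hV : IsVertexList (newtonPolyhedron g) n V)
    (hla : IsPrincipalIndex (newtonPolyhedron g) n V la) (hn : la ≤ n) :
    (newtonDistance g ≤ (V la).1 ∧ (V la).2 ≤ newtonDistance g) ∧
      (1 ≤ la → (newtonDistance g, newtonDistance g) ∈ polyEdge n V la) := by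
  by_cases hext : (bisectrixParam (newtonPolyhedron g), bisectrixParam (newtonPolyhedron g)) ∈
      (newtonPolyhedron g).extremePoints ℝ
  · obtain ⟨-, h⟩ := hla.1 hext
    refine ⟨by rw [h]; exact ⟨le_rfl, le_rfl⟩, fun h1 => ?_⟩
    rw [polyEdge, if_neg (by omega), if_pos hn]
    change (bisectrixParam (newtonPolyhedron g), bisectrixParam (newtonPolyhedron g)) ∈ _
    rw [← h]
    exact right_mem_segment ℝ _ _
  · obtain ⟨-, h⟩ := hla.2 hext
    refine ⟨?_, fun _ => h⟩
    change (newtonDistance g, newtonDistance g) ∈ _ at h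
    rcases Nat.eq_zero_or_pos la with rfl | h1
    · rw [polyEdge, if_pos rfl] at h
      exact ⟨h.1.le, h.2⟩
    · rw [polyEdge, if_neg (by omega), if_pos hn] at h
      obtain ⟨a, b, ha, hb, hab, he⟩ := h
      have hx := hV.fst_lt (show la - 1 < la by omega) hn
      have hy := hV.snd_lt (show la - 1 < la by omega) hn
      have e1 : a * (V (la - 1)).1 + b * (V la).1 = newtonDistance g := congrArg Prod.fst he
      have e2 : a * (V (la - 1)).2 + b * (V la).2 = newtonDistance g := congrArg Prod.snd he
      obtain rfl : b = 1 - a := by linarith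
      constructor <;> nlinarith

/-- Let u be the weight of the edge with index la. Edges further right are flatter, so w₁ ≤ u₁, and
w₁ + w₂ ≥ 1/d = u₁ + u₂ since (d, d) lies on L_u and not below L_w. The condition for u therefore
implies that for w. -/
lemma edgeCond_of_principalIndex_lt (hV : IsVertexList (newtonPolyhedron g) n V)
    (hfin : FiniteType g) (hd : 0 < newtonDistance g) (hm : 0 ≤ m) (hl₀1 : 1 ≤ l₀)
    (hl₀n : l₀ ≤ n + 1) (hvert : (V (l₀ - 1)).1 < (V (l₀ - 1)).2)
    (hla : IsPrincipalIndex (newtonPolyhedron g) n V la)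
    (h : ∀ l, l₀ ≤ l → l ≤ la → EdgeCond n V m l q₁ q₃) {l : ℕ} (hl : la < l) (hln : l ≤ n + 1) :
    EdgeCond n V m l q₁ q₃ := by
  have hn : la ≤ n := by omega
  obtain ⟨⟨h1, h2⟩, hmem⟩ := hla.mem_polyEdge hV hn
  -- V (l₀ - 1) lies strictly above the bisectrix and V la does not.
  have hle : l₀ ≤ la := by
    by_contra hcon
    have e1 := hV.fst_le (show la ≤ l₀ - 1 by omega) (by omega)
    have e2 := hV.snd_le (show la ≤ l₀ - 1 by omega) (by omega)
    linarith
  obtain ⟨u, hu⟩ := hV.exists_weight_of_edge (show 1 ≤ la by omega) hn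
  obtain ⟨hu1, hu2, eu, -, husup⟩ := hV.weight_of_edge hfin (by omega) hn hu
  have hud : u.1 * newtonDistance g + u.2 * newtonDistance g = 1 := hu (hmem (by omega))
  have hcu := h la hle le_rfl u hu
  intro w hw
  have key : w.1 ≤ u.1 ∧ IsSupportingWeight (newtonPolyhedron g) w := by
    rcases eq_or_lt_of_le hln with rfl | hlt
    · obtain ⟨e1, -, -, e2⟩ := hV.weight_of_last_edge hfin hw
      exact ⟨by rw [e1]; exact hu1.le, e2⟩
    · obtain ⟨hw1, hw2, ew, -, hwsup⟩ := hV.weight_of_edge hfin (by omega) (by omega) hw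
      refine ⟨?_, hwsup⟩
      have hl1 : l - 1 ≤ n := by omega
      have hu' := husup.2.2.1 _ (hV.mem hl1)
      have hw' := hwsup.2.2.1 _ (hV.mem (show la - 1 ≤ n by omega))
      obtain ⟨n1, n2⟩ := hV.nonneg hl1
      refine fst_le_of_ratio_le (x := V (l - 1)) hu1 hu2 n1 n2 (by linarith) (by linarith) ?_
      exact ratio_le_of_points (x := V (la - 1)) (y := V (l - 1)) hu1.le hw1.le
        (hV.snd_lt (by omega) hl1) (by linarith) (by linarith)
  have hsum := key.2.one_div_newtonDistance_le hfin hd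
  have husum : u.1 + u.2 = 1 / newtonDistance g := by
    rw [eq_div_iff hd.ne']
    linarith
  rw [WeightCond] at hcu ⊢
  have hmul : (1 + m) * w.1 * recip q₁ ≤ (1 + m) * u.1 * recip q₁ := by
    have := recip_nonneg q₁
    have := key.1
    gcongr
  linarith

end Edges

lemma IsAdaptingShear.newtonDistance_lt {φ : ℝ × ℝ → ℝ} {ψ : ℝ → ℝ} (hφ : SmoothNearZero φ) (hfin : FiniteType φ)
    (hna : ¬ IsAdapted φ) (hψ : IsAdaptingShear φ ψ) :
    newtonDistance φ < newtonDistance (sheared φ ψ) := by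
  rw [hψ.2.2]
  exact lt_of_le_of_ne (newtonDistance_le_newtonHeight hφ hfin) hna

end MixedRestriction

end

/-! ### Assembly of the necessary conditions and the relations between them. -/

theorem mainTheorem3
    (Ω : Set (ℝ × ℝ)) (hΩ : IsOpen Ω) (h0Ω : (0 : ℝ × ℝ) ∈ Ω)
    (φ : ℝ × ℝ → ℝ) (hφ : ContDiffOn ℝ ∞ φ Ω)
    (hφ0 : φ 0 = 0) (hdφ0 : fderiv ℝ φ 0 = 0)
    (hfin : FiniteType φ) (hlin : IsLinearlyAdapted φ)
    (κ : ℝ × ℝ) (hκ : IsPrincipalWeight (newtonPolyhedron φ) κ) (hκle : κ.1 ≤ κ.2)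
    (m : ℝ) (hm : m = κ.2 / κ.1) :
    -- necessary conditions for the estimate
    (∀ ρ : ℝ × ℝ → ℝ, ContDiff ℝ ∞ ρ → HasCompactSupport ρ → tsupport ρ ⊆ Ω →
      (∀ x, 0 ≤ ρ x) → ρ 0 ≠ 0 →
      ∀ p₁ p₃ q₁ q₃ : ℝ≥0∞, p₁.HolderConjugate q₁ → p₃.HolderConjugate q₃ →
        RestrictionEstimate Ω φ ρ p₁ p₃ →
        DistanceCond φ q₁ q₃ ∧ HeightCond φ q₃ ∧
        (¬ IsAdapted φ → ∀ ψ : ℝ → ℝ, IsAdaptingShear φ ψ →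
          RawConds (augmentedPolyhedron κ (newtonPolyhedron (sheared φ ψ))) m q₁ q₃)) ∧
    -- relations between the conditions
    (∀ q₁ q₃ : ℝ≥0∞, 1 ≤ q₁ → 1 ≤ q₃ →
      (q₃ = ⊤ → (DistanceCond φ q₁ q₃ ∧ HeightCond φ q₃ ↔ 2 ≤ q₁)) ∧
      (q₁ = ⊤ → (DistanceCond φ q₁ q₃ ∧ HeightCond φ q₃ ↔
        ENNReal.ofReal (2 * newtonHeight φ) ≤ q₃))) ∧
    (¬ IsAdapted φ → ∀ ψ : ℝ → ℝ, IsAdaptingShear φ ψ →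
      ∀ (n : ℕ) (V : ℕ → ℝ × ℝ) (l₀ la : ℕ),
        IsVertexList (newtonPolyhedron (sheared φ ψ)) n V →
        IsFirstIndex n V m l₀ →
        IsPrincipalIndex (newtonPolyhedron (sheared φ ψ)) n V la →
        ((1 + m) * κ.1 = 1 / newtonDistance φ ∧
          (κ.1 + κ.2) / 2 = 1 / (2 * newtonDistance φ)) ∧
        ∀ q₁ q₃ : ℝ≥0∞, 1 ≤ q₁ → 1 ≤ q₃ →
          (RawConds (augmentedPolyhedron κ (newtonPolyhedron (sheared φ ψ))) m q₁ q₃ ↔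
            EdgeConds n V l₀ κ m q₁ q₃) ∧
          ((∀ l, l₀ ≤ l → l ≤ la → EdgeCond n V m l q₁ q₃) → WeightCond m κ q₁ q₃ →
            ∀ l, la < l → l ≤ n + 1 → EdgeCond n V m l q₁ q₃) ∧
          (q₃ = ⊤ →
            (EdgeConds n V l₀ κ m q₁ q₃ ∧ DistanceCond φ q₁ q₃ ∧ HeightCond φ q₃ ↔ 2 ≤ q₁)) ∧
          (q₁ = ⊤ →
            (EdgeConds n V l₀ κ m q₁ q₃ ∧ DistanceCond φ q₁ q₃ ∧ HeightCond φ q₃ ↔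
              ENNReal.ofReal (2 * newtonHeight φ) ≤ q₃))) := by
  have hs : SmoothNearZero φ := ⟨Ω, hΩ, h0Ω, hφ⟩
  have hd := newtonDistance_pos hfin hφ0
  have hdh := newtonDistance_le_newtonHeight hs hfin
  have hh := hd.trans_le hdh
  have htop₃ : ∀ q₁ : ℝ≥0∞, 1 ≤ q₁ → (DistanceCond φ q₁ ⊤ ∧ HeightCond φ ⊤ ↔ 2 ≤ q₁) :=
    fun q₁ hq => by simp [distanceCond_top_right_iff hd hq, heightCond_top hh]
  have htop₁ : ∀ q₃ : ℝ≥0∞, 1 ≤ q₃ → (DistanceCond φ ⊤ q₃ ∧ HeightCond φ q₃ ↔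
      ENNReal.ofReal (2 * newtonHeight φ) ≤ q₃) := fun q₃ hq => by
    rw [← heightCond_iff hh hq]
    exact ⟨fun h => h.2, fun h => ⟨h.distanceCond_top_left hd hdh, h⟩⟩
  refine ⟨?_, ?_, ?_⟩
  · intro ρ hρ _ _ hρnn hρ0 p₁ p₃ q₁ q₃ hp₁ hp₃ hR
    have hρpos : 0 < ρ 0 := lt_of_le_of_ne (hρnn 0) hρ0.symm
    refine ⟨hR.distanceCond hΩ h0Ω hs hfin hφ0 hρ.continuous hρpos hp₁ hp₃ hκ,
      hR.heightCond hΩ h0Ω hs hfin hφ0 hρ.continuous hρpos hp₁ hp₃, ?_⟩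
    intro hna ψ hψ w hw
    obtain ⟨hκ1, ⟨k, hk, A, hA, δ, hδ, hbound⟩, -, -, hne, -⟩ :=
      exists_order_of_newtonDistance_lt hs hfin hφ0 hψ.2.1 hψ.1 hκ hκle
        (hψ.newtonDistance_lt hs hfin hna)
    have hκ2 : 0 < κ.2 := hκ1.trans_le hκle
    obtain ⟨hsup, hr⟩ := (isSupportingWeight_augmentedPolyhedron_iff hκ1 hκ2
      isClosed_newtonPolyhedron (fun _ => nonneg_of_mem_newtonPolyhedron) hne).1 hw
    refine hR.weight_le_of_shear hΩ h0Ω hs hρ.continuous hρpos hp₁ hp₃ hψ.2.1 hψ.1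
      (hm ▸ div_pos hκ2 hκ1) (k := k) ?_ hA hδ hbound hsup.1 hsup.2.1 ?_ hsup.2.2.1
    · rw [hm, div_le_iff₀ hκ1]
      exact hk
    · rw [hm, div_mul_eq_mul_div, div_le_iff₀ hκ1]
      linarith
  · rintro q₁ q₃ hq₁ hq₃
    exact ⟨by rintro rfl; exact htop₃ q₁ hq₁, by rintro rfl; exact htop₁ q₃ hq₃⟩
  · intro hna ψ hψ n V l₀ la hV hl₀ hla
    obtain ⟨hκ1, -, hfina, hpos, hne, hup⟩ :=
      exists_order_of_newtonDistance_lt hs hfin hφ0 hψ.2.1 hψ.1 hκ hκle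
        (hψ.newtonDistance_lt hs hfin hna)
    have hκ2 : 0 < κ.2 := hκ1.trans_le hκle
    have hκa : IsSupportingWeight (newtonPolyhedron (sheared φ ψ)) κ := ⟨hκ1.le, hκ2.le, hpos, hne⟩
    have hm0 : 0 < m := hm ▸ div_pos hκ2 hκ1
    have hmκ : m * κ.1 = κ.2 := by rw [hm, div_mul_cancel₀ _ hκ1.ne']
    have hsum : κ.1 + κ.2 = 1 / newtonDistance φ := by
      have : κ.1 * newtonDistance φ + κ.2 * newtonDistance φ = 1 := hκ.2.1
      rw [eq_div_iff hd.ne']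
      linarith
    have hda : 0 < newtonDistance (sheared φ ψ) := hψ.2.2 ▸ hh
    have hvert := hl₀.weight_vertex hV hκ1 hκ2 hκa hm
    have hedge : ∀ l, l₀ ≤ l → l ≤ n + 1 → ∀ w, polyEdge n V l ⊆ weightLine w →
        IsSupportingWeight (newtonPolyhedron (sheared φ ψ)) w ∧ m * w.1 ≤ w.2 := by
      intro l hl hln w hw
      obtain ⟨h1, h2⟩ := weight_of_edge_of_firstIndex_le hV hfina hκ1 hκa hl₀.1 hvert hl hln hw
      refine ⟨h1, ?_⟩
      rw [hm, div_mul_eq_mul_div, div_le_iff₀ hκ1]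
      linarith
    refine ⟨⟨by rw [← hsum]; linarith, by rw [hsum]; field_simp⟩, ?_⟩
    intro q₁ q₃ hq₁ hq₃
    refine ⟨rawConds_augmentedPolyhedron_iff hV hfina hκ1 hκ2 hκa hm hl₀, ?_, ?_, ?_⟩
    · intro h _ l hl hln
      -- V (l₀ - 1) lies on L_κ, and all of L_κ ∩ 𝓝(φ^a) lies above the bisectrix.
      exact edgeCond_of_principalIndex_lt hV hfina hda hm0.le hl₀.1 hl₀.2.1
        (hup _ ⟨hvert, hV.mem (by have := hl₀.2.1; omega)⟩) hla h hl hln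
    · rintro rfl
      rw [htop₃ q₁ hq₁]
      refine and_iff_right_of_imp fun h => ?_
      have hr := (recip_le_half_iff hq₁).2 h
      refine ⟨fun l hl hln w hw => ?_, .of_top_right hm0.le hκ1.le hmκ.le hr⟩
      obtain ⟨h1, h2⟩ := hedge l hl hln w hw
      exact .of_top_right hm0.le h1.1 h2 hr
    · rintro rfl
      rw [htop₁ q₃ hq₃]
      refine and_iff_right_of_imp fun h => ?_
      -- Since h(φ) = d(φ^a) and every supporting weight of 𝓝(φ^a) has w₁ + w₂ ≥ 1/d(φ^a), the
      -- height condition alone gives all the others when p₁' = ∞.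
      have hr : recip q₃ ≤ 1 / newtonDistance (sheared φ ψ) / 2 := by
        have := (heightCond_iff hh hq₃).2 h
        rwa [HeightCond, ← hψ.2.2, mul_comm, ← div_div] at this
      have hcond : ∀ w, IsSupportingWeight (newtonPolyhedron (sheared φ ψ)) w →
          WeightCond m w ⊤ q₃ := by
        intro w hw
        have := hw.one_div_newtonDistance_le hfina hda
        rw [WeightCond, recip_top]
        linarith
      exact ⟨fun l hl hln w hw => hcond w (hedge l hl hln w hw).1, hcond κ hκa⟩
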